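/- Let $\mathcal H_0,\mathcal H_1$ be complex Hilbert spaces, $A_0$ and $A_1$ (possibly unbounded) selfadjoint operators in $\mathcal H_0$ and $\mathcal H_1$, $B_{01}:\mathcal H_1\to\mathcal H_0$ a bounded operator and $B_{10}=B_{01}^*$. The spectrum of $A_0$ is absolutely continuous and is the closure of an open interval $J^0=(a,b)$, $-\infty\le a<b\le\infty$, and $\sigma(A_1)\subset J^0$. **The function $K_B'$.** Let $E_0$ be the spectral measure of $A_0$ and $K_B(\mu)=B_{10}E_0((-\infty,\mu))B_{01}$. Assume that $K_B$ is differentiable on $J^0$ in operator norm and that $K_B'$ is continuous on the closure of $J^0$ and admits an analytic continuation, continuous up to $J^0$, to a simply connected domain $D^-$ of the lower half-plane which adjoins $J^0$ from below (each point of $J^0$ has a neighbourhood whose part below the real axis lies in $D^-$). Let $D^+$ be the mirror image of $D^-$ in the real axis and put $K_B'(\mu)=[K_B'(\bar\mu)]^*$ on $D^+$. Write $D^{l}=D^{\pm}$ for $l=\pm1$. **Contours.** Fix $l=\pm1$. A contour $\Gamma^l$ is a Jordan curve in $D^l$, locally rectifiable and of finite length near a finite end point, which results from a continuous deformation $F(s,t)$,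 $0\le s\le1$, $t\in\mathbb R$, of $J^0$ (at $s=0$) into $\Gamma^l$ (at $s=1$), with $F(s,t)\in D^l$ for $s>0$ and the end points $a,b$ fixed. The latter means that, uniformly in $s$, $F(s,t)$ tends to $a$ as $t\to-\infty$ and to $b$ as $t\to+\infty$ (an infinite end point being the point at infinity of the complex plane), and that for every $\varepsilon>0$ and arbitrarily near to $-\infty$ and to $+\infty$ there are $t$ for which the transversal $\tau_t:s\mapsto F(s,t)$ is Lipschitz and $\int_{\tau_t}(1+|\mu|)^{-1}\|K_B'(\mu)\|\,|d\mu|<\varepsilon$. Put $$\mathcal V_0(B,\Gamma)=\int_\Gamma|d\mu|\,\|K_B'(\mu)\|,\qquad d_0(\Gamma)=\operatorname{dist}(\sigma(A_1),\Gamma),$$ $$r_{\min}(\Gamma)=\tfrac12d_0(\Gamma)-\sqrt{\tfrac14d_0^2(\Gamma)-\mathcal V_0(B,\Gamma)},\qquad r_{\max}(\Gamma)=d_0(\Gamma)-\sqrt{\mathcal V_0(B,\Gamma)} .$$ Call $\Gamma^l$ admissible if $\mathcal V_0(B,\Gamma^l)<\infty$ and $\mathcal V_0(B,\Gamma^l)<\frac14d_0^2(\Gamma^l)$,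 and let $r_0(B)$ be the infimum of $r_{\min}(\Gamma^l)$ over all admissible contours $\Gamma^l$ in $D^l$. **The operator $H_1^{(l)}$.** Let $\Gamma^l$ be an admissible contour, let $X^{(l)}$ be a bounded operator in $\mathcal H_1$ with $\|X^{(l)}\|<r_{\max}(\Gamma^l)$ and $$X^{(l)}=\int_{\Gamma^l}d\mu\,K_B'(\mu)\,(A_1+X^{(l)}-\mu)^{-1},$$ and let $H_1^{(l)}=A_1+X^{(l)}$, with the domain of $A_1$. **The subspaces $\mathcal N_i^{(l)}$.** Assume that $A_1$ is semibounded from below and has compact resolvent and infinitely many eigenvalues, enumerated in increasing order as $\lambda_1\le\lambda_2\le\dots$, $\lambda_i\to\infty$. Let $r>r_0(B)$ and $i_0\ge2$ be such that $$\lambda_i-\lambda_{i-1}>2r\qquad\text{for all } i\ge i_0 .$$ Let $\gamma_0$ be the circle centred at $(\lambda_1+\lambda_{i_0-1})/2$ with radius $(\lambda_{i_0-1}-\lambda_1)/2+r$ and, for $i\ge i_0$, let $\gamma_i$ be the circle centred at $\lambda_i$ with radius $r$. For $i=0,i_0,i_0+1,\dots$ put $$\mathsf Q_i^{(l)}=-\frac1{2\pi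 \mathrm i}\int_{\gamma_i}(H_1^{(l)}-z)^{-1}\,dz,\qquad \mathcal N_i^{(l)}=\mathsf Q_i^{(l)}\mathcal H_1 .$$ **Claim.** The sequence of subspaces $\mathcal N_i^{(l)}$, $i=0,i_0,i_0+1,\dots$, is $\omega$-linearly independent (if $x_i\in\mathcal N_i^{(l)}$ and the series $x_0+x_{i_0}+x_{i_0+1}+\cdots$ converges in norm to $0$, then all $x_i=0$) and complete in $\mathcal H_1$ (the closed linear span of the union of the $\mathcal N_i^{(l)}$ is $\mathcal H_1$). -/

import Mathlib

open MeasureTheory Filter Topology Set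
open scoped ENNReal InnerProductSpace

noncomputable section

namespace TransferFunction

/-! ### Unbounded operators: resolvent, spectrum, eigenvalues -/

section Operators

variable {H : Type*} [NormedAddCommGroup H] [InnerProductSpace ℂ H]

/-- The bounded operator `R` is a two-sided inverse of `T - z`. -/
def IsResolventAt (T : H →ₗ.[ℂ] H) (z : ℂ) (R : H →L[ℂ] H) : Prop :=
  (∀ y : H, ∃ x : T.domain, (x : H) = R y ∧ T x - z • (x : H) = y) ∧
    ∀ x : T.domain, R (T x - z • (x : H)) = x

theorem IsResolventAt.unique {T : H →ₗ.[ℂ] H} {z : ℂ} {R S : H →L[ℂ] H}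
    (hR : IsResolventAt T z R) (hS : IsResolventAt T z S) : R = S := by
  ext y
  obtain ⟨x, hx, hxy⟩ := hR.1 y
  rw [← hx, ← hxy, hS.2 x]

/-- The resolvent set of a (possibly unbounded) operator. -/
def resolventSetOf (T : H →ₗ.[ℂ] H) : Set ℂ := {z | ∃ R, IsResolventAt T z R}

/-- The spectrum of a (possibly unbounded) operator. -/
def spectrumOf (T : H →ₗ.[ℂ] H) : Set ℂ := (resolventSetOf T)ᶜ

open Classical in
/-- The resolvent `(T - z)⁻¹`; it is given the value `0` on the spectrum. -/
def resolventOf (T : H →ₗ.[ℂ] H) (z : ℂ) : H →L[ℂ] H :=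
  if h : ∃ R, IsResolventAt T z R then h.choose else 0

theorem IsResolventAt.resolventOf_eq {T : H →ₗ.[ℂ] H} {z : ℂ} {R : H →L[ℂ] H}
    (hR : IsResolventAt T z R) : resolventOf T z = R := by
  have h : ∃ R, IsResolventAt T z R := ⟨R, hR⟩
  rw [resolventOf, dif_pos h]
  exact h.choose_spec.unique hR

/-- The set of real eigenvalues (all the eigenvalues, for a selfadjoint operator). -/
def eigenvaluesOf (T : H →ₗ.[ℂ] H) : Set ℝ :=
  {μ | ∃ x : T.domain, (x : H) ≠ 0 ∧ T x = (μ : ℂ) • (x : H)}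

/-- The operator `A + X` with domain that of `A`, for a bounded operator `X`. -/
def perturb (A : H →ₗ.[ℂ] H) (X : H →L[ℂ] H) : H →ₗ.[ℂ] H := (X : H →ₗ[ℂ] H) +ᵥ A

/-- The Riesz integral `-(2πi)⁻¹ ∮ (T - z)⁻¹ dz` over the circle of centre `c` and radius `R`. -/
def rieszProjection (T : H →ₗ.[ℂ] H) (c : ℂ) (R : ℝ) : H →L[ℂ] H :=
  (-(1 / (2 * (Real.pi : ℂ) * Complex.I))) • ∮ z in C(c, R), resolventOf T z

/-- A sequence of subspaces is `ω`-linearly independent if a convergent series of elements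
`x k ∈ N k` can have sum zero only if all the `x k` vanish. -/
def OmegaLinearIndependent (N : ℕ → Submodule ℂ H) : Prop :=
  ∀ x : ℕ → H, (∀ k, x k ∈ N k) →
    Tendsto (fun n => ∑ k ∈ Finset.range n, x k) atTop (𝓝 0) → ∀ k, x k = 0

/-- A sequence of subspaces is complete if the closed linear span of its members is the space. -/
def CompleteSequence (N : ℕ → Submodule ℂ H) : Prop :=
  (⨆ k, N k).topologicalClosure = ⊤

end Operators

/-! ### Spectral measures -/

/-- A projection-valued measure on the Borel sets of the real line. -/
structure SpectralMeasure (H : Type*) [NormedAddCommGroup H] [InnerProductSpace ℂ H]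
    [CompleteSpace H] where
  proj : Set ℝ → H →L[ℂ] H
  isStarProjection : ∀ s, MeasurableSet s → IsStarProjection (proj s)
  univ : proj Set.univ = 1
  hasSum : ∀ s : ℕ → Set ℝ, (∀ n, MeasurableSet (s n)) → Pairwise (Function.onFun Disjoint s) →
    ∀ x, HasSum (fun n => proj (s n) x) (proj (⋃ n, s n) x)

namespace SpectralMeasure

variable {H : Type*} [NormedAddCommGroup H] [InnerProductSpace ℂ H] [CompleteSpace H]

theorem inner_proj_self (E : SpectralMeasure H) (x : H) {s : Set ℝ} (hs : MeasurableSet s) :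
    ⟪x, E.proj s x⟫_ℂ = ((‖E.proj s x‖ ^ 2 : ℝ) : ℂ) := by
  have h := E.isStarProjection s hs
  have h1 : E.proj s (E.proj s x) = E.proj s x := by
    have := congrArg (fun T : H →L[ℂ] H => T x) h.isIdempotentElem.eq
    simpa using this
  have h2 := h.isSelfAdjoint.isSymmetric x (E.proj s x)
  simp only [ContinuousLinearMap.coe_coe] at h2
  rw [h1] at h2
  rw [← h2, inner_self_eq_norm_sq_to_K]
  push_cast
  rfl

theorem hasSum_norm_sq (E : SpectralMeasure H) (x : H) (s : ℕ → Set ℝ)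
    (hs : ∀ n, MeasurableSet (s n)) (hd : Pairwise (Function.onFun Disjoint s)) :
    HasSum (fun n => ‖E.proj (s n) x‖ ^ 2) (‖E.proj (⋃ n, s n) x‖ ^ 2) := by
  have h := (E.hasSum s hs hd x).mapL (innerSL ℂ x)
  simp only [innerSL_apply_apply] at h
  rw [E.inner_proj_self x (MeasurableSet.iUnion hs)] at h
  simp only [E.inner_proj_self x (hs _)] at h
  exact_mod_cast h

theorem proj_empty (E : SpectralMeasure H) : E.proj ∅ = 0 := by
  ext x
  have h := E.hasSum (fun _ => ∅) (fun _ => MeasurableSet.empty)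
    (fun _ _ _ => disjoint_bot_left) x
  exact (summable_const_iff _).1 h.summable

/-- The scalar measure `s ↦ ‖E(s) x‖² = ⟨E(s) x, x⟩`. -/
def scalarMeasure (E : SpectralMeasure H) (x : H) : Measure ℝ :=
  Measure.ofMeasurable (fun s _ => ENNReal.ofReal (‖E.proj s x‖ ^ 2))
    (by simp [E.proj_empty])
    (by
      intro s hs hd
      have h := E.hasSum_norm_sq x s hs hd
      rw [← h.tsum_eq]
      exact ENNReal.ofReal_tsum_of_nonneg (fun n => sq_nonneg _) h.summable)

theorem scalarMeasure_apply (E : SpectralMeasure H) (x : H) {s : Set ℝ} (hs : MeasurableSet s) :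
    E.scalarMeasure x s = ENNReal.ofReal (‖E.proj s x‖ ^ 2) :=
  Measure.ofMeasurable_apply s hs

/-- `E` is the spectral measure of `A`, that is `A = ∫ λ dE(λ)`: the domain of `A` consists of the
`x` with `∫ λ² d⟨E(λ)x, x⟩ < ∞`, and `⟨A x, x⟩ = ∫ λ d⟨E(λ)x, x⟩` there. -/
def IsSpectralMeasureOf (E : SpectralMeasure H) (A : H →ₗ.[ℂ] H) : Prop :=
  (∀ x : H, x ∈ A.domain ↔ ∫⁻ μ, ENNReal.ofReal (μ ^ 2) ∂(E.scalarMeasure x) < ∞) ∧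
    ∀ x : A.domain, ⟪(x : H), A x⟫_ℂ = ((∫ μ, μ ∂(E.scalarMeasure x) : ℝ) : ℂ)

/-- The spectrum is absolutely continuous: all the scalar measures are. -/
def IsAbsolutelyContinuous (E : SpectralMeasure H) : Prop :=
  ∀ x : H, E.scalarMeasure x ≪ volume

end SpectralMeasure

/-! ### The function `K_B`, its derivative, and contours -/

/-- The open real interval with (possibly infinite) end points `a` and `b`. -/
def realInterval (a b : EReal) : Set ℝ := {x | a < (x : EReal) ∧ (x : EReal) < b}

section Contours

variable {H₀ H₁ : Type*} [NormedAddCommGroup H₀] [InnerProductSpace ℂ H₀] [CompleteSpace H₀]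
  [NormedAddCommGroup H₁] [InnerProductSpace ℂ H₁] [CompleteSpace H₁]

/-- `K_B(μ) = B₁₀ E((-∞, μ)) B₀₁` with `B₁₀ = B₀₁*`. -/
def couplingFunction (E : SpectralMeasure H₀) (B₀₁ : H₁ →L[ℂ] H₀) (μ : ℝ) : H₁ →L[ℂ] H₁ :=
  (ContinuousLinearMap.adjoint B₀₁) ∘L (E.proj (Iio μ)) ∘L B₀₁

/-- `K'` is the derivative (in operator norm) of `K_B` on the interval `(a, b)`, is continuous
on the closure of the interval, and is continued analytically from the interval to the simply
connected domain `D` of the lower half-plane, which adjoins the interval from below. -/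
structure IsContinuedDerivative (E : SpectralMeasure H₀) (B₀₁ : H₁ →L[ℂ] H₀) (a b : EReal)
    (D : Set ℂ) (K' : ℂ → H₁ →L[ℂ] H₁) : Prop where
  isOpen : IsOpen D
  isSimplyConnected : IsSimplyConnected D
  im_neg : ∀ z ∈ D, z.im < 0
  adjoins : ∀ x ∈ realInterval a b, ∀ᶠ z in 𝓝 (x : ℂ), z.im < 0 → z ∈ D
  hasDerivAt : ∀ x ∈ realInterval a b, HasDerivAt (couplingFunction E B₀₁) (K' (x : ℂ)) x
  continuousOn_closure :
    ContinuousOn (fun x : ℝ => K' (x : ℂ)) (closure (realInterval a b))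
  continuousOn : ContinuousOn K' (D ∪ (fun x : ℝ => (x : ℂ)) '' realInterval a b)
  differentiableOn : DifferentiableOn ℂ K' D

/-- The domains `D⁻ = D` and `D⁺`, the mirror image of `D` in the real axis. -/
def signedDomain (D : Set ℂ) (l : ℤˣ) : Set ℂ :=
  if l = -1 then D else {z | (starRingEnd ℂ) z ∈ D}

/-- `K'` continued to the upper half-plane by `K'(μ) = [K'(μ̄)]*`. -/
def reflect (K' : ℂ → H₁ →L[ℂ] H₁) (μ : ℂ) : H₁ →L[ℂ] H₁ :=
  if μ.im ≤ 0 then K' μ else ContinuousLinearMap.adjoint (K' ((starRingEnd ℂ) μ))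

/-- Neighbourhoods in the plane of an end point: an infinite end point is the point at infinity. -/
def endFilter (e : EReal) : Filter ℂ :=
  if e = ⊤ ∨ e = ⊥ then Bornology.cobounded ℂ else 𝓝 ((e.toReal : ℝ) : ℂ)

/-- The variation of `K_B` along the curve `σ(s)`, `0 ≤ s ≤ 1`, with the weight `(1 + |μ|)⁻¹`. -/
def weightedVariation (K : ℂ → H₁ →L[ℂ] H₁) (σ : ℝ → ℂ) : ℝ≥0∞ :=
  ∫⁻ s in Icc (0 : ℝ) 1, ‖K (σ s)‖ₑ * ‖deriv σ s‖ₑ / (1 + ‖σ s‖ₑ)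

/-- `F` is a continuous deformation, within `D` and with the end points fixed, of the interval
`(a, b)` into the curve `γ`. The end points (finite or not) stay fixed in the sense that
`F s t` tends to the end point as `t → ±∞`, uniformly in `s`, and that arbitrarily near to each of
them there are transversals `s ↦ F s t` of arbitrarily small weighted variation. -/
structure IsDeformation (K : ℂ → H₁ →L[ℂ] H₁) (D : Set ℂ) (a b : EReal) (γ : ℝ → ℂ)
    (F : ℝ → ℝ → ℂ) : Prop where
  continuousOn : ContinuousOn (fun p : ℝ × ℝ => F p.1 p.2) (Icc (0 : ℝ) 1 ×ˢ Set.univ)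
  source : ∃ φ : ℝ → ℝ, StrictMono φ ∧ range φ = realInterval a b ∧ ∀ t, F 0 t = (φ t : ℂ)
  target : ∀ t, F 1 t = γ t
  mem : ∀ s ∈ Ioc (0 : ℝ) 1, ∀ t, F s t ∈ D
  left : Tendsto (fun p : ℝ × ℝ => F p.1 p.2) (𝓟 (Icc (0 : ℝ) 1) ×ˢ atBot) (endFilter a)
  right : Tendsto (fun p : ℝ × ℝ => F p.1 p.2) (𝓟 (Icc (0 : ℝ) 1) ×ˢ atTop) (endFilter b)
  left_small : ∀ ε > 0, ∃ᶠ t in atBot,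
    (∃ C, LipschitzOnWith C (fun s => F s t) (Icc 0 1)) ∧
      weightedVariation K (fun s => F s t) < ε
  right_small : ∀ ε > 0, ∃ᶠ t in atTop,
    (∃ C, LipschitzOnWith C (fun s => F s t) (Icc 0 1)) ∧
      weightedVariation K (fun s => F s t) < ε

/-- A (locally) rectifiable Jordan curve in `D` which results from a continuous deformation of the
interval `(a, b)`, the end points being fixed. It is parametrized by the real line in a locally
Lipschitz way (e.g. through the arc length), and has finite length near a finite end point. -/
structure IsContour (K : ℂ → H₁ →L[ℂ] H₁) (D : Set ℂ) (a b : EReal) (γ : ℝ → ℂ) : Prop where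
  locallyLipschitz : LocallyLipschitz γ
  injective : Function.Injective γ
  mem : ∀ t, γ t ∈ D
  length_left : a ≠ ⊥ → ∫⁻ t in Iic (0 : ℝ), ‖deriv γ t‖ₑ < ∞
  length_right : b ≠ ⊤ → ∫⁻ t in Ici (0 : ℝ), ‖deriv γ t‖ₑ < ∞
  deformation : ∃ F, IsDeformation K D a b γ F

/-- The variation `𝒱₀(B, Γ) = ∫_Γ |dμ| ‖K'_B(μ)‖`. -/
def variation (K : ℂ → H₁ →L[ℂ] H₁) (γ : ℝ → ℂ) : ℝ≥0∞ :=
  ∫⁻ t, ‖K (γ t)‖ₑ * ‖deriv γ t‖ₑ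

/-- `d₀(Γ) = dist(σ(A₁), Γ)`. -/
def contourDist (A₁ : H₁ →ₗ.[ℂ] H₁) (γ : ℝ → ℂ) : ℝ :=
  ⨅ t : ℝ, Metric.infDist (γ t) (spectrumOf A₁)

/-- `Γ` is a `K_B`-bounded contour with `𝒱₀(B, Γ) < d₀(Γ)² / 4`. -/
def IsAdmissibleContour (A₁ : H₁ →ₗ.[ℂ] H₁) (K : ℂ → H₁ →L[ℂ] H₁) (D : Set ℂ) (a b : EReal)
    (γ : ℝ → ℂ) : Prop :=
  IsContour K D a b γ ∧ variation K γ < ∞ ∧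
    (variation K γ).toReal < 1 / 4 * contourDist A₁ γ ^ 2

/-- `r_min(Γ) = d₀(Γ)/2 - √(d₀(Γ)²/4 - 𝒱₀(B, Γ))`. -/
def rMin (A₁ : H₁ →ₗ.[ℂ] H₁) (K : ℂ → H₁ →L[ℂ] H₁) (γ : ℝ → ℂ) : ℝ :=
  contourDist A₁ γ / 2 - √(contourDist A₁ γ ^ 2 / 4 - (variation K γ).toReal)

/-- `r_max(Γ) = d₀(Γ) - √𝒱₀(B, Γ)`. -/
def rMax (A₁ : H₁ →ₗ.[ℂ] H₁) (K : ℂ → H₁ →L[ℂ] H₁) (γ : ℝ → ℂ) : ℝ :=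
  contourDist A₁ γ - √(variation K γ).toReal

/-- `r₀(B)`: the infimum of `r_min(Γ)` over the contours in `D` with `𝒱₀(B, Γ) < d₀(Γ)² / 4`. -/
def rZero (A₁ : H₁ →ₗ.[ℂ] H₁) (K : ℂ → H₁ →L[ℂ] H₁) (D : Set ℂ) (a b : EReal) : ℝ :=
  sInf (rMin A₁ K '' {γ | IsAdmissibleContour A₁ K D a b γ})

/-- `V₁(Y, Γ) = ∫_Γ dμ K'_B(μ) (Y - μ)⁻¹`. -/
def transferIntegral (K : ℂ → H₁ →L[ℂ] H₁) (γ : ℝ → ℂ) (Y : H₁ →ₗ.[ℂ] H₁) : H₁ →L[ℂ] H₁ :=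
  ∫ t : ℝ, deriv γ t • (K (γ t) ∘L resolventOf Y (γ t))

/-- `X` is the solution of `X = V₁(A₁ + X, Γ)` with `‖X‖ < r_max(Γ)`. -/
def IsBasicSolution (A₁ : H₁ →ₗ.[ℂ] H₁) (K : ℂ → H₁ →L[ℂ] H₁) (γ : ℝ → ℂ)
    (X : H₁ →L[ℂ] H₁) : Prop :=
  X = transferIntegral K γ (perturb A₁ X) ∧ ‖X‖ < rMax A₁ K γ

end Contours

/-! ### The circles `γ₀, γ_{i₀}, γ_{i₀+1}, …` and the subspaces `N_i` -/

/-- The `k`-th member of the list of indices `0, i₀, i₀ + 1, …`. -/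
def indexSeq (i₀ : ℕ) : ℕ → ℕ
  | 0 => 0
  | k + 1 => i₀ + k

/-- The centre of the circle `γ_i`. -/
def circleCenter (lam : ℕ → ℝ) (i₀ i : ℕ) : ℝ :=
  if i = 0 then (lam 1 + lam (i₀ - 1)) / 2 else lam i

/-- The radius of the circle `γ_i`. -/
def circleRadius (lam : ℕ → ℝ) (i₀ : ℕ) (r : ℝ) (i : ℕ) : ℝ :=
  if i = 0 then (lam (i₀ - 1) - lam 1) / 2 + r else r

/-- The range `N_i` of the Riesz projection of `T` for the circle `γ_i`. -/
def invariantSubspace {H : Type*} [NormedAddCommGroup H] [InnerProductSpace ℂ H]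
    (T : H →ₗ.[ℂ] H) (lam : ℕ → ℝ) (i₀ : ℕ) (r : ℝ) (i : ℕ) : Submodule ℂ H :=
  LinearMap.range
    (rieszProjection T (circleCenter lam i₀ i : ℂ) (circleRadius lam i₀ r i) : H →ₗ[ℂ] H)

end TransferFunction

end

namespace TransferFunction

/-! ### Primitives on simply connected domains -/

section Primitive

/-- Local primitives on balls covering `D`, glued to a fibre bundle with discrete fibre. -/
noncomputable def primitiveBundle {D : Set ℂ} (f : ℂ → ℂ) (r : D → ℝ) (hr : ∀ i, 0 < r i)
    (G : D → ℂ → ℂ) (hG : ∀ i : D, ∀ z ∈ Metric.ball (i : ℂ) (r i), HasDerivAt (G i) (f z) z) :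
    FiberBundleCore D D (WithDiscreteTopology ℂ) where
  baseSet i := {x | (x : ℂ) ∈ Metric.ball (i : ℂ) (r i)}
  isOpen_baseSet i := Metric.isOpen_ball.preimage continuous_subtype_val
  indexAt := id
  mem_baseSet_at i := Metric.mem_ball_self (hr i)
  coordChange i j x w := .toTopology _ (w.ofTopology + (G i x - G j x))
  coordChange_self i x _ v := by simp
  continuousOn_coordChange i j := by
    rintro ⟨x, w⟩ ⟨⟨hxi, hxj⟩, -⟩
    apply ContinuousAt.continuousWithinAt
    have hconst : ∀ᶠ z in 𝓝 (x : ℂ), G i z - G j z = G i x - G j x := by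
      have hx : (x : ℂ) ∈ Metric.ball (i : ℂ) (r i) ∩ Metric.ball (j : ℂ) (r j) := ⟨hxi, hxj⟩
      have ho : IsOpen (Metric.ball (i : ℂ) (r i) ∩ Metric.ball (j : ℂ) (r j)) :=
        Metric.isOpen_ball.inter Metric.isOpen_ball
      have hc : Convex ℝ (Metric.ball (i : ℂ) (r i) ∩ Metric.ball (j : ℂ) (r j)) :=
        (convex_ball _ _).inter (convex_ball _ _)
      have hd : ∀ z ∈ Metric.ball (i : ℂ) (r i) ∩ Metric.ball (j : ℂ) (r j),
          HasDerivAt (fun z => G i z - G j z) 0 z := fun z hz => by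
        simpa using (hG i z hz.1).fun_sub (hG j z hz.2)
      filter_upwards [ho.mem_nhds hx] with z hz
      exact ho.is_const_of_deriv_eq_zero hc.isPreconnected
        (fun z hz => (hd z hz).differentiableAt.differentiableWithinAt)
        (fun z hz => (hd z hz).deriv) hz hx
    have hev : ∀ᶠ p : D × WithDiscreteTopology ℂ in 𝓝 (x, w),
        (WithTopology.toTopology ⊥ (p.2.ofTopology + (G i p.1 - G j p.1)) :
          WithDiscreteTopology ℂ) =
          WithTopology.toTopology ⊥ (w.ofTopology + (G i x - G j x)) := by
      have h1 : ∀ᶠ p : D × WithDiscreteTopology ℂ in 𝓝 (x, w), p.2 = w := by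
        have : Tendsto Prod.snd (𝓝 (x, w)) (𝓝 w) := continuous_snd.continuousAt
        rw [nhds_discrete (WithDiscreteTopology ℂ)] at this
        exact tendsto_pure.1 this
      have h2 : ∀ᶠ p : D × WithDiscreteTopology ℂ in 𝓝 (x, w),
          G i p.1 - G j p.1 = G i x - G j x :=
        ((continuous_subtype_val.comp continuous_fst).tendsto (x, w)).eventually hconst
      filter_upwards [h1, h2] with p hp1 hp2
      rw [hp1, hp2]
    exact (continuousAt_const).congr (hev.mono fun p hp => hp.symm)
  coordChange_comp i j k x _ v := by
    simp only [WithTopology.toTopology.injEq]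
    ring

/-- A holomorphic function on a simply connected domain has a primitive. -/
theorem exists_primitive {D : Set ℂ} (hD : IsOpen D) (hs : IsSimplyConnected D) {f : ℂ → ℂ}
    (hf : DifferentiableOn ℂ f D) : ∃ G : ℂ → ℂ, ∀ z ∈ D, HasDerivAt G (f z) z := by
  classical
  have := hs.simplyConnectedSpace
  have := hD.locallyPathConnectedSpace
  have h1 : ∀ i : D, ∃ r > 0, ∃ G : ℂ → ℂ, ∀ z ∈ Metric.ball (i : ℂ) r,
      HasDerivAt G (f z) z := fun i => by
    obtain ⟨r, hr, hb⟩ := Metric.isOpen_iff.1 hD i i.2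
    obtain ⟨G, hG⟩ := (hf.mono hb).isExactOn_ball
    exact ⟨r, hr, G, hG⟩
  choose r hr G hG using h1
  let Z := primitiveBundle f r hr G hG
  have hcov : IsCoveringMap (Bundle.TotalSpace.proj : Z.TotalSpace → D) :=
    FiberBundle.isCoveringMap (F := WithDiscreteTopology ℂ) (E := Z.Fiber)
  obtain ⟨x₀⟩ : Nonempty D := hs.nonempty.to_subtype
  obtain ⟨s, ⟨-, hs⟩, -⟩ := hcov.existsUnique_continuousMap_lifts (ContinuousMap.id D) x₀
    ⟨x₀, (.toTopology _ 0 : WithDiscreteTopology ℂ)⟩ rfl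
  have hproj : ∀ x, (s x).proj = x := fun x => congrFun hs x
  let v : D → ℂ := fun x =>
    WithTopology.ofTopology ((s x).snd : WithDiscreteTopology ℂ) + G (s x).proj x
  refine ⟨fun z => if h : z ∈ D then v ⟨z, h⟩ else 0, fun z hz => ?_⟩
  let i : D := ⟨z, hz⟩
  have hcont : ContinuousAt (fun x : D => (Z.localTriv i (s x)).2) i := by
    refine continuous_snd.continuousAt.comp (ContinuousAt.comp ?_ s.continuous.continuousAt)
    apply (Z.localTriv i).continuousAt
    simp only [FiberBundleCore.mem_localTriv_source, hproj]
    exact Metric.mem_ball_self (hr i)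
  have hev : ∀ᶠ x : D in 𝓝 i, (Z.localTriv i (s x)).2 = (Z.localTriv i (s i)).2 := by
    rw [ContinuousAt, nhds_discrete (WithDiscreteTopology ℂ)] at hcont
    exact tendsto_pure.1 hcont
  have hval : ∀ x : D, ((Z.localTriv i (s x)).2).ofTopology = v x - G i x := fun x => by
    have : (Z.localTriv i (s x)).2 = Z.coordChange (s x).proj i (s x).proj (s x).snd := rfl
    rw [this]
    change _ + (G (s x).proj (s x).proj - G i (s x).proj) = _ + _ - _
    rw [hproj]
    ring
  have hev2 : ∀ᶠ w in 𝓝 z, (if h : w ∈ D then v ⟨w, h⟩ else 0) = G i w + (v i - G i z) := by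
    have h2 : ∀ᶠ w in 𝓝 z, ∀ h : w ∈ D, v ⟨w, h⟩ = G i w + (v i - G i z) := by
      have : 𝓝 z = map ((↑) : D → ℂ) (𝓝 i) := (map_nhds_subtype_coe_eq_nhds hz (hD.mem_nhds hz)).symm
      rw [this, eventually_map]
      filter_upwards [hev] with x hx h
      have h3 := congrArg WithTopology.ofTopology hx
      rw [hval, hval] at h3
      change v x = _
      linear_combination h3
    filter_upwards [h2, hD.mem_nhds hz] with w hw hwD
    rw [dif_pos hwD, hw hwD]
  refine HasDerivAt.congr_of_eventuallyEq ?_ hev2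
  exact (hG i z (Metric.mem_ball_self (hr i))).add_const _

end Primitive

/-! ### Integration along Lipschitz curves -/

section Curves

variable {f G : ℂ → ℂ} {D : Set ℂ}

theorem locallyLipschitzOn_of_hasDerivAt (hD : IsOpen D) (hf : ContinuousOn f D)
    (hG : ∀ z ∈ D, HasDerivAt G (f z) z) {z : ℂ} (hz : z ∈ D) :
    ∃ C, ∃ U ∈ 𝓝 z, LipschitzOnWith C G U := by
  have h1 : ∀ᶠ w in 𝓝 z, ‖f w‖₊ ≤ ‖f z‖₊ + 1 :=
    ((hf.continuousAt (hD.mem_nhds hz)).nnnorm.eventually_lt continuousAt_const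
      (lt_add_one _)).mono fun _ h => h.le
  obtain ⟨δ, hδ, hball⟩ := Metric.eventually_nhds_iff_ball.1 (h1.and (hD.mem_nhds hz))
  exact ⟨_, _, Metric.ball_mem_nhds z hδ,
    (convex_ball z δ).lipschitzOnWith_of_nnnorm_hasDerivWithin_le
      (fun w hw => (hG w (hball w hw).2).hasDerivWithinAt) fun w hw => (hball w hw).1⟩

theorem exists_lipschitzOnWith_comp (hD : IsOpen D) (hf : ContinuousOn f D)
    (hG : ∀ z ∈ D, HasDerivAt G (f z) z) {τ : ℝ → ℂ} {C : NNReal} {p q : ℝ}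
    (hτ : LipschitzOnWith C τ (uIcc p q)) (hmem : ∀ s ∈ uIcc p q, τ s ∈ D) :
    ∃ C', LipschitzOnWith C' (G ∘ τ) (uIcc p q) := by
  apply LocallyLipschitzOn.exists_lipschitzOnWith_of_compact isCompact_uIcc
  intro s hs
  obtain ⟨K, U, hU, hK⟩ := locallyLipschitzOn_of_hasDerivAt hD hf hG (hmem s hs)
  have hτU : τ ⁻¹' U ∈ 𝓝[uIcc p q] s := hτ.continuousOn s hs hU
  exact ⟨K * C, τ ⁻¹' U ∩ uIcc p q, inter_mem hτU self_mem_nhdsWithin,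
    hK.comp (hτ.mono inter_subset_right) fun x hx => hx.1⟩

/-- The fundamental theorem of calculus along a Lipschitz curve. -/
theorem integral_along_curve (hD : IsOpen D) (hf : ContinuousOn f D)
    (hG : ∀ z ∈ D, HasDerivAt G (f z) z) {τ : ℝ → ℂ} {C : NNReal} {p q : ℝ}
    (hτ : LipschitzOnWith C τ (uIcc p q)) (hmem : ∀ s ∈ uIcc p q, τ s ∈ D) :
    ∫ s in p..q, f (τ s) * deriv τ s = G (τ q) - G (τ p) := by
  obtain ⟨K, hK⟩ := exists_lipschitzOnWith_comp hD hf hG hτ hmem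
  have hre : AbsolutelyContinuousOnInterval (fun s => (G (τ s)).re) p q := by
    apply LipschitzOnWith.absolutelyContinuousOnInterval (K := 1 * K)
    exact (LipschitzWith.mk_one fun z w => by
      rw [Real.dist_eq, dist_eq_norm, ← Complex.sub_re]
      exact Complex.abs_re_le_norm _).comp_lipschitzOnWith hK
  have him : AbsolutelyContinuousOnInterval (fun s => (G (τ s)).im) p q := by
    apply LipschitzOnWith.absolutelyContinuousOnInterval (K := 1 * K)
    exact (LipschitzWith.mk_one fun z w => by
      rw [Real.dist_eq, dist_eq_norm, ← Complex.sub_im]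
      exact Complex.abs_im_le_norm _).comp_lipschitzOnWith hK
  have hre' : IntervalIntegrable (fun s => ((deriv (fun s => (G (τ s)).re) s : ℝ) : ℂ)) volume p q :=
    ⟨hre.intervalIntegrable_deriv.1.ofReal, hre.intervalIntegrable_deriv.2.ofReal⟩
  have him' : IntervalIntegrable (fun s => ((deriv (fun s => (G (τ s)).im) s : ℝ) : ℂ)) volume p q :=
    ⟨him.intervalIntegrable_deriv.1.ofReal, him.intervalIntegrable_deriv.2.ofReal⟩
  have hae : ∀ᵐ s, s ∈ uIoc p q → f (τ s) * deriv τ s =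
      ((deriv (fun s => (G (τ s)).re) s : ℝ) : ℂ) +
        ((deriv (fun s => (G (τ s)).im) s : ℝ) : ℂ) * Complex.I := by
    filter_upwards [hτ.absolutelyContinuousOnInterval.boundedVariationOn.ae_differentiableAt_of_mem_uIcc]
      with s hs hsm
    have hs' := uIoc_subset_uIcc hsm
    have h1 : HasDerivAt (fun s => G (τ s)) (f (τ s) * deriv τ s) s :=
      (hG _ (hmem s hs')).comp s (hs hs').hasDerivAt
    have h2 : HasDerivAt (fun s => (G (τ s)).re) (f (τ s) * deriv τ s).re s :=
      Complex.reCLM.hasFDerivAt.comp_hasDerivAt s h1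
    have h3 : HasDerivAt (fun s => (G (τ s)).im) (f (τ s) * deriv τ s).im s :=
      Complex.imCLM.hasFDerivAt.comp_hasDerivAt s h1
    rw [h2.deriv, h3.deriv, Complex.re_add_im]
  rw [intervalIntegral.integral_congr_ae hae, intervalIntegral.integral_add
    hre' (him'.mul_const _),
    intervalIntegral.integral_mul_const, intervalIntegral.integral_ofReal,
    intervalIntegral.integral_ofReal, hre.integral_deriv_eq_sub, him.integral_deriv_eq_sub]
  apply Complex.ext <;> simp

/-- The increment of a primitive along a transversal which starts at the boundary. -/
theorem enorm_sub_le_lintegral_transversal (hD : IsOpen D) (hf : ContinuousOn f D)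
    (hG : ∀ z ∈ D, HasDerivAt G (f z) z) {τ : ℝ → ℂ} {C : NNReal}
    (hτ : LipschitzOnWith C τ (Icc 0 1)) (hmem : ∀ s ∈ Ioc (0 : ℝ) 1, τ s ∈ D)
    (hcont : Tendsto (fun s => G (τ s)) (𝓝[>] 0) (𝓝 (G (τ 0)))) :
    ‖G (τ 1) - G (τ 0)‖ₑ ≤ ∫⁻ s in Icc (0 : ℝ) 1, ‖f (τ s)‖ₑ * ‖deriv τ s‖ₑ := by
  have h1 : Tendsto (fun s => ‖G (τ 1) - G (τ s)‖ₑ) (𝓝[>] 0) (𝓝 ‖G (τ 1) - G (τ 0)‖ₑ) :=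
    (continuous_enorm.tendsto _).comp (tendsto_const_nhds.sub hcont)
  refine le_of_tendsto h1 ?_
  filter_upwards [Ioo_mem_nhdsGT (zero_lt_one' ℝ)] with s hs
  have hsub : uIcc s 1 ⊆ Icc 0 1 := by
    rw [uIcc_of_le hs.2.le]; exact Icc_subset_Icc_left hs.1.le
  rw [← integral_along_curve hD hf hG (hτ.mono hsub) (fun u hu => hmem u (by
    rw [uIcc_of_le hs.2.le] at hu; exact ⟨hs.1.trans_le hu.1, hu.2⟩)),
    intervalIntegral.integral_of_le hs.2.le]
  refine (enorm_integral_le_lintegral_enorm _).trans ?_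
  simp only [enorm_mul]
  exact lintegral_mono_set (Ioc_subset_Icc_self.trans (Icc_subset_Icc_left hs.1.le))

end Curves

/-! ### Boundary values of primitives -/

section Boundary

variable {f G : ℂ → ℂ} {D : Set ℂ} {S : Set ℝ} {o : ℝ}

theorem mem_closure_halfBall (ho : o ≠ 0) {x t δ : ℝ} (ht : (t : ℂ) ∈ Metric.ball (x : ℂ) δ) :
    (t : ℂ) ∈ closure (Metric.ball (x : ℂ) δ ∩ {z | 0 < o * z.im}) := by
  have h1 : Tendsto (fun ε : ℝ => (t : ℂ) + (ε * o : ℝ) * Complex.I) (𝓝[>] 0) (𝓝 (t : ℂ)) := by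
    have : Continuous fun ε : ℝ => (t : ℂ) + (ε * o : ℝ) * Complex.I := by fun_prop
    simpa using (this.tendsto 0).mono_left nhdsWithin_le_nhds
  refine mem_closure_of_tendsto h1 ?_
  filter_upwards [h1 (Metric.isOpen_ball.mem_nhds ht), self_mem_nhdsWithin] with ε h2 h3
  refine ⟨h2, ?_⟩
  have : 0 < o * o := mul_self_pos.2 ho
  have h3' : (0 : ℝ) < ε := h3
  simp only [mem_ofPred_eq, Complex.add_im, Complex.ofReal_im, Complex.mul_im, Complex.ofReal_re,
    Complex.I_re, Complex.I_im]
  nlinarith [mul_pos this h3']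

theorem exists_tendsto_boundary (hside : ∀ z ∈ D, 0 < o * z.im) 
    (hf : ContinuousOn f (D ∪ (fun x : ℝ => (x : ℂ)) '' S))
    (hG : ∀ z ∈ D, HasDerivAt G (f z) z) {x : ℝ} (hx : x ∈ S)
    (hadj : ∀ᶠ z in 𝓝 (x : ℂ), 0 < o * z.im → z ∈ D) :
    ∃ y, Tendsto G (𝓝[D] (x : ℂ)) (𝓝 y) := by
  have h1 : ∀ᶠ w in 𝓝 (x : ℂ), w ∈ D → ‖f w‖₊ ≤ ‖f x‖₊ + 1 := by
    have hc : ContinuousWithinAt f D x := (hf x (Or.inr ⟨x, hx, rfl⟩)).mono subset_union_left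
    have := hc.nnnorm.eventually_lt continuousWithinAt_const (lt_add_one ‖f x‖₊)
    exact (eventually_nhdsWithin_iff.1 this).mono fun _ h hw => (h hw).le
  obtain ⟨δ, hδ, hball⟩ := Metric.eventually_nhds_iff_ball.1 (h1.and hadj)
  have hU : Convex ℝ (Metric.ball (x : ℂ) δ ∩ {z | 0 < o * z.im}) := by
    refine (convex_ball _ _).inter ?_
    have : IsLinearMap ℝ fun z : ℂ => o * z.im := ⟨fun _ _ => by simp [mul_add], fun _ _ => by
      simp; ring⟩
    exact convex_halfSpace_gt this 0
  have hlip := hU.lipschitzOnWith_of_nnnorm_hasDerivWithin_le (C := ‖f x‖₊ + 1)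
      (fun w hw => (hG w ((hball w hw.1).2 hw.2)).hasDerivWithinAt)
      fun w hw => (hball w hw.1).1 ((hball w hw.1).2 hw.2)
  obtain ⟨g, hg, hgG⟩ := hlip.extend_finite_dimension
  refine ⟨g x, ((hg.continuous.tendsto x).mono_left nhdsWithin_le_nhds).congr' ?_⟩
  filter_upwards [self_mem_nhdsWithin, mem_nhdsWithin_of_mem_nhds (Metric.ball_mem_nhds _ hδ)]
    with z hz hz'
  exact (hgG ⟨hz', hside z hz⟩).symm

/-- A primitive extends continuously to the part of the boundary to which the integrand extends,
and the extension is a primitive along the boundary. -/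
theorem exists_boundary_extension (hD : IsOpen D) (hS : IsOpen S) (ho : o ≠ 0)
    (hside : ∀ z ∈ D, 0 < o * z.im) (hf : ContinuousOn f (D ∪ (fun x : ℝ => (x : ℂ)) '' S))
    (hG : ∀ z ∈ D, HasDerivAt G (f z) z)
    (hadj : ∀ x ∈ S, ∀ᶠ z in 𝓝 (x : ℂ), 0 < o * z.im → z ∈ D) :
    ∃ G' : ℂ → ℂ, (∀ z ∈ D, HasDerivAt G' (f z) z) ∧
      ContinuousOn G' (D ∪ (fun x : ℝ => (x : ℂ)) '' S) ∧
      ∀ x ∈ S, HasDerivAt (fun t : ℝ => G' t) (f x) x := by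
  have hGc : ContinuousOn G D := fun z hz => (hG z hz).continuousAt.continuousWithinAt
  have hcl : D ∪ (fun x : ℝ => (x : ℂ)) '' S ⊆ closure D := by
    rintro z (hz | ⟨x, hx, rfl⟩)
    · exact subset_closure hz
    · obtain ⟨δ, hδ, hball⟩ := Metric.eventually_nhds_iff_ball.1 (hadj x hx)
      exact closure_mono (fun w hw => hball w hw.1 hw.2)
        (mem_closure_halfBall ho (Metric.mem_ball_self hδ))
  have hcont : ContinuousOn (extendFrom D G) (D ∪ (fun x : ℝ => (x : ℂ)) '' S) := by
    refine continuousOn_extendFrom hcl ?_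
    rintro z (hz | ⟨x, hx, rfl⟩)
    · exact ⟨_, hGc z hz⟩
    · exact exists_tendsto_boundary hside hf hG hx (hadj x hx)
  have hder : ∀ z ∈ D, HasDerivAt (extendFrom D G) (f z) z := fun z hz =>
    (hG z hz).congr_of_eventuallyEq <| by
      filter_upwards [hD.mem_nhds hz] with w hw
      exact extendFrom_extends hGc w hw
  refine ⟨extendFrom D G, hder, hcont, fun x hx => ?_⟩
  have hSx : ∀ᶠ z in 𝓝 (x : ℂ), z.re ∈ S :=
    Complex.continuous_re.continuousAt.eventually (hS.mem_nhds (by simpa using hx))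
  obtain ⟨δ, hδ, hball⟩ := Metric.eventually_nhds_iff_ball.1 ((hadj x hx).and hSx)
  have hlin : IsLinearMap ℝ fun z : ℂ => o * z.im := ⟨fun _ _ => by simp [mul_add], fun _ _ => by
      simp; ring⟩
  have hcim : Continuous fun z : ℂ => o * z.im := continuous_const.mul Complex.continuous_im
  set U : Set ℂ := Metric.ball (x : ℂ) (δ / 2) ∩ {z | 0 < o * z.im} with hU
  have hUD : U ⊆ D := fun w hw =>
    (hball w (Metric.ball_subset_ball (by linarith) hw.1)).1 hw.2
  have hUc : closure U ⊆ D ∪ (fun x : ℝ => (x : ℂ)) '' S := by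
    intro w hw
    have h1 : w ∈ Metric.ball (x : ℂ) δ :=
      Metric.closedBall_subset_ball (by linarith)
        (Metric.closure_ball_subset_closedBall (closure_mono inter_subset_left hw))
    have h2 : 0 ≤ o * w.im := by
      have : closure U ⊆ {z | 0 ≤ o * z.im} :=
        closure_minimal (fun z hz => show 0 ≤ o * z.im from le_of_lt hz.2) (isClosed_le continuous_const hcim)
      exact this hw
    rcases h2.eq_or_lt with h3 | h3
    · right
      have h4 : w.im = 0 := by
        rcases mul_eq_zero.1 h3.symm with h | h
        · exact absurd h ho
        · exact h
      exact ⟨w.re, (hball w h1).2, Complex.ext (by simp) (by simp [h4])⟩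
    · exact Or.inl ((hball w h1).1 h3)
  have key := hasFDerivWithinAt_closure_of_tendsto_fderiv (f := extendFrom D G) (s := U)
    (x := (x : ℂ)) (f' := (ContinuousLinearMap.toSpanSingleton ℂ (f x)).restrictScalars ℝ)
    (fun z hz => ((hder z (hUD hz)).differentiableAt.restrictScalars ℝ).differentiableWithinAt)
    ((convex_ball _ _).inter (convex_halfSpace_gt hlin 0))
    (Metric.isOpen_ball.inter (isOpen_lt continuous_const hcim))
    (fun y hy => (hcont y (hUc hy)).mono (subset_closure.trans hUc)) (by
      have h1 : Tendsto f (𝓝[U] (x : ℂ)) (𝓝 (f x)) :=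
        (hf x (Or.inr ⟨x, hx, rfl⟩)).mono (subset_closure.trans hUc)
      have h2 : Continuous fun c : ℂ =>
          (ContinuousLinearMap.toSpanSingleton ℂ c).restrictScalars ℝ := by
        have := (ContinuousLinearMap.restrictScalarsL ℂ ℂ ℂ ℝ ℂ).continuous.comp
          (ContinuousLinearMap.toSpanSingletonCLE (𝕜 := ℂ) (E := ℂ)).continuous
        exact this
      refine ((h2.tendsto (f x)).comp h1).congr' ?_
      filter_upwards [self_mem_nhdsWithin] with z hz
      exact ((hder z (hUD hz)).hasFDerivAt.restrictScalars ℝ).fderiv.symm)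
  have hball' : ∀ᶠ t : ℝ in 𝓝 x, (t : ℂ) ∈ closure U := by
    have : ∀ᶠ t : ℝ in 𝓝 x, (t : ℂ) ∈ Metric.ball (x : ℂ) (δ / 2) :=
      Complex.continuous_ofReal.continuousAt.eventually (Metric.ball_mem_nhds _ (half_pos hδ))
    exact this.mono fun t ht => mem_closure_halfBall ho ht
  have h3 := key.comp_hasDerivWithinAt (f := fun t : ℝ => (t : ℂ))
    (s := (fun t : ℝ => (t : ℂ)) ⁻¹' closure U) x
    (Complex.ofRealCLM.hasDerivAt (x := x)).hasDerivWithinAt (fun t ht => ht)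
  have h4 := h3.hasDerivAt hball'
  simpa [Function.comp_def] using h4

end Boundary

/-! ### Products of simple poles -/

section Poles

/-- The product of the functions `z ↦ (x - z)⁻¹` for the `x` in the list. -/
noncomputable def poleProduct (L : List ℝ) (z : ℂ) : ℂ := (L.map fun x : ℝ => ((x : ℂ) - z)⁻¹).prod

@[simp] theorem poleProduct_nil (z : ℂ) : poleProduct [] z = 1 := rfl

@[simp] theorem poleProduct_cons (x : ℝ) (L : List ℝ) (z : ℂ) :
    poleProduct (x :: L) z = ((x : ℂ) - z)⁻¹ * poleProduct L z := by simp [poleProduct]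

theorem differentiableAt_poleProduct {L : List ℝ} {z : ℂ} (h : ∀ x ∈ L, (x : ℂ) ≠ z) :
    DifferentiableAt ℂ (poleProduct L) z := by
  induction L with
  | nil => exact differentiableAt_const (1 : ℂ)
  | cons x L ih =>
    have h1 : DifferentiableAt ℂ (fun z => ((x : ℂ) - z)⁻¹) z :=
      (differentiableAt_id.const_sub _).inv (sub_ne_zero.2 (h x (by simp)))
    have h2 := h1.mul (ih fun y hy => h y (by simp [hy]))
    refine h2.congr_of_eventuallyEq (Eventually.of_forall fun w => ?_)
    simp

theorem norm_poleProduct_le {L : List ℝ} {z : ℂ} {d : ℝ} (hd : 0 < d)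
    (h : ∀ x ∈ L, d ≤ ‖(x : ℂ) - z‖) : ‖poleProduct L z‖ ≤ d⁻¹ ^ L.length := by
  induction L with
  | nil => simp
  | cons x L ih =>
    rw [poleProduct_cons, norm_mul, List.length_cons, pow_succ', norm_inv]
    gcongr
    · exact h x (by simp)
    · exact ih fun y hy => h y (by simp [hy])

theorem endFilter_of_ne {e : EReal} (h : ¬(e = ⊤ ∨ e = ⊥)) :
    endFilter e = 𝓝 ((e.toReal : ℝ) : ℂ) := by rw [endFilter, if_neg h]

theorem exists_eventually_norm_inv_le {e : EReal} {x : ℝ} (hx : (x : EReal) ≠ e) :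
    ∃ C, ∀ᶠ z in endFilter e, (x : ℂ) ≠ z ∧ ‖((x : ℂ) - z)⁻¹‖ * (1 + ‖z‖) ≤ C := by
  by_cases he : e = ⊤ ∨ e = ⊥
  · refine ⟨2, ?_⟩
    rw [endFilter, if_pos he]
    have h1 : ∀ᶠ z : ℂ in Bornology.cobounded ℂ, 2 * |x| + 1 ≤ ‖z‖ :=
      tendsto_norm_cobounded_atTop.eventually_ge_atTop _
    filter_upwards [h1] with z hz
    have h2 : ‖z‖ - |x| ≤ ‖(x : ℂ) - z‖ := by
      have := norm_sub_norm_le z (x : ℂ)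
      rwa [norm_sub_rev, Complex.norm_real, Real.norm_eq_abs] at this
    have h3 : 0 < ‖(x : ℂ) - z‖ := by have := abs_nonneg x; linarith
    refine ⟨fun h => by simp [h] at h3, ?_⟩
    rw [norm_inv, inv_mul_le_iff₀ h3]
    linarith
  · have he' : ((e.toReal : ℝ) : EReal) = e :=
      EReal.coe_toReal (fun h => he (Or.inl h)) (fun h => he (Or.inr h))
    have hne : (x : ℂ) ≠ ((e.toReal : ℝ) : ℂ) := fun h => hx (by
      rw [Complex.ofReal_inj.1 h, he'])
    rw [endFilter_of_ne he]
    have hc : ContinuousAt (fun z : ℂ => ‖((x : ℂ) - z)⁻¹‖ * (1 + ‖z‖)) ((e.toReal : ℝ) : ℂ) := by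
      apply ContinuousAt.mul
      · exact ((continuousAt_const.sub continuousAt_id).inv₀ (sub_ne_zero.2 hne)).norm
      · fun_prop
    refine ⟨_, (Filter.Tendsto.eventually_ne tendsto_id hne.symm |>.mono fun z hz => hz.symm).and
      ((hc.eventually_lt continuousAt_const (lt_add_one _)).mono fun z hz => hz.le)⟩

theorem exists_eventually_norm_poleProduct_le {e : EReal} {L : List ℝ} (hL : L ≠ [])
    (hx : ∀ x ∈ L, (x : EReal) ≠ e) :
    ∃ C, ∀ᶠ z in endFilter e, (∀ x ∈ L, (x : ℂ) ≠ z) ∧ ‖poleProduct L z‖ * (1 + ‖z‖) ≤ C := by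
  induction L with
  | nil => exact absurd rfl hL
  | cons x L ih =>
    obtain ⟨C₁, h₁⟩ := exists_eventually_norm_inv_le (hx x (by simp))
    rcases eq_or_ne L [] with rfl | hL'
    · exact ⟨C₁, h₁.mono fun z hz => by simpa using hz⟩
    · obtain ⟨C₂, h₂⟩ := ih hL' fun y hy => hx y (by simp [hy])
      refine ⟨C₁ * C₂, (h₁.and h₂).mono fun z hz => ⟨?_, ?_⟩⟩
      · intro y hy
        rcases List.mem_cons.1 hy with rfl | hy
        · exact hz.1.1
        · exact hz.2.1 y hy
      · rw [poleProduct_cons, norm_mul, mul_assoc]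
        have h0 : 0 ≤ ‖((x : ℂ) - z)⁻¹‖ * (1 + ‖z‖) := by positivity
        refine mul_le_mul ?_ hz.2.2 (by positivity) (h0.trans hz.1.2)
        refine le_trans ?_ hz.1.2
        exact le_mul_of_one_le_right (norm_nonneg _) (by linarith [norm_nonneg z])

end Poles

/-! ### The scalar functions `⟨y, K_B y⟩` -/

section Coupling

variable {H₀ H₁ : Type*} [NormedAddCommGroup H₀] [InnerProductSpace ℂ H₀] [CompleteSpace H₀]
  [NormedAddCommGroup H₁] [InnerProductSpace ℂ H₁] [CompleteSpace H₁]

theorem inner_couplingFunction (E : SpectralMeasure H₀) (B : H₁ →L[ℂ] H₀) (x : ℝ) (y : H₁) :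
    ⟪y, couplingFunction E B x y⟫_ℂ = ((‖E.proj (Iio x) (B y)‖ ^ 2 : ℝ) : ℂ) := by
  rw [← E.inner_proj_self (B y) measurableSet_Iio]
  simp [couplingFunction, ContinuousLinearMap.adjoint_inner_right]

theorem SpectralMeasure.norm_proj_sq_mono (E : SpectralMeasure H₀) (v : H₀) {s t : Set ℝ}
    (hs : MeasurableSet s) (ht : MeasurableSet t) (hst : s ⊆ t) :
    ‖E.proj s v‖ ^ 2 ≤ ‖E.proj t v‖ ^ 2 := by
  have h := measure_mono (μ := E.scalarMeasure v) hst
  rwa [E.scalarMeasure_apply v hs, E.scalarMeasure_apply v ht,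
    ENNReal.ofReal_le_ofReal_iff (sq_nonneg _)] at h

theorem SpectralMeasure.norm_proj_sq_le (E : SpectralMeasure H₀) (v : H₀) {s : Set ℝ}
    (hs : MeasurableSet s) : ‖E.proj s v‖ ^ 2 ≤ ‖v‖ ^ 2 := by
  have := E.norm_proj_sq_mono v hs MeasurableSet.univ (subset_univ s)
  simpa [E.univ] using this

theorem monotone_norm_proj_Iio (E : SpectralMeasure H₀) (v : H₀) :
    Monotone fun x : ℝ => ‖E.proj (Iio x) v‖ ^ 2 := fun _ _ h =>
  E.norm_proj_sq_mono v measurableSet_Iio measurableSet_Iio (Iio_subset_Iio h)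

/-- `K` is a continuation of `K_B'` to a simply connected domain `D` which adjoins the interval
from one side, given by the sign of `o`. -/
structure IsOneSidedContinuation (E : SpectralMeasure H₀) (B : H₁ →L[ℂ] H₀) (a b : EReal)
    (D : Set ℂ) (K : ℂ → H₁ →L[ℂ] H₁) (o : ℝ) : Prop where
  isOpen : IsOpen D
  isSimplyConnected : IsSimplyConnected D
  ne_zero : o ≠ 0
  side : ∀ z ∈ D, 0 < o * z.im
  adjoins : ∀ x ∈ realInterval a b, ∀ᶠ z in 𝓝 (x : ℂ), 0 < o * z.im → z ∈ D
  hasDerivAt : ∀ x ∈ realInterval a b, HasDerivAt (couplingFunction E B) (K (x : ℂ)) x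
  continuousOn : ContinuousOn K (D ∪ (fun x : ℝ => (x : ℂ)) '' realInterval a b)
  differentiableOn : DifferentiableOn ℂ K D

theorem exists_hasDerivAt_norm_proj (E : SpectralMeasure H₀) (B : H₁ →L[ℂ] H₀) {x : ℝ}
    {T : H₁ →L[ℂ] H₁} (h : HasDerivAt (couplingFunction E B) T x) (y : H₁) :
    ∃ d : ℝ, 0 ≤ d ∧ HasDerivAt (fun x : ℝ => ‖E.proj (Iio x) (B y)‖ ^ 2) d x ∧
      ⟪y, T y⟫_ℂ = d := by
  have h1 : HasDerivAt (fun x => ⟪y, couplingFunction E B x y⟫_ℂ) ⟪y, T y⟫_ℂ x :=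
    (((innerSL ℂ y).comp (ContinuousLinearMap.apply ℂ H₁ y)).restrictScalars
      ℝ).hasFDerivAt.comp_hasDerivAt x h
  simp only [inner_couplingFunction] at h1
  have h2 : HasDerivAt (fun x : ℝ => ‖E.proj (Iio x) (B y)‖ ^ 2) (⟪y, T y⟫_ℂ).re x := by
    exact Complex.reCLM.hasFDerivAt.comp_hasDerivAt x h1
  refine ⟨_, ?_, h2, ?_⟩
  · rw [← h2.deriv]
    exact (monotone_norm_proj_Iio E (B y)).deriv_nonneg
  · exact h1.unique h2.ofReal_comp

end Coupling

/-! ### Independence of the contour: scalar integrals -/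

section Scalar

theorem isOpen_realInterval (a b : EReal) : IsOpen (realInterval a b) :=
  (isOpen_Ioo (a := a) (b := b)).preimage continuous_coe_real_ereal

theorem ordConnected_realInterval (a b : EReal) : (realInterval a b).OrdConnected :=
  ⟨fun _ hx _ hy _ hz => ⟨hx.1.trans_le (EReal.coe_le_coe_iff.2 hz.1),
    (EReal.coe_le_coe_iff.2 hz.2).trans_lt hy.2⟩⟩

/-- A function on the line whose derivative is dominated by that of a real function `k` has
increments dominated by those of `k`. -/
theorem norm_sub_le_of_hasDerivAt_le {g g' : ℝ → ℂ} {k k' : ℝ → ℝ} {C : ℝ} {T : Set ℝ}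
    (hT : T.OrdConnected) (hg : ∀ x ∈ T, HasDerivAt g (g' x) x)
    (hk : ∀ x ∈ T, HasDerivAt k (k' x) x) (hle : ∀ x ∈ T, ‖g' x‖ ≤ C * k' x) {p q : ℝ}
    (hp : p ∈ T) (hq : q ∈ T) (hpq : p ≤ q) : ‖g q - g p‖ ≤ C * (k q - k p) := by
  have hsub : Icc p q ⊆ T := hT.out hp hq
  refine image_norm_le_of_norm_deriv_right_le_deriv_boundary' (f := fun x => g x - g p)
    (f' := g') (B := fun x => C * (k x - k p)) (B' := fun x => C * k' x) ?_ ?_ ?_ ?_ ?_ ?_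
    (right_mem_Icc.2 hpq)
  · exact fun x hx => ((hg x (hsub hx)).sub_const _).continuousAt.continuousWithinAt
  · exact fun x hx => ((hg x (hsub (Ico_subset_Icc_self hx))).sub_const _).hasDerivWithinAt
  · simp
  · exact fun x hx =>
      (((hk x (hsub hx)).sub_const _).const_mul C).continuousAt.continuousWithinAt
  · exact fun x hx =>
      (((hk x (hsub (Ico_subset_Icc_self hx))).sub_const _).const_mul C).hasDerivWithinAt
  · exact fun x hx => hle x (hsub (Ico_subset_Icc_self hx))

theorem exists_tendsto_of_hasDerivAt_le {g g' : ℝ → ℂ} {k k' : ℝ → ℝ} {C : ℝ} {T : Set ℝ}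
    (hT : T.OrdConnected) (hg : ∀ x ∈ T, HasDerivAt g (g' x) x)
    (hk : ∀ x ∈ T, HasDerivAt k (k' x) x) (hle : ∀ x ∈ T, ‖g' x‖ ≤ C * k' x)
    {ι : Type*} {F : Filter ι} [F.NeBot] {u : ι → ℝ} (hu : ∀ᶠ i in F, u i ∈ T) {l : ℝ}
    (hl : Tendsto (fun i => k (u i)) F (𝓝 l)) : ∃ y, Tendsto (fun i => g (u i)) F (𝓝 y) := by
  apply cauchy_map_iff_exists_tendsto.1
  have hc : Cauchy (map (fun i => k (u i)) F) := cauchy_map_iff_exists_tendsto.2 ⟨l, hl⟩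
  rw [Metric.cauchy_iff] at hc ⊢
  refine ⟨inferInstance, fun ε hε => ?_⟩
  obtain ⟨t, ht, htε⟩ := hc.2 (ε / (|C| + 1)) (by positivity)
  refine ⟨_, image_mem_map (inter_mem ht hu), ?_⟩
  have key : ∀ i j, k (u i) ∈ t → k (u j) ∈ t → u i ∈ T → u j ∈ T → u i ≤ u j →
      dist (g (u i)) (g (u j)) < ε := fun i j hi hj hi' hj' hij => by
    have h1 := norm_sub_le_of_hasDerivAt_le hT hg hk hle hi' hj' hij
    have h2 := htε _ hi _ hj
    rw [dist_comm, Real.dist_eq] at h2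
    rw [dist_comm, dist_eq_norm]
    have h3 : C * (k (u j) - k (u i)) ≤ |C| * |k (u j) - k (u i)| := by
      rw [← abs_mul]; exact le_abs_self _
    rw [lt_div_iff₀ (by positivity)] at h2
    nlinarith [abs_nonneg (k (u j) - k (u i)), abs_nonneg C]
  rintro _ ⟨i, ⟨hi, hi'⟩, rfl⟩ _ ⟨j, ⟨hj, hj'⟩, rfl⟩
  rcases le_total (u i) (u j) with h | h
  · exact key i j hi hj hi' hj' h
  · rw [dist_comm]; exact key j i hj hi hj' hi' h

end Scalar

section ScalarContour

set_option linter.unusedSectionVars false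

variable {H₀ H₁ : Type*} [NormedAddCommGroup H₀] [InnerProductSpace ℂ H₀] [CompleteSpace H₀]
  [NormedAddCommGroup H₁] [InnerProductSpace ℂ H₁] [CompleteSpace H₁]
  {E : SpectralMeasure H₀} {B : H₁ →L[ℂ] H₀} {a b : EReal} {D : Set ℂ} {K : ℂ → H₁ →L[ℂ] H₁}
  {o : ℝ} {L : List ℝ} {y : H₁} {G : ℂ → ℂ}

/-- The integrand `c(z) ⟨y, K(z) y⟩`, where `c` is a product of simple poles. -/
noncomputable def poleIntegrand (K : ℂ → H₁ →L[ℂ] H₁) (L : List ℝ) (y : H₁) (z : ℂ) : ℂ :=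
  poleProduct L z * ⟪y, K z y⟫_ℂ

theorem norm_poleIntegrand_le (K : ℂ → H₁ →L[ℂ] H₁) (L : List ℝ) (y : H₁) (z : ℂ) :
    ‖poleIntegrand K L y z‖ ≤ ‖poleProduct L z‖ * (‖y‖ ^ 2 * ‖K z‖) := by
  rw [poleIntegrand, norm_mul]
  gcongr
  refine (norm_inner_le_norm _ _).trans ?_
  have := (K z).le_opNorm y
  nlinarith [norm_nonneg y]

/-- The points of the interval which are not poles. -/
def regularPoints (a b : EReal) (L : List ℝ) : Set ℝ := {x | x ∈ realInterval a b ∧ x ∉ L}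

theorem isOpen_regularPoints (a b : EReal) (L : List ℝ) : IsOpen (regularPoints a b L) := by
  have : regularPoints a b L = realInterval a b \ {x | x ∈ L} := rfl
  rw [this]
  exact (isOpen_realInterval a b).sdiff (List.finite_toSet L).isClosed

theorem IsOneSidedContinuation.ne_of_mem (hK : IsOneSidedContinuation E B a b D K o) {z : ℂ}
    (hz : z ∈ D) (x : ℝ) : (x : ℂ) ≠ z := by
  rintro rfl
  simpa using hK.side _ hz

theorem IsOneSidedContinuation.differentiableOn_poleIntegrand
    (hK : IsOneSidedContinuation E B a b D K o) (L : List ℝ) (y : H₁) :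
    DifferentiableOn ℂ (poleIntegrand K L y) D := by
  intro z hz
  refine DifferentiableWithinAt.mul
    (differentiableAt_poleProduct fun x _ => hK.ne_of_mem hz x).differentiableWithinAt ?_
  exact ((innerSL ℂ y).comp (ContinuousLinearMap.apply ℂ H₁ y)).differentiableAt.comp_differentiableWithinAt
    z (hK.differentiableOn z hz)

theorem IsOneSidedContinuation.continuousOn_poleIntegrand
    (hK : IsOneSidedContinuation E B a b D K o) (L : List ℝ) (y : H₁) :
    ContinuousOn (poleIntegrand K L y)
      (D ∪ (fun x : ℝ => (x : ℂ)) '' regularPoints a b L) := by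
  refine ContinuousOn.mul (fun z hz => ?_) ?_
  · apply ContinuousAt.continuousWithinAt
    apply DifferentiableAt.continuousAt (𝕜 := ℂ)
    apply differentiableAt_poleProduct
    rcases hz with hz | ⟨t, ht, rfl⟩
    · exact fun x _ => hK.ne_of_mem hz x
    · rintro x hx h
      exact ht.2 (Complex.ofReal_inj.1 h ▸ hx)
  · exact ((innerSL ℂ y).comp (ContinuousLinearMap.apply ℂ H₁ y)).continuous.comp_continuousOn
      (hK.continuousOn.mono (union_subset_union_right _ (image_mono fun x hx => hx.1)))

/-- `G` is a primitive of the integrand, up to the regular points of the boundary. -/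
structure IsPrimitive (K : ℂ → H₁ →L[ℂ] H₁) (D : Set ℂ) (a b : EReal) (L : List ℝ) (y : H₁)
    (G : ℂ → ℂ) : Prop where
  hasDerivAt : ∀ z ∈ D, HasDerivAt G (poleIntegrand K L y z) z
  continuousOn : ContinuousOn G (D ∪ (fun x : ℝ => (x : ℂ)) '' regularPoints a b L)
  hasDerivAt_real : ∀ x ∈ regularPoints a b L,
    HasDerivAt (fun t : ℝ => G t) (poleIntegrand K L y x) x

theorem IsOneSidedContinuation.exists_isPrimitive
    (hK : IsOneSidedContinuation E B a b D K o) (L : List ℝ) (y : H₁) :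
    ∃ G, IsPrimitive K D a b L y G := by
  obtain ⟨G, hG⟩ := exists_primitive hK.isOpen hK.isSimplyConnected
    (hK.differentiableOn_poleIntegrand L y)
  obtain ⟨G', h1, h2, h3⟩ := exists_boundary_extension hK.isOpen (isOpen_regularPoints a b L)
    hK.ne_zero hK.side (hK.continuousOn_poleIntegrand L y) hG fun x hx => hK.adjoins x hx.1
  exact ⟨G', h1, h2, h3⟩

theorem eventually_forall_of_principal_prod {F : Filter ℝ} {s : Set ℝ} {P : ℝ × ℝ → Prop}
    (h : ∀ᶠ p in 𝓟 s ×ˢ F, P p) : ∀ᶠ t in F, ∀ u ∈ s, P (u, t) := by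
  rw [prod_comm, eventually_map] at h
  exact eventually_prod_principal_iff.1 h

/-- Arbitrarily near to an end point there are transversals along which the increment of the
primitive is arbitrarily small. -/
theorem IsPrimitive.frequently_enorm_sub_lt (hK : IsOneSidedContinuation E B a b D K o)
    (hG : IsPrimitive K D a b L y G) (hL : L ≠ []) {e : EReal} (he : ∀ x ∈ L, (x : EReal) ≠ e)
    {F : ℝ → ℝ → ℂ} {φ : ℝ → ℝ} {T : Filter ℝ} (hφ : ∀ t, φ t ∈ realInterval a b)
    (h0 : ∀ t, F 0 t = φ t) (hmem : ∀ s ∈ Ioc (0 : ℝ) 1, ∀ t, F s t ∈ D)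
    (hlim : Tendsto (fun p : ℝ × ℝ => F p.1 p.2) (𝓟 (Icc (0 : ℝ) 1) ×ˢ T) (endFilter e))
    (hsmall : ∀ ε > 0, ∃ᶠ t in T, (∃ C, LipschitzOnWith C (fun s => F s t) (Icc 0 1)) ∧
      weightedVariation K (fun s => F s t) < ε) {ε : ℝ≥0∞} (hε : 0 < ε) :
    ∃ᶠ t in T, ‖G (F 1 t) - G (F 0 t)‖ₑ < ε := by
  obtain ⟨C, hC⟩ := exists_eventually_norm_poleProduct_le hL he
  have hev := eventually_forall_of_principal_prod (hlim.eventually hC)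
  set M : NNReal := Real.toNNReal (C * ‖y‖ ^ 2) + 1 with hM
  have hM0 : (M : ℝ≥0∞) ≠ 0 := by
    rw [ENNReal.coe_ne_zero]; positivity
  refine ((hsmall (ε / M) (ENNReal.div_pos hε.ne' ENNReal.coe_ne_top)).and_eventually hev).mono ?_
  rintro t ⟨⟨⟨C', hLip⟩, hvar⟩, ht⟩
  have hcont : Tendsto (fun s => G (F s t)) (𝓝[>] 0) (𝓝 (G (F 0 t))) := by
    have hreg : φ t ∈ regularPoints a b L := by
      refine ⟨hφ t, fun hx => (ht 0 (left_mem_Icc.2 zero_le_one)).1 _ hx ?_⟩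
      simp [h0]
    have h1 : ContinuousWithinAt G (D ∪ (fun x : ℝ => (x : ℂ)) '' regularPoints a b L) (F 0 t) :=
      hG.continuousOn _ (Or.inr ⟨_, hreg, (h0 t).symm⟩)
    have h2 : Tendsto (fun s => F s t) (𝓝[>] 0)
        (𝓝[D ∪ (fun x : ℝ => (x : ℂ)) '' regularPoints a b L] (F 0 t)) := by
      rw [tendsto_nhdsWithin_iff]
      constructor
      · have := hLip.continuousOn 0 (left_mem_Icc.2 zero_le_one)
        refine Tendsto.mono_left this ?_
        rw [← nhdsWithin_Ioc_eq_nhdsGT (zero_lt_one' ℝ)]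
        exact nhdsWithin_mono _ Ioc_subset_Icc_self
      · filter_upwards [Ioc_mem_nhdsGT (zero_lt_one' ℝ)] with s hs
        exact Or.inl (hmem s hs t)
    exact h1.tendsto.comp h2
  have h1 := enorm_sub_le_lintegral_transversal hK.isOpen
    (hK.differentiableOn_poleIntegrand L y).continuousOn hG.hasDerivAt hLip
    (fun s hs => hmem s hs t) hcont
  refine h1.trans_lt ?_
  have h2 : ∫⁻ s in Icc (0 : ℝ) 1, ‖poleIntegrand K L y (F s t)‖ₑ * ‖deriv (fun s => F s t) s‖ₑ ≤
      M * weightedVariation K (fun s => F s t) := by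
    rw [weightedVariation, ← lintegral_const_mul' _ _ ENNReal.coe_ne_top]
    refine setLIntegral_mono' measurableSet_Icc fun s hs => ?_
    have hb := (ht s hs).2
    have h3 : ‖poleIntegrand K L y (F s t)‖ₑ * (1 + ‖F s t‖ₑ) ≤ M * ‖K (F s t)‖ₑ := by
      have h4 : ‖poleIntegrand K L y (F s t)‖ * (1 + ‖F s t‖) ≤ M * ‖K (F s t)‖ := by
        have h5 : C * ‖y‖ ^ 2 ≤ M := by
          rw [hM]; push_cast
          exact (Real.le_coe_toNNReal _).trans (by simp)
        calc _ ≤ ‖poleProduct L (F s t)‖ * (‖y‖ ^ 2 * ‖K (F s t)‖) * (1 + ‖F s t‖) := by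
              gcongr; exact norm_poleIntegrand_le _ _ _ _
          _ = (‖poleProduct L (F s t)‖ * (1 + ‖F s t‖)) * (‖y‖ ^ 2 * ‖K (F s t)‖) := by ring
          _ ≤ C * (‖y‖ ^ 2 * ‖K (F s t)‖) := by gcongr
          _ ≤ M * ‖K (F s t)‖ := by rw [← mul_assoc]; gcongr
      have h6 : ‖poleIntegrand K L y (F s t)‖₊ * (1 + ‖F s t‖₊) ≤ M * ‖K (F s t)‖₊ := by
        exact_mod_cast h4
      simp only [enorm_eq_nnnorm]
      exact_mod_cast h6
    have h7 : (1 + ‖F s t‖ₑ) ≠ 0 := by simp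
    have h8 : (1 + ‖F s t‖ₑ) ≠ ∞ := by simp
    rw [← mul_div_assoc, ENNReal.le_div_iff_mul_le (Or.inl h7) (Or.inl h8)]
    calc _ = ‖poleIntegrand K L y (F s t)‖ₑ * (1 + ‖F s t‖ₑ) * ‖deriv (fun s => F s t) s‖ₑ := by
          ring
      _ ≤ M * ‖K (F s t)‖ₑ * ‖deriv (fun s => F s t) s‖ₑ := by gcongr
      _ = _ := by ring
  refine h2.trans_lt ?_
  rw [mul_comm]
  exact (ENNReal.lt_div_iff_mul_lt (Or.inl hM0) (Or.inl ENNReal.coe_ne_top)).1 hvar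

theorem eq_of_frequently_enorm_sub_lt {T : Filter ℝ} {u v : ℝ → ℂ} {l m : ℂ}
    (hu : Tendsto u T (𝓝 l)) (hv : Tendsto v T (𝓝 m))
    (h : ∀ ε : ℝ≥0∞, 0 < ε → ∃ᶠ t in T, ‖u t - v t‖ₑ < ε) : l = m := by
  by_contra hne
  have h1 : Tendsto (fun t => ‖u t - v t‖ₑ) T (𝓝 ‖l - m‖ₑ) :=
    (continuous_enorm.tendsto _).comp (hu.sub hv)
  have h2 : 0 < ‖l - m‖ₑ := enorm_pos.2 (sub_ne_zero.2 hne)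
  obtain ⟨ε, hε, hε'⟩ := exists_between h2
  obtain ⟨t, ht, ht'⟩ := ((h ε hε).and_eventually (h1.eventually_const_lt hε')).exists
  exact absurd ht (not_lt.2 ht'.le)

/-- The primitive has limits at the end points of the interval, along the interval. -/
theorem IsPrimitive.exists_tendsto_end (hK : IsOneSidedContinuation E B a b D K o)
    (hG : IsPrimitive K D a b L y G) {ι : Type*} {T : Filter ι} [T.NeBot] {u : ι → ℝ}
    {V : Set ℝ} (hV : V.OrdConnected) (hVJ : V ⊆ realInterval a b) {C : ℝ}
    (hC : ∀ x ∈ V, (∀ p ∈ L, (p : ℂ) ≠ (x : ℂ)) ∧ ‖poleProduct L x‖ * (1 + ‖(x : ℂ)‖) ≤ C)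
    (hu : ∀ᶠ i in T, u i ∈ V)
    {l : ℝ} (hl : Tendsto (fun i => ‖E.proj (Iio (u i)) (B y)‖ ^ 2) T (𝓝 l)) :
    ∃ m, Tendsto (fun i => G (u i)) T (𝓝 m) := by
  have hd : ∀ x : ℝ, ∃ d : ℝ, x ∈ V →
      (0 ≤ d ∧ HasDerivAt (fun x : ℝ => ‖E.proj (Iio x) (B y)‖ ^ 2) d x ∧
        ⟪y, K x y⟫_ℂ = d) := fun x => by
    by_cases hx : x ∈ V
    · obtain ⟨d, h⟩ := exists_hasDerivAt_norm_proj E B (hK.hasDerivAt x (hVJ hx)) y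
      exact ⟨d, fun _ => h⟩
    · exact ⟨0, fun h => absurd h hx⟩
  choose d hd using hd
  refine exists_tendsto_of_hasDerivAt_le (g := fun x : ℝ => G x)
    (g' := fun x => poleIntegrand K L y x) (k := fun x : ℝ => ‖E.proj (Iio x) (B y)‖ ^ 2)
    (k' := d) (C := C) hV ?_ (fun x hx => (hd x hx).2.1) ?_ hu hl
  · exact fun x hx => hG.hasDerivAt_real x ⟨hVJ hx, fun h => (hC x hx).1 x h rfl⟩
  · intro x hx
    obtain ⟨h0, -, h2⟩ := hd x hx
    rw [poleIntegrand, h2, norm_mul, Complex.norm_real, Real.norm_of_nonneg h0]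
    gcongr
    refine le_trans ?_ (hC x hx).2
    exact le_mul_of_one_le_right (norm_nonneg _) (by linarith [norm_nonneg (x : ℂ)])

end ScalarContour

section ContourValue

set_option linter.unusedSectionVars false

variable {H₀ H₁ : Type*} [NormedAddCommGroup H₀] [InnerProductSpace ℂ H₀] [CompleteSpace H₀]
  [NormedAddCommGroup H₁] [InnerProductSpace ℂ H₁] [CompleteSpace H₁]
  {E : SpectralMeasure H₀} {B : H₁ →L[ℂ] H₀} {a b : EReal} {D : Set ℂ} {K : ℂ → H₁ →L[ℂ] H₁}
  {o : ℝ} {L : List ℝ} {y : H₁} {G : ℂ → ℂ} {γ : ℝ → ℂ} {F : ℝ → ℝ → ℂ}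

theorem IsDeformation.exists_orderIso (h : IsDeformation K D a b γ F) :
    ∃ e : ℝ ≃o realInterval a b, ∀ t, F 0 t = ((e t : ℝ) : ℂ) := by
  obtain ⟨φ, hφ, hr, h0⟩ := h.source
  have hm : ∀ t, φ t ∈ realInterval a b := fun t => by rw [← hr]; exact mem_range_self t
  refine ⟨StrictMono.orderIsoOfSurjective (fun t => (⟨φ t, hm t⟩ : realInterval a b))
    (fun s t hst => hφ hst) fun x => ?_, h0⟩
  have hx : (x : ℝ) ∈ range φ := by rw [hr]; exact x.2
  obtain ⟨t, ht⟩ := hx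
  exact ⟨t, Subtype.ext ht⟩

theorem IsPrimitive.exists_tendsto_atTop (hK : IsOneSidedContinuation E B a b D K o)
    (hG : IsPrimitive K D a b L y G) (hL : L ≠ []) (hLJ : ∀ x ∈ L, x ∈ realInterval a b)
    (h : IsDeformation K D a b γ F) :
    ∃ m, Tendsto (fun x : realInterval a b => G (x : ℝ)) atTop (𝓝 m) := by
  obtain ⟨e, he⟩ := h.exists_orderIso
  have : Nonempty (realInterval a b) := ⟨e 0⟩
  obtain ⟨C, hC⟩ := exists_eventually_norm_poleProduct_le hL fun x hx => (hLJ x hx).2.ne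
  have hev : ∀ᶠ x : realInterval a b in atTop, (∀ p ∈ L, (p : ℂ) ≠ ((x : ℝ) : ℂ)) ∧
      ‖poleProduct L (x : ℝ)‖ * (1 + ‖((x : ℝ) : ℂ)‖) ≤ C := by
    rw [← e.map_atTop, eventually_map]
    filter_upwards [eventually_forall_of_principal_prod (h.right.eventually hC)] with t ht
    simpa only [he] using ht 0 (left_mem_Icc.2 zero_le_one)
  obtain ⟨x₀, hx₀⟩ := eventually_atTop.1 hev
  refine hG.exists_tendsto_end hK (V := realInterval a b ∩ Ici (x₀ : ℝ)) (C := C)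
    ((ordConnected_realInterval a b).inter ordConnected_Ici) inter_subset_left
    (fun x hx => hx₀ ⟨x, hx.1⟩ hx.2) ?_
    (tendsto_atTop_ciSup (fun x z hxz => monotone_norm_proj_Iio E (B y) hxz) ?_)
  · filter_upwards [eventually_ge_atTop x₀] with x hx
    exact ⟨x.2, hx⟩
  · exact ⟨‖B y‖ ^ 2, by rintro _ ⟨x, rfl⟩; exact E.norm_proj_sq_le _ measurableSet_Iio⟩

theorem IsPrimitive.exists_tendsto_atBot (hK : IsOneSidedContinuation E B a b D K o)
    (hG : IsPrimitive K D a b L y G) (hL : L ≠ []) (hLJ : ∀ x ∈ L, x ∈ realInterval a b)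
    (h : IsDeformation K D a b γ F) :
    ∃ m, Tendsto (fun x : realInterval a b => G (x : ℝ)) atBot (𝓝 m) := by
  obtain ⟨e, he⟩ := h.exists_orderIso
  have : Nonempty (realInterval a b) := ⟨e 0⟩
  obtain ⟨C, hC⟩ := exists_eventually_norm_poleProduct_le hL fun x hx => (hLJ x hx).1.ne'
  have hev : ∀ᶠ x : realInterval a b in atBot, (∀ p ∈ L, (p : ℂ) ≠ ((x : ℝ) : ℂ)) ∧
      ‖poleProduct L (x : ℝ)‖ * (1 + ‖((x : ℝ) : ℂ)‖) ≤ C := by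
    rw [← e.map_atBot, eventually_map]
    filter_upwards [eventually_forall_of_principal_prod (h.left.eventually hC)] with t ht
    simpa only [he] using ht 0 (left_mem_Icc.2 zero_le_one)
  obtain ⟨x₀, hx₀⟩ := eventually_atBot.1 hev
  refine hG.exists_tendsto_end hK (V := realInterval a b ∩ Iic (x₀ : ℝ)) (C := C)
    ((ordConnected_realInterval a b).inter ordConnected_Iic) inter_subset_left
    (fun x hx => hx₀ ⟨x, hx.1⟩ hx.2) ?_
    (tendsto_atBot_ciInf (fun x z hxz => monotone_norm_proj_Iio E (B y) hxz) ?_)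
  · filter_upwards [eventually_le_atBot x₀] with x hx
    exact ⟨x.2, hx⟩
  · exact ⟨0, by rintro _ ⟨x, rfl⟩; positivity⟩

/-- The integral over a contour is the difference of the limits of the primitive at the ends of
the interval. -/
theorem IsPrimitive.integral_contour (hK : IsOneSidedContinuation E B a b D K o)
    (hG : IsPrimitive K D a b L y G) (hL : L ≠ []) (hLJ : ∀ x ∈ L, x ∈ realInterval a b)
    (hγ : IsContour K D a b γ)
    (hint : Integrable fun t => poleIntegrand K L y (γ t) * deriv γ t) {m₁ m₂ : ℂ}
    (hm₁ : Tendsto (fun x : realInterval a b => G (x : ℝ)) atBot (𝓝 m₁))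
    (hm₂ : Tendsto (fun x : realInterval a b => G (x : ℝ)) atTop (𝓝 m₂)) :
    ∫ t, poleIntegrand K L y (γ t) * deriv γ t = m₂ - m₁ := by
  obtain ⟨F, hF⟩ := hγ.deformation
  obtain ⟨e, he⟩ := hF.exists_orderIso
  have hftc : ∀ p q : ℝ, ∫ t in p..q, poleIntegrand K L y (γ t) * deriv γ t =
      G (γ q) - G (γ p) := fun p q => by
    obtain ⟨C, hC⟩ := LocallyLipschitzOn.exists_lipschitzOnWith_of_compact
      (isCompact_uIcc (a := p) (b := q))
      (LocallyLipschitzOn.mono (locallyLipschitzOn_univ.2 hγ.locallyLipschitz) (subset_univ _))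
    exact integral_along_curve hK.isOpen (hK.differentiableOn_poleIntegrand L y).continuousOn
      hG.hasDerivAt hC fun s _ => hγ.mem s
  have htop : Tendsto (fun q => G (γ q)) atTop
      (𝓝 (G (γ 0) + ∫ t in Ioi (0 : ℝ), poleIntegrand K L y (γ t) * deriv γ t)) := by
    have h1 := intervalIntegral_tendsto_integral_Ioi (0 : ℝ) hint.integrableOn tendsto_id
    simp only [hftc] at h1
    refine (tendsto_const_nhds.add h1).congr fun q => ?_
    simp
  have hbot : Tendsto (fun q => G (γ q)) atBot
      (𝓝 (G (γ 0) - ∫ t in Iic (0 : ℝ), poleIntegrand K L y (γ t) * deriv γ t)) := by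
    have h1 := intervalIntegral_tendsto_integral_Iic (0 : ℝ) hint.integrableOn tendsto_id
    simp only [hftc] at h1
    refine (tendsto_const_nhds.sub h1).congr fun q => ?_
    simp
  have e1 := eq_of_frequently_enorm_sub_lt htop
    (hm₂.comp e.tendsto_atTop) fun ε hε => by
      have := hG.frequently_enorm_sub_lt hK hL (fun x hx => (hLJ x hx).2.ne) (T := atTop)
        (φ := fun t => (e t : ℝ)) (fun t => (e t).2) he hF.mem hF.right hF.right_small hε
      simpa only [hF.target, he, Function.comp_apply] using this
  have e2 := eq_of_frequently_enorm_sub_lt hbot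
    (hm₁.comp e.tendsto_atBot) fun ε hε => by
      have := hG.frequently_enorm_sub_lt hK hL (fun x hx => (hLJ x hx).1.ne') (T := atBot)
        (φ := fun t => (e t : ℝ)) (fun t => (e t).2) he hF.mem hF.left hF.left_small hε
      simpa only [hF.target, he, Function.comp_apply] using this
  rw [← intervalIntegral.integral_Iic_add_Ioi hint.integrableOn hint.integrableOn (b := 0),
    ← e1, ← e2]
  ring

theorem IsOneSidedContinuation.integral_poleIntegrand_eq
    (hK : IsOneSidedContinuation E B a b D K o) (hL : L ≠ [])
    (hLJ : ∀ x ∈ L, x ∈ realInterval a b) {γ₁ γ₂ : ℝ → ℂ} (h₁ : IsContour K D a b γ₁)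
    (h₂ : IsContour K D a b γ₂)
    (hint₁ : Integrable fun t => poleIntegrand K L y (γ₁ t) * deriv γ₁ t)
    (hint₂ : Integrable fun t => poleIntegrand K L y (γ₂ t) * deriv γ₂ t) :
    ∫ t, poleIntegrand K L y (γ₁ t) * deriv γ₁ t =
      ∫ t, poleIntegrand K L y (γ₂ t) * deriv γ₂ t := by
  obtain ⟨G, hG⟩ := hK.exists_isPrimitive L y
  obtain ⟨F, hF⟩ := h₁.deformation
  obtain ⟨m₁, hm₁⟩ := hG.exists_tendsto_atBot hK hL hLJ hF
  obtain ⟨m₂, hm₂⟩ := hG.exists_tendsto_atTop hK hL hLJ hF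
  rw [hG.integral_contour hK hL hLJ h₁ hint₁ hm₁ hm₂,
    hG.integral_contour hK hL hLJ h₂ hint₂ hm₁ hm₂]

/-! ### Independence of the contour: operator integrals -/

theorem IsContour.aestronglyMeasurable_integrand (hKc : ContinuousOn K D)
    (hγ : IsContour K D a b γ)
    {g : ℂ → H₁ →L[ℂ] H₁} (hg : Continuous fun t => g (γ t)) :
    AEStronglyMeasurable fun t => deriv γ t • (K (γ t) ∘L g (γ t)) := by
  have h1 : Continuous fun t => K (γ t) :=
    hKc.comp_continuous hγ.locallyLipschitz.continuous hγ.mem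
  exact (stronglyMeasurable_deriv γ).aestronglyMeasurable.smul
    (h1.clm_comp hg).aestronglyMeasurable

theorem IsContour.integrable_norm (hKc : ContinuousOn K D) (hγ : IsContour K D a b γ)
    (hv : variation K γ < ∞) : Integrable fun t => ‖K (γ t)‖ * ‖deriv γ t‖ := by
  have h1 : Continuous fun t => K (γ t) :=
    hKc.comp_continuous hγ.locallyLipschitz.continuous hγ.mem
  refine ⟨h1.norm.aestronglyMeasurable.mul
    (stronglyMeasurable_deriv γ).norm.aestronglyMeasurable, ?_⟩
  simpa [HasFiniteIntegral, variation, enorm_mul] using hv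

theorem IsContour.integral_norm (hKc : ContinuousOn K D) (hγ : IsContour K D a b γ) :
    ∫ t, ‖K (γ t)‖ * ‖deriv γ t‖ = (variation K γ).toReal := by
  have h1 : Continuous fun t => K (γ t) :=
    hKc.comp_continuous hγ.locallyLipschitz.continuous hγ.mem
  have h2 : AEStronglyMeasurable fun t => ‖K (γ t)‖ * ‖deriv γ t‖ :=
    h1.norm.aestronglyMeasurable.mul (stronglyMeasurable_deriv γ).norm.aestronglyMeasurable
  rw [integral_eq_lintegral_of_nonneg_ae (Eventually.of_forall fun t => by positivity) h2,
    variation]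
  simp only [ENNReal.ofReal_mul (norm_nonneg _), ofReal_norm]

theorem norm_integrand_le (K : ℂ → H₁ →L[ℂ] H₁) (γ : ℝ → ℂ) (t : ℝ) (S : H₁ →L[ℂ] H₁) :
    ‖deriv γ t • (K (γ t) ∘L S)‖ ≤ ‖K (γ t)‖ * ‖deriv γ t‖ * ‖S‖ := by
  rw [norm_smul]
  calc _ ≤ ‖deriv γ t‖ * (‖K (γ t)‖ * ‖S‖) := by
        gcongr; exact ContinuousLinearMap.opNorm_comp_le _ _
    _ = _ := by ring

theorem IsContour.integrable_integrand (hKc : ContinuousOn K D)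
    (hγ : IsContour K D a b γ) (hv : variation K γ < ∞)
    {g : ℂ → H₁ →L[ℂ] H₁} (hg : Continuous fun t => g (γ t)) {C : ℝ} (hC : ∀ t, ‖g (γ t)‖ ≤ C) :
    Integrable fun t => deriv γ t • (K (γ t) ∘L g (γ t)) := by
  refine ((hγ.integrable_norm hKc hv).mul_const C).mono'
    (hγ.aestronglyMeasurable_integrand hKc hg) (Eventually.of_forall fun t => ?_)
  exact (norm_integrand_le K γ t _).trans (by gcongr; exact hC t)

theorem IsContour.norm_integral_le (hKc : ContinuousOn K D) (hγ : IsContour K D a b γ)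
    (hv : variation K γ < ∞) {g : ℂ → H₁ →L[ℂ] H₁} {C : ℝ} (hC : ∀ t, ‖g (γ t)‖ ≤ C) :
    ‖∫ t, deriv γ t • (K (γ t) ∘L g (γ t))‖ ≤ (variation K γ).toReal * C := by
  rw [← hγ.integral_norm hKc, ← integral_mul_const]
  exact norm_integral_le_of_norm_le ((hγ.integrable_norm hKc hv).mul_const C)
    (Eventually.of_forall fun t =>
      (norm_integrand_le K γ t _).trans (by gcongr; exact hC t))

end ContourValue

section OperatorContour

set_option linter.unusedSectionVars false

variable {H₀ H₁ : Type*} [NormedAddCommGroup H₀] [InnerProductSpace ℂ H₀] [CompleteSpace H₀]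
  [NormedAddCommGroup H₁] [InnerProductSpace ℂ H₁] [CompleteSpace H₁]
  {E : SpectralMeasure H₀} {B : H₁ →L[ℂ] H₀} {a b : EReal} {D : Set ℂ} {K : ℂ → H₁ →L[ℂ] H₁}
  {o : ℝ} {L : List ℝ} {γ₁ γ₂ : ℝ → ℂ}

/-- The integral of `K g` exists along both curves and has the same value. -/
def SameIntegral (K : ℂ → H₁ →L[ℂ] H₁) (γ₁ γ₂ : ℝ → ℂ) (g : ℂ → H₁ →L[ℂ] H₁) : Prop :=
  Integrable (fun t => deriv γ₁ t • (K (γ₁ t) ∘L g (γ₁ t))) ∧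
    Integrable (fun t => deriv γ₂ t • (K (γ₂ t) ∘L g (γ₂ t))) ∧
      ∫ t, deriv γ₁ t • (K (γ₁ t) ∘L g (γ₁ t)) = ∫ t, deriv γ₂ t • (K (γ₂ t) ∘L g (γ₂ t))

theorem SameIntegral.add {g h : ℂ → H₁ →L[ℂ] H₁} (hg : SameIntegral K γ₁ γ₂ g)
    (hh : SameIntegral K γ₁ γ₂ h) : SameIntegral K γ₁ γ₂ fun z => g z + h z := by
  simp only [SameIntegral, ContinuousLinearMap.comp_add, smul_add]
  refine ⟨hg.1.add hh.1, hg.2.1.add hh.2.1, ?_⟩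
  rw [integral_add hg.1 hh.1, integral_add hg.2.1 hh.2.1, hg.2.2, hh.2.2]

theorem sameIntegral_zero : SameIntegral K γ₁ γ₂ fun _ => 0 := by simp [SameIntegral]

theorem SameIntegral.comp_right {g : ℂ → H₁ →L[ℂ] H₁} (hg : SameIntegral K γ₁ γ₂ g)
    (T : H₁ →L[ℂ] H₁) : SameIntegral K γ₁ γ₂ fun z => g z ∘L T := by
  let Λ : (H₁ →L[ℂ] H₁) →L[ℂ] (H₁ →L[ℂ] H₁) := (ContinuousLinearMap.compL ℂ H₁ H₁ H₁).flip T
  have hΛ : ∀ S, Λ S = S ∘L T := fun S => rfl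
  have h : ∀ γ : ℝ → ℂ, (fun t => deriv γ t • (K (γ t) ∘L (g (γ t) ∘L T))) =
      fun t => Λ (deriv γ t • (K (γ t) ∘L g (γ t))) := fun γ => by
    ext t; simp [hΛ]
  rw [SameIntegral, h, h]
  refine ⟨Λ.integrable_comp hg.1, Λ.integrable_comp hg.2.1, ?_⟩
  rw [Λ.integral_comp_comm hg.1, Λ.integral_comp_comm hg.2.1, hg.2.2]

theorem IsOneSidedContinuation.continuousOn_poleProduct
    (hK : IsOneSidedContinuation E B a b D K o) (L : List ℝ) : ContinuousOn (poleProduct L) D :=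
  fun _ hz => (differentiableAt_poleProduct fun x _ =>
    hK.ne_of_mem hz x).continuousAt.continuousWithinAt

/-- The quadratic form `T ↦ ⟨y, T y⟩`. -/
noncomputable def quadraticForm (y : H₁) : (H₁ →L[ℂ] H₁) →L[ℂ] ℂ :=
  (innerSL ℂ y).comp (ContinuousLinearMap.apply ℂ H₁ y)

theorem quadraticForm_apply (y : H₁) (T : H₁ →L[ℂ] H₁) : quadraticForm y T = ⟪y, T y⟫_ℂ := rfl

theorem eq_of_quadraticForm_eq {S T : H₁ →L[ℂ] H₁}
    (h : ∀ y, quadraticForm y S = quadraticForm y T) : S = T := by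
  apply ContinuousLinearMap.coe_injective
  refine (ext_inner_map _ _).1 fun y => ?_
  have := congrArg (starRingEnd ℂ) (h y)
  simp only [quadraticForm_apply, inner_conj_symm] at this
  exact this

theorem quadraticForm_integrand (K : ℂ → H₁ →L[ℂ] H₁) (L : List ℝ) (y : H₁) (γ : ℝ → ℂ) (t : ℝ) :
    quadraticForm y (deriv γ t • (K (γ t) ∘L
      (poleProduct L (γ t) • ContinuousLinearMap.id ℂ H₁))) =
      poleIntegrand K L y (γ t) * deriv γ t := by
  have : K (γ t) ∘L (poleProduct L (γ t) • ContinuousLinearMap.id ℂ H₁) =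
      poleProduct L (γ t) • K (γ t) := by ext; simp
  rw [this, map_smul, map_smul, quadraticForm_apply, poleIntegrand, smul_eq_mul, smul_eq_mul]
  ring

theorem IsOneSidedContinuation.integrable_poleProduct
    (hK : IsOneSidedContinuation E B a b D K o) {γ : ℝ → ℂ} (h : IsContour K D a b γ)
    (hv : variation K γ < ∞) {d : ℝ} (hd : 0 < d) (hdγ : ∀ x ∈ L, ∀ t, d ≤ ‖(x : ℂ) - γ t‖) :
    Integrable (fun t => deriv γ t • (K (γ t) ∘L
        (poleProduct L (γ t) • ContinuousLinearMap.id ℂ H₁))) := by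
  refine h.integrable_integrand (hK.continuousOn.mono subset_union_left) hv
    (g := fun z => poleProduct L z • ContinuousLinearMap.id ℂ H₁)
    (((hK.continuousOn_poleProduct L).comp_continuous h.locallyLipschitz.continuous
      h.mem).smul continuous_const) (C := d⁻¹ ^ L.length) fun t => ?_
  refine (norm_smul_le _ _).trans ?_
  calc _ ≤ d⁻¹ ^ L.length * 1 := by
        gcongr
        · exact norm_poleProduct_le hd fun x hx => hdγ x hx t
        · exact ContinuousLinearMap.norm_id_le
    _ = _ := mul_one _

theorem IsOneSidedContinuation.sameIntegral_poleProduct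
    (hK : IsOneSidedContinuation E B a b D K o) (hL : L ≠ [])
    (hLJ : ∀ x ∈ L, x ∈ realInterval a b) (h₁ : IsContour K D a b γ₁)
    (h₂ : IsContour K D a b γ₂) (hv₁ : variation K γ₁ < ∞) (hv₂ : variation K γ₂ < ∞) {d : ℝ}
    (hd : 0 < d) (hd₁ : ∀ x ∈ L, ∀ t, d ≤ ‖(x : ℂ) - γ₁ t‖)
    (hd₂ : ∀ x ∈ L, ∀ t, d ≤ ‖(x : ℂ) - γ₂ t‖) (T : H₁ →L[ℂ] H₁) :
    SameIntegral K γ₁ γ₂ fun z => poleProduct L z • T := by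
  suffices h : SameIntegral K γ₁ γ₂ fun z => poleProduct L z • ContinuousLinearMap.id ℂ H₁ by
    have h' := h.comp_right T
    simpa only [ContinuousLinearMap.smul_comp, ContinuousLinearMap.id_comp] using h'
  have i₁ := hK.integrable_poleProduct h₁ hv₁ hd hd₁
  have i₂ := hK.integrable_poleProduct h₂ hv₂ hd hd₂
  refine ⟨i₁, i₂, eq_of_quadraticForm_eq fun y => ?_⟩
  have j₁ := (quadraticForm y).integrable_comp i₁
  have j₂ := (quadraticForm y).integrable_comp i₂
  rw [← (quadraticForm y).integral_comp_comm i₁, ← (quadraticForm y).integral_comp_comm i₂]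
  simp only [quadraticForm_integrand] at j₁ j₂ ⊢
  exact hK.integral_poleIntegrand_eq hL hLJ h₁ h₂ j₁ j₂

/-- Linear combinations of products of simple poles at points of `σ`. -/
inductive IsPoleSum (σ : Set ℝ) : (ℂ → H₁ →L[ℂ] H₁) → Prop
  | single (L : List ℝ) (hL : L ≠ []) (hσ : ∀ x ∈ L, x ∈ σ) (T : H₁ →L[ℂ] H₁) :
    IsPoleSum σ fun z => poleProduct L z • T
  | zero : IsPoleSum σ fun _ => 0
  | add {g h : ℂ → H₁ →L[ℂ] H₁} (hg : IsPoleSum σ g) (hh : IsPoleSum σ h) :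
    IsPoleSum σ fun z => g z + h z

theorem IsPoleSum.sum {σ : Set ℝ} {ι : Type*} (s : Finset ι) {g : ι → ℂ → H₁ →L[ℂ] H₁}
    (hg : ∀ i ∈ s, IsPoleSum σ (g i)) : IsPoleSum σ fun z => ∑ i ∈ s, g i z := by
  classical
  induction s using Finset.induction_on with
  | empty => simpa using IsPoleSum.zero
  | insert i s hi ih =>
    simp only [Finset.sum_insert hi]
    exact (hg i (by simp)).add (ih fun j hj => hg j (by simp [hj]))

/-- Multiplication by a further simple pole from the left. -/
theorem IsPoleSum.pole_comp {σ : Set ℝ} {g : ℂ → H₁ →L[ℂ] H₁} (hg : IsPoleSum σ g) {x : ℝ}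
    (hx : x ∈ σ) (T : H₁ →L[ℂ] H₁) :
    IsPoleSum σ fun z => (((x : ℂ) - z)⁻¹ • T) ∘L g z := by
  induction hg with
  | single L hL hσ S =>
    have := IsPoleSum.single (H₁ := H₁) (σ := σ) (x :: L) (by simp)
      (by simpa [hx] using hσ) (T ∘L S)
    simpa [smul_smul, mul_comm] using this
  | zero => simpa using IsPoleSum.zero
  | add _ _ ih₁ ih₂ => simpa only [ContinuousLinearMap.comp_add] using ih₁.add ih₂

theorem IsOneSidedContinuation.sameIntegral_of_isPoleSum
    (hK : IsOneSidedContinuation E B a b D K o) {σ : Set ℝ} (hσ : σ ⊆ realInterval a b)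
    (h₁ : IsContour K D a b γ₁)
    (h₂ : IsContour K D a b γ₂) (hv₁ : variation K γ₁ < ∞) (hv₂ : variation K γ₂ < ∞) {d : ℝ}
    (hd : 0 < d) (hd₁ : ∀ x ∈ σ, ∀ t, d ≤ ‖(x : ℂ) - γ₁ t‖)
    (hd₂ : ∀ x ∈ σ, ∀ t, d ≤ ‖(x : ℂ) - γ₂ t‖) {g : ℂ → H₁ →L[ℂ] H₁} (hg : IsPoleSum σ g) :
    SameIntegral K γ₁ γ₂ g := by
  induction hg with
  | single L hL hLσ T =>
    exact hK.sameIntegral_poleProduct hL (fun x hx => hσ (hLσ x hx)) h₁ h₂ hv₁ hv₂ hd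
      (fun x hx => hd₁ x (hLσ x hx)) (fun x hx => hd₂ x (hLσ x hx)) T
  | zero => exact sameIntegral_zero
  | add _ _ ih₁ ih₂ => exact ih₁.add ih₂

end OperatorContour

/-! ### Resolvents -/

section Resolvent

set_option linter.unusedSectionVars false

variable {H : Type*} [NormedAddCommGroup H] [InnerProductSpace ℂ H] [CompleteSpace H]
  {T A : H →ₗ.[ℂ] H} {z w : ℂ} {R S X Y V P : H →L[ℂ] H}

theorem isResolventAt_resolventOf (h : z ∈ resolventSetOf T) :
    IsResolventAt T z (resolventOf T z) := by
  obtain ⟨R, hR⟩ := h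
  rwa [hR.resolventOf_eq]

theorem IsResolventAt.perturb_of_inverse (hR : IsResolventAt T w R) (hY : Y = X - (z - w) • 1)
    (h₁ : (1 + Y * R) * V = 1) (h₂ : V * (1 + Y * R) = 1) :
    IsResolventAt (perturb T X) z (R * V) := by
  have hYR : ∀ u, Y u = X u - (z - w) • u := fun u => by rw [hY]; simp
  constructor
  · intro y
    obtain ⟨x, hx, hxy⟩ := hR.1 (V y)
    refine ⟨x, by simpa using hx, ?_⟩
    have e1 := congrArg (fun T : H →L[ℂ] H => T y) h₁
    simp only [mul_apply_eq_comp, add_apply,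
      one_apply_eq_self] at e1
    have e2 : perturb T X x = X (x : H) + T x := rfl
    rw [← hx, hYR] at e1
    rw [e2]
    calc X (x : H) + T x - z • (x : H) = (T x - w • (x : H)) + (X x - (z - w) • (x : H)) := by
          rw [sub_smul]; abel
      _ = y := by rw [hxy, e1]
  · intro x
    have e2 : perturb T X x = X (x : H) + T x := rfl
    have e3 := hR.2 x
    have e4 : X (x : H) + T x - z • (x : H) = (1 + Y * R) (T x - w • (x : H)) := by
      simp only [mul_apply_eq_comp, add_apply,
        one_apply_eq_self]
      rw [e3, hYR, sub_smul]; abel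
    have e5 := congrArg (fun S : H →L[ℂ] H => S (T x - w • (x : H))) h₂
    simp only [mul_apply_eq_comp, one_apply_eq_self] at e5
    rw [e2, e4, mul_apply_eq_comp]
    exact (congrArg R e5).trans e3

theorem IsResolventAt.perturb_of_isUnit (hR : IsResolventAt T w R) (hY : Y = X - (z - w) • 1)
    (h : IsUnit (1 + Y * R)) :
    IsResolventAt (perturb T X) z (R * Ring.inverse (1 + Y * R)) :=
  hR.perturb_of_inverse hY (Ring.mul_inverse_cancel _ h) (Ring.inverse_mul_cancel _ h)

theorem perturb_zero (T : H →ₗ.[ℂ] H) : perturb T (0 : H →L[ℂ] H) = T := zero_vadd _ T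

theorem IsResolventAt.shift_of_isUnit (hR : IsResolventAt T w R)
    (h : IsUnit (1 - (z - w) • R)) : IsResolventAt T z (R * Ring.inverse (1 - (z - w) • R)) := by
  have e : (1 : H →L[ℂ] H) + (0 - (z - w) • 1) * R = 1 - (z - w) • R := by
    rw [zero_sub, neg_mul, smul_mul_assoc, one_mul, ← sub_eq_add_neg]
  have := hR.perturb_of_isUnit (X := 0) (z := z) rfl (by rwa [e])
  rwa [e, perturb_zero] at this

theorem IsResolventAt.eventually_isResolventAt (hR : IsResolventAt T w R) :
    ∀ᶠ z in 𝓝 w, IsResolventAt T z (R * Ring.inverse (1 - (z - w) • R)) := by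
  have hc : Tendsto (fun z : ℂ => ‖(z - w) • R‖) (𝓝 w) (𝓝 0) := by
    have : Continuous fun z : ℂ => ‖(z - w) • R‖ := by fun_prop
    simpa using this.tendsto w
  filter_upwards [hc.eventually_lt_const zero_lt_one] with z hz
  exact hR.shift_of_isUnit (isUnit_one_sub_of_norm_lt_one hz)

theorem isOpen_resolventSetOf (T : H →ₗ.[ℂ] H) : IsOpen (resolventSetOf T) := by
  rw [isOpen_iff_mem_nhds]
  rintro w ⟨R, hR⟩
  exact hR.eventually_isResolventAt.mono fun z hz => ⟨_, hz⟩

theorem differentiableAt_resolventOf (h : w ∈ resolventSetOf T) :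
    DifferentiableAt ℂ (resolventOf T) w := by
  obtain ⟨R, hR⟩ := h
  have h1 : (fun z => R * Ring.inverse (1 - (z - w) • R)) =ᶠ[𝓝 w] resolventOf T :=
    hR.eventually_isResolventAt.mono fun z hz => hz.resolventOf_eq.symm
  refine DifferentiableAt.congr_of_eventuallyEq ?_ h1.symm
  have h2 : DifferentiableAt ℂ (fun z : ℂ => 1 - (z - w) • R) w := by fun_prop
  have h3 : DifferentiableAt ℂ (Ring.inverse : (H →L[ℂ] H) → (H →L[ℂ] H)) (1 - (w - w) • R) :=
    differentiableAt_inverse (by simp)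
  exact (h3.comp w h2).const_mul R

theorem continuousOn_resolventOf (T : H →ₗ.[ℂ] H) :
    ContinuousOn (resolventOf T) (resolventSetOf T) := fun _ hz =>
  (differentiableAt_resolventOf hz).continuousAt.continuousWithinAt

/-- The resolvent identity. -/
theorem IsResolventAt.sub_eq (hR : IsResolventAt T z R) (hS : IsResolventAt T w S) :
    R - S = (z - w) • (R * S) := by
  ext y
  obtain ⟨x, hx, hxy⟩ := hS.1 y
  have h1 := hR.2 x
  have h2 : T x - z • (x : H) = y - (z - w) • (x : H) := by rw [← hxy, sub_smul]; abel
  rw [h2, map_sub, map_smul, hx] at h1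
  simp only [sub_apply, smul_apply,
    mul_apply_eq_comp]
  rw [sub_eq_iff_eq_add, ← sub_eq_iff_eq_add', h1]

theorem IsResolventAt.commute (hR : IsResolventAt T z R) (hS : IsResolventAt T w S) :
    R * S = S * R := by
  rcases eq_or_ne z w with rfl | hzw
  · rw [hR.unique hS]
  · have h1 := hR.sub_eq hS
    have h2 := hS.sub_eq hR
    have h3 : (z - w) • (R * S) = (z - w) • (S * R) := by
      rw [← h1, ← neg_sub S R, h2, ← neg_smul, neg_sub]
    exact smul_right_injective _ (sub_ne_zero.2 hzw) h3

/-- `v` is an eigenvector (or zero) of `A` with eigenvalue `c`. -/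
def IsEigenpair (A : H →ₗ.[ℂ] H) (c : ℂ) (v : H) : Prop := ∃ x : A.domain, (x : H) = v ∧ A x = c • v

theorem IsEigenpair.resolvent_apply {c : ℂ} {v : H} (h : IsEigenpair A c v)
    (hR : IsResolventAt A z R) : (c - z) • R v = v := by
  obtain ⟨x, rfl, hx⟩ := h
  have := hR.2 x
  rwa [hx, ← sub_smul, map_smul] at this

theorem IsResolventAt.isEigenpair {κ : ℂ} (hκ : κ ≠ 0) {v : H} (hR : IsResolventAt A z R)
    (h : R v = κ • v) : IsEigenpair A (z + κ⁻¹) v := by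
  obtain ⟨x, hx, hxy⟩ := hR.1 v
  refine ⟨κ⁻¹ • x, ?_, ?_⟩
  · rw [Submodule.coe_smul, hx, h, inv_smul_smul₀ hκ]
  · rw [LinearPMap.map_smul, ← sub_add_cancel (A x) (z • (x : H)), hxy, hx, h, smul_add, add_smul,
      smul_comm z, inv_smul_smul₀ hκ, add_comm]

theorem IsEigenpair.mem_spectrumOf {c : ℂ} {v : H} (h : IsEigenpair A c v) (hv : v ≠ 0) :
    c ∈ spectrumOf A := by
  rintro ⟨R, hR⟩
  have := h.resolvent_apply hR
  rw [sub_self, zero_smul] at this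
  exact hv this.symm

theorem IsEigenpair.mem_eigenvaluesOf {c : ℝ} {v : H} (h : IsEigenpair A c v) (hv : v ≠ 0) :
    c ∈ eigenvaluesOf A := by
  obtain ⟨x, rfl, hx⟩ := h
  exact ⟨x, hv, hx⟩

theorem ofReal_mem_spectrumOf {c : ℝ} (h : c ∈ eigenvaluesOf A) : (c : ℂ) ∈ spectrumOf A := by
  obtain ⟨x, hx, hx'⟩ := h
  exact IsEigenpair.mem_spectrumOf ⟨x, rfl, hx'⟩ hx

end Resolvent

/-! ### Selfadjoint operators with compact resolvent -/

section SelfAdjoint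

set_option linter.unusedSectionVars false

variable {H : Type*} [NormedAddCommGroup H] [InnerProductSpace ℂ H] [CompleteSpace H]
  {A : H →ₗ.[ℂ] H} {z w : ℂ} {R S : H →L[ℂ] H}

theorem inner_map_of_isSelfAdjoint (hA : IsSelfAdjoint A) (x y : A.domain) :
    ⟪A x, (y : H)⟫_ℂ = ⟪(x : H), A y⟫_ℂ := by
  have h := LinearPMap.adjoint_isFormalAdjoint hA.dense_domain
  rw [LinearPMap.isSelfAdjoint_def.1 hA] at h
  exact h x y

theorem IsResolventAt.adjoint_eq (hA : IsSelfAdjoint A) (hR : IsResolventAt A z R)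
    (hS : IsResolventAt A ((starRingEnd ℂ) z) S) : ContinuousLinearMap.adjoint R = S := by
  symm
  rw [ContinuousLinearMap.eq_adjoint_iff]
  intro y x
  obtain ⟨u, hu, hux⟩ := hR.1 x
  obtain ⟨v, hv, hvy⟩ := hS.1 y
  rw [← hu, ← hv]
  conv_rhs => rw [← hvy]
  rw [← hux]
  rw [inner_sub_left, inner_sub_right, inner_smul_left, inner_smul_right, Complex.conj_conj,
    inner_map_of_isSelfAdjoint hA]

/-- The assumptions on `A₁`: it is selfadjoint, has real spectrum and compact resolvent. -/
structure HasCompactResolvent (A : H →ₗ.[ℂ] H) : Prop where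
  isSelfAdjoint : IsSelfAdjoint A
  im_eq_zero : ∀ z ∈ spectrumOf A, z.im = 0
  isCompact : ∀ z ∈ resolventSetOf A, IsCompactOperator (resolventOf A z)

theorem HasCompactResolvent.mem_resolventSetOf (hA : HasCompactResolvent A) (hz : z.im ≠ 0) :
    z ∈ resolventSetOf A := by
  by_contra h
  exact hz (hA.im_eq_zero z h)

theorem HasCompactResolvent.conj_mem (hA : HasCompactResolvent A) (hz : z ∈ resolventSetOf A) :
    (starRingEnd ℂ) z ∈ resolventSetOf A := by
  by_cases h : z.im = 0
  · rwa [Complex.conj_eq_iff_im.2 h]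
  · exact hA.mem_resolventSetOf (by simpa using h)

theorem HasCompactResolvent.adjoint_resolventOf (hA : HasCompactResolvent A)
    (hz : z ∈ resolventSetOf A) :
    ContinuousLinearMap.adjoint (resolventOf A z) = resolventOf A ((starRingEnd ℂ) z) :=
  (isResolventAt_resolventOf hz).adjoint_eq hA.isSelfAdjoint
    (isResolventAt_resolventOf (hA.conj_mem hz))

theorem HasCompactResolvent.isEigenpair_ofReal (hA : HasCompactResolvent A) {c : ℂ} {v : H}
    (h : IsEigenpair A c v) (hv : v ≠ 0) : c = (c.re : ℂ) ∧ c.re ∈ eigenvaluesOf A := by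
  have h1 : c = (c.re : ℂ) :=
    Complex.ext (by simp) (by simpa using hA.im_eq_zero c (h.mem_spectrumOf hv))
  refine ⟨h1, ?_⟩
  rw [h1] at h
  exact h.mem_eigenvaluesOf hv

/-- The spectrum consists of eigenvalues. -/
theorem HasCompactResolvent.spectrumOf_eq (hA : HasCompactResolvent A) :
    spectrumOf A = (fun x : ℝ => (x : ℂ)) '' eigenvaluesOf A := by
  apply Subset.antisymm
  · intro c hc
    have hI : Complex.I ∈ resolventSetOf A := hA.mem_resolventSetOf (by simp)
    have hR := isResolventAt_resolventOf hI
    have hne : c - Complex.I ≠ 0 := fun h => by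
      rw [sub_eq_zero] at h
      exact hc (h ▸ hI)
    rcases (hA.isCompact _ hI).hasEigenvalue_or_mem_resolventSet (inv_ne_zero hne) with h | h
    · obtain ⟨v, hv⟩ := h.exists_hasEigenvector
      have h1 := hR.isEigenpair (inv_ne_zero hne) hv.apply_eq_smul
      rw [inv_inv, add_sub_cancel] at h1
      obtain ⟨h2, h3⟩ := hA.isEigenpair_ofReal h1 hv.2
      exact ⟨_, h3, h2.symm⟩
    · exfalso
      apply hc
      have h1 : IsUnit (1 - (c - Complex.I) • resolventOf A Complex.I) := by
        have h2 : (1 - (c - Complex.I) • resolventOf A Complex.I) =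
            (Units.mk0 _ hne) • (algebraMap ℂ (H →L[ℂ] H) (c - Complex.I)⁻¹ -
              resolventOf A Complex.I) := by
          rw [Units.smul_def, Units.val_mk0, smul_sub, Algebra.algebraMap_eq_smul_one,
            smul_inv_smul₀ hne]
        rw [h2]
        exact (spectrum.mem_resolventSet_iff.1 h).smul _
      exact ⟨_, hR.shift_of_isUnit h1⟩
  · rintro _ ⟨c, hc, rfl⟩
    exact ofReal_mem_spectrumOf hc

/-- The orthogonal projection onto the eigenspace for the eigenvalue `c`. -/
noncomputable def eigenProjection (A : H →ₗ.[ℂ] H) (c : ℝ) : H →L[ℂ] H :=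
  (LinearMap.ker ((resolventOf A Complex.I - ((c : ℂ) - Complex.I)⁻¹ • 1 :
    H →L[ℂ] H) : H →ₗ[ℂ] H)).starProjection

theorem ofReal_sub_I_ne_zero (c : ℝ) : (c : ℂ) - Complex.I ≠ 0 := fun h => by
  simpa using congrArg Complex.im h

theorem HasCompactResolvent.isEigenpair_eigenProjection (hA : HasCompactResolvent A) (c : ℝ)
    (v : H) : IsEigenpair A c (eigenProjection A c v) := by
  have hI : Complex.I ∈ resolventSetOf A := hA.mem_resolventSetOf (by simp)
  have h1 := Submodule.starProjection_apply_mem (LinearMap.ker ((resolventOf A Complex.I -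
    ((c : ℂ) - Complex.I)⁻¹ • 1 : H →L[ℂ] H) : H →ₗ[ℂ] H)) v
  have h2 : resolventOf A Complex.I (eigenProjection A c v) =
      ((c : ℂ) - Complex.I)⁻¹ • eigenProjection A c v := by
    have h2 : (resolventOf A Complex.I - ((c : ℂ) - Complex.I)⁻¹ • 1 : H →L[ℂ] H)
        (eigenProjection A c v) = 0 := h1
    simpa [sub_eq_zero, sub_apply] using h2
  have h3 := (isResolventAt_resolventOf hI).isEigenpair
    (inv_ne_zero (ofReal_sub_I_ne_zero c)) h2
  rwa [inv_inv, add_sub_cancel] at h3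

theorem HasCompactResolvent.eigenProjection_apply_eq (hA : HasCompactResolvent A) {c : ℝ}
    {v : H} (h : IsEigenpair A c v) : eigenProjection A c v = v := by
  have hI : Complex.I ∈ resolventSetOf A := hA.mem_resolventSetOf (by simp)
  rw [eigenProjection, Submodule.starProjection_eq_self_iff, LinearMap.mem_ker]
  have h1 := h.resolvent_apply (isResolventAt_resolventOf hI)
  have h2 : resolventOf A Complex.I v = ((c : ℂ) - Complex.I)⁻¹ • v := by
    conv_rhs => rw [← h1]
    rw [inv_smul_smul₀ (ofReal_sub_I_ne_zero c)]
  simp [h2]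

theorem isSelfAdjoint_eigenProjection (A : H →ₗ.[ℂ] H) (c : ℝ) :
    IsSelfAdjoint (eigenProjection A c) := isSelfAdjoint_starProjection _

theorem HasCompactResolvent.resolventOf_mul_eigenProjection (hA : HasCompactResolvent A)
    (hz : z ∈ resolventSetOf A) {c : ℝ} (hc : (c : ℂ) ≠ z) :
    resolventOf A z * eigenProjection A c = ((c : ℂ) - z)⁻¹ • eigenProjection A c := by
  ext v
  have h1 := (hA.isEigenpair_eigenProjection c v).resolvent_apply (isResolventAt_resolventOf hz)
  rw [mul_apply_eq_comp, smul_apply]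
  conv_rhs => rw [← h1]
  rw [inv_smul_smul₀ (sub_ne_zero.2 hc)]

theorem HasCompactResolvent.eigenProjection_mul_resolventOf (hA : HasCompactResolvent A)
    (hz : z ∈ resolventSetOf A) {c : ℝ} (hc : (c : ℂ) ≠ z) :
    eigenProjection A c * resolventOf A z = ((c : ℂ) - z)⁻¹ • eigenProjection A c := by
  have hc' : (c : ℂ) ≠ (starRingEnd ℂ) z := fun h => hc (by
    have := congrArg (starRingEnd ℂ) h
    simpa using this)
  have h := congrArg star (hA.resolventOf_mul_eigenProjection (hA.conj_mem hz) hc')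
  rw [star_mul, star_smul, (isSelfAdjoint_eigenProjection A c).star_eq,
    ContinuousLinearMap.star_eq_adjoint, hA.adjoint_resolventOf (hA.conj_mem hz),
    Complex.conj_conj] at h
  rw [h]
  simp

theorem HasCompactResolvent.eigenProjection_mul_of_ne (hA : HasCompactResolvent A) {c d : ℝ}
    (hcd : c ≠ d) : eigenProjection A c * eigenProjection A d = 0 := by
  have hI : Complex.I ∈ resolventSetOf A := hA.mem_resolventSetOf (by simp)
  have hne : ∀ c : ℝ, (c : ℂ) ≠ Complex.I := fun c => sub_ne_zero.1 (ofReal_sub_I_ne_zero c)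
  have h1 : eigenProjection A c * resolventOf A Complex.I * eigenProjection A d =
      ((c : ℂ) - Complex.I)⁻¹ • (eigenProjection A c * eigenProjection A d) := by
    rw [hA.eigenProjection_mul_resolventOf hI (hne c), smul_mul_assoc]
  rw [mul_assoc, hA.resolventOf_mul_eigenProjection hI (hne d), mul_smul_comm] at h1
  by_contra h
  have h2 := smul_left_injective ℂ h h1
  exact hcd (by simpa using h2.symm)

theorem HasCompactResolvent.eigenProjection_mul_self (hA : HasCompactResolvent A) (c : ℝ) :
    eigenProjection A c * eigenProjection A c = eigenProjection A c := by
  ext v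
  exact hA.eigenProjection_apply_eq (hA.isEigenpair_eigenProjection c v)

/-- The spectral projection for a finite set of eigenvalues. -/
noncomputable def finProjection (A : H →ₗ.[ℂ] H) (s : Finset ℝ) : H →L[ℂ] H :=
  ∑ c ∈ s, eigenProjection A c

theorem HasCompactResolvent.finProjection_mul_eigenProjection (hA : HasCompactResolvent A)
    {s : Finset ℝ} {c : ℝ} (hc : c ∈ s) :
    finProjection A s * eigenProjection A c = eigenProjection A c := by
  rw [finProjection, Finset.sum_mul, Finset.sum_eq_single c
    (fun d _ hd => hA.eigenProjection_mul_of_ne hd) (fun h => absurd hc h),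
    hA.eigenProjection_mul_self]

theorem HasCompactResolvent.isStarProjection_finProjection (hA : HasCompactResolvent A)
    (s : Finset ℝ) : IsStarProjection (finProjection A s) := by
  constructor
  · have : finProjection A s * finProjection A s = finProjection A s := by
      conv_lhs => rw [finProjection, ← finProjection, finProjection.eq_1 (s := s)]
      rw [← finProjection, finProjection.eq_1, Finset.mul_sum]
      exact Finset.sum_congr rfl fun c hc => hA.finProjection_mul_eigenProjection hc
    exact this
  · rw [IsSelfAdjoint, finProjection, star_sum]
    exact Finset.sum_congr rfl fun c _ => (isSelfAdjoint_eigenProjection A c).star_eq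

theorem HasCompactResolvent.resolventOf_mul_finProjection (hA : HasCompactResolvent A)
    (hz : z ∈ resolventSetOf A) {s : Finset ℝ} (hs : ∀ c ∈ s, (c : ℂ) ≠ z) :
    resolventOf A z * finProjection A s = ∑ c ∈ s, ((c : ℂ) - z)⁻¹ • eigenProjection A c := by
  rw [finProjection, Finset.mul_sum]
  exact Finset.sum_congr rfl fun c hc => hA.resolventOf_mul_eigenProjection hz (hs c hc)

theorem HasCompactResolvent.finProjection_mul_resolventOf (hA : HasCompactResolvent A)
    (hz : z ∈ resolventSetOf A) {s : Finset ℝ} (hs : ∀ c ∈ s, (c : ℂ) ≠ z) :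
    finProjection A s * resolventOf A z = resolventOf A z * finProjection A s := by
  rw [hA.resolventOf_mul_finProjection hz hs, finProjection, Finset.sum_mul]
  exact Finset.sum_congr rfl fun c hc => hA.eigenProjection_mul_resolventOf hz (hs c hc)

/-- The norm of the resolvent, reduced by the spectral subspace for `s`. -/
theorem HasCompactResolvent.norm_resolventOf_mul_le (hA : HasCompactResolvent A)
    (hz : z ∈ resolventSetOf A) {s : Finset ℝ} (hs : ∀ c ∈ s, (c : ℂ) ≠ z) {d : ℝ} (hd : 0 < d)
    (hsd : ∀ c ∈ eigenvaluesOf A, c ∉ s → d ≤ ‖(c : ℂ) - z‖) :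
    ‖resolventOf A z * (1 - finProjection A s)‖ ≤ d⁻¹ := by
  set R := resolventOf A z with hRdef
  set P := finProjection A s with hPdef
  have hR := isResolventAt_resolventOf hz
  have hP := hA.isStarProjection_finProjection s
  have hPP : P * P = P := hP.isIdempotentElem
  have hcomm : P * R = R * P := hA.finProjection_mul_resolventOf hz hs
  have hs' : ∀ c ∈ s, (c : ℂ) ≠ (starRingEnd ℂ) z := fun c hc h => hs c hc (by
    have := congrArg (starRingEnd ℂ) h
    simpa using this)
  set R' := resolventOf A ((starRingEnd ℂ) z) with hR'def
  have hcomm' : P * R' = R' * P := hA.finProjection_mul_resolventOf (hA.conj_mem hz) hs'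
  have hRR' : R * R' = R' * R := hR.commute (isResolventAt_resolventOf (hA.conj_mem hz))
  have hstar : star (R * (1 - P)) = R' * (1 - P) := by
    rw [star_mul, star_sub, star_one, hP.isSelfAdjoint.star_eq,
      ContinuousLinearMap.star_eq_adjoint, hA.adjoint_resolventOf hz]
    change (1 - P) * R' = R' * (1 - P)
    rw [sub_mul, mul_sub, one_mul, mul_one, hcomm']
  have hQR : (1 - P) * R = R * (1 - P) := by rw [sub_mul, mul_sub, one_mul, mul_one, hcomm]
  have hQR' : (1 - P) * R' = R' * (1 - P) := by rw [sub_mul, mul_sub, one_mul, mul_one, hcomm']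
  have hnormal : IsStarNormal (R * (1 - P)) := by
    constructor
    rw [hstar, Commute, SemiconjBy]
    calc R' * (1 - P) * (R * (1 - P)) = R' * ((1 - P) * R) * (1 - P) := by simp only [mul_assoc]
      _ = R' * R * ((1 - P) * (1 - P)) := by rw [hQR]; simp only [mul_assoc]
      _ = R * (R' * (1 - P)) * (1 - P) := by rw [← hRR']; simp only [mul_assoc]
      _ = R * ((1 - P) * R') * (1 - P) := by rw [hQR']
      _ = R * (1 - P) * (R' * (1 - P)) := by simp only [mul_assoc]
  have hcompact : IsCompactOperator ((R * (1 - P) : H →L[ℂ] H) : H → H) := (hA.isCompact z hz).comp_clm (1 - P)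
  have hspec : ∀ κ ∈ spectrum ℂ (R * (1 - P)), ‖κ‖ ≤ d⁻¹ := by
    intro κ hκ
    rcases eq_or_ne κ 0 with rfl | hκ0
    · simpa using hd.le
    obtain ⟨v, hv⟩ := ((hcompact.hasEigenvalue_iff_mem_spectrum hκ0).2 hκ).exists_hasEigenvector
    have hv1 : R ((1 - P) v) = κ • v := hv.apply_eq_smul
    have hPv : P v = 0 := by
      have h1 : P (R ((1 - P) v)) = 0 := by
        have h2 : P * R * (1 - P) = 0 := by
          rw [hcomm, mul_assoc, mul_sub, mul_one, hPP, sub_self, mul_zero]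
        exact congrArg (fun T : H →L[ℂ] H => T v) h2
      rw [hv1, map_smul] at h1
      exact (smul_eq_zero.1 h1).resolve_left hκ0
    have hRv : R v = κ • v := by
      simpa [sub_apply, hPv] using hv1
    have hpair := hR.isEigenpair hκ0 hRv
    obtain ⟨h1, h2⟩ := hA.isEigenpair_ofReal hpair hv.2
    rw [h1] at hpair
    have h3 : (z + κ⁻¹).re ∉ s := fun hmem => by
      have h4 := hA.eigenProjection_apply_eq hpair
      have h5 := congrArg (fun T : H →L[ℂ] H => T v) (hA.finProjection_mul_eigenProjection hmem)
      simp only [mul_apply_eq_comp, h4] at h5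
      exact hv.2 (h5.symm.trans hPv)
    have h4 := hsd _ h2 h3
    rw [← h1, add_sub_cancel_left, norm_inv] at h4
    exact (le_inv_comm₀ hd (norm_pos_iff.2 hκ0)).1 h4
  have h1 := IsStarNormal.spectralRadius_eq_nnnorm (R * (1 - P))
  have h2 : spectralRadius ℂ (R * (1 - P)) ≤ ENNReal.ofReal d⁻¹ := by
    refine iSup₂_le fun κ hκ => ?_
    rw [← enorm_eq_nnnorm, ← ofReal_norm]
    exact ENNReal.ofReal_le_ofReal (hspec κ hκ)
  rw [h1, ← enorm_eq_nnnorm, ← ofReal_norm] at h2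
  exact (ENNReal.ofReal_le_ofReal_iff (inv_nonneg.2 hd.le)).1 h2

theorem HasCompactResolvent.mem_resolventSetOf_of_le (hA : HasCompactResolvent A) {d : ℝ}
    (hd : 0 < d) (h : ∀ c ∈ eigenvaluesOf A, d ≤ ‖(c : ℂ) - z‖) : z ∈ resolventSetOf A := by
  by_contra hz
  rw [← mem_compl_iff] at hz
  change z ∈ spectrumOf A at hz
  rw [hA.spectrumOf_eq] at hz
  obtain ⟨c, hc, rfl⟩ := hz
  have := h c hc
  simp only [sub_self, norm_zero] at this
  linarith

theorem HasCompactResolvent.norm_resolventOf_le (hA : HasCompactResolvent A) {d : ℝ}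
    (hd : 0 < d) (h : ∀ c ∈ eigenvaluesOf A, d ≤ ‖(c : ℂ) - z‖) : ‖resolventOf A z‖ ≤ d⁻¹ := by
  simpa [finProjection] using hA.norm_resolventOf_mul_le (hA.mem_resolventSetOf_of_le hd h)
    (s := ∅) (by simp) hd fun c hc _ => h c hc

end SelfAdjoint

/-! ### The resolvent of the perturbed operator -/

section Perturbed

set_option linter.unusedSectionVars false

variable {H : Type*} [NormedAddCommGroup H] [InnerProductSpace ℂ H] [CompleteSpace H]
  {T A : H →ₗ.[ℂ] H} {z w : ℂ} {R S X Y V P : H →L[ℂ] H} {d : ℝ}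

/-- The second resolvent identity. -/
theorem IsResolventAt.sub_eq_of_perturb (hR : IsResolventAt (perturb T X) z R)
    (hS : IsResolventAt (perturb T Y) z S) : R - S = R * (Y - X) * S := by
  ext y
  obtain ⟨x, hx, hxy⟩ := hS.1 y
  have h1 := hR.2 x
  have e1 : perturb T X x = X (x : H) + T x := rfl
  have e2 : perturb T Y x = Y (x : H) + T x := rfl
  have h2 : perturb T X x - z • (x : H) = y - (Y - X) (x : H) := by
    rw [← hxy, e1, e2, sub_apply]; abel
  rw [h2, map_sub, hx] at h1
  simp only [sub_apply, mul_apply_eq_comp] at h1 ⊢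
  rw [sub_eq_iff_eq_add, ← sub_eq_iff_eq_add', h1]

theorem norm_neg_mul_le (hR : ‖R‖ ≤ d⁻¹) : ‖-(X * R)‖ ≤ ‖X‖ * d⁻¹ := by
  rw [norm_neg]
  exact (norm_mul_le _ _).trans (by gcongr)

theorem mul_inv_lt_one (hd : ‖X‖ < d) : ‖X‖ * d⁻¹ < 1 := by
  have h : 0 < d := (norm_nonneg _).trans_lt hd
  rw [← div_eq_mul_inv, div_lt_one h]
  exact hd

theorem inv_mul_inv_one_sub (hd : ‖X‖ < d) : d⁻¹ * (1 - ‖X‖ * d⁻¹)⁻¹ = (d - ‖X‖)⁻¹ := by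
  have h : 0 < d := (norm_nonneg _).trans_lt hd
  rw [← mul_inv, mul_sub, mul_one, mul_comm ‖X‖, ← mul_assoc, mul_inv_cancel₀ h.ne', one_mul]

theorem IsResolventAt.perturb_tsum (hR : IsResolventAt A z R) (hd : ‖X‖ < d)
    (hRd : ‖R‖ ≤ d⁻¹) : IsResolventAt (perturb A X) z (R * ∑' k : ℕ, (-(X * R)) ^ k) := by
  have h1 : ‖-(X * R)‖ < 1 := (norm_neg_mul_le hRd).trans_lt (mul_inv_lt_one hd)
  refine hR.perturb_of_inverse (Y := X) (by simp) ?_ ?_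
  · have := mul_neg_geom_series _ h1
    rwa [sub_neg_eq_add] at this
  · have := geom_series_mul_neg _ h1
    rwa [sub_neg_eq_add] at this

theorem norm_mul_pow_le (hR : ‖R‖ ≤ d⁻¹) (k : ℕ) :
    ‖R * (-(X * R)) ^ k‖ ≤ d⁻¹ * (‖X‖ * d⁻¹) ^ k := by
  induction k with
  | zero =>
    simpa using hR
  | succ k ih =>
    rw [pow_succ, ← mul_assoc, pow_succ, ← mul_assoc]
    exact (norm_mul_le _ _).trans (mul_le_mul ih (norm_neg_mul_le hR) (norm_nonneg _)
      ((norm_nonneg _).trans ih))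

theorem hasSum_bound (hd : ‖X‖ < d) :
    HasSum (fun k : ℕ => d⁻¹ * (‖X‖ * d⁻¹) ^ k) (d - ‖X‖)⁻¹ := by
  have h : 0 < d := (norm_nonneg _).trans_lt hd
  rw [← inv_mul_inv_one_sub hd]
  exact (hasSum_geometric_of_lt_one (by positivity) (mul_inv_lt_one hd)).mul_left _

theorem HasCompactResolvent.isResolventAt_perturb (hA : HasCompactResolvent A) (hd : ‖X‖ < d)
    (h : ∀ c ∈ eigenvaluesOf A, d ≤ ‖(c : ℂ) - z‖) :
    IsResolventAt (perturb A X) z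
      (∑' k : ℕ, resolventOf A z * (-(X * resolventOf A z)) ^ k) := by
  have hd0 : 0 < d := (norm_nonneg _).trans_lt hd
  have hR := hA.norm_resolventOf_le hd0 h
  have h1 := (isResolventAt_resolventOf (hA.mem_resolventSetOf_of_le hd0 h)).perturb_tsum hd hR
  have h2 : Summable fun k : ℕ => (-(X * resolventOf A z)) ^ k :=
    summable_geometric_of_norm_lt_one ((norm_neg_mul_le hR).trans_lt (mul_inv_lt_one hd))
  rwa [← h2.tsum_mul_left] at h1

theorem HasCompactResolvent.mem_resolventSetOf_perturb (hA : HasCompactResolvent A)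
    (hd : ‖X‖ < d) (h : ∀ c ∈ eigenvaluesOf A, d ≤ ‖(c : ℂ) - z‖) :
    z ∈ resolventSetOf (perturb A X) := ⟨_, hA.isResolventAt_perturb hd h⟩

theorem HasCompactResolvent.norm_resolventOf_perturb_le (hA : HasCompactResolvent A)
    (hd : ‖X‖ < d) (h : ∀ c ∈ eigenvaluesOf A, d ≤ ‖(c : ℂ) - z‖) :
    ‖resolventOf (perturb A X) z‖ ≤ (d - ‖X‖)⁻¹ := by
  have hd0 : 0 < d := (norm_nonneg _).trans_lt hd
  rw [(hA.isResolventAt_perturb hd h).resolventOf_eq]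
  exact tsum_of_norm_bounded (hasSum_bound hd)
    fun k => norm_mul_pow_le (hA.norm_resolventOf_le hd0 h) k

/-- The part of the resolvent in the spectral subspace for `s`. -/
noncomputable def finResolvent (A : H →ₗ.[ℂ] H) (s : Finset ℝ) (z : ℂ) : H →L[ℂ] H :=
  ∑ c ∈ s, ((c : ℂ) - z)⁻¹ • eigenProjection A c

/-- The truncated Neumann series. -/
noncomputable def finNeumann (A : H →ₗ.[ℂ] H) (X : H →L[ℂ] H) (s : Finset ℝ) (n : ℕ) (z : ℂ) :
    H →L[ℂ] H :=
  ∑ k ∈ Finset.range n, finResolvent A s z * (-(X * finResolvent A s z)) ^ k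

theorem isPoleSum_finNeumann (A : H →ₗ.[ℂ] H) (X : H →L[ℂ] H) {s : Finset ℝ} {σ : Set ℝ}
    (hs : ↑s ⊆ σ) (n : ℕ) : IsPoleSum σ (finNeumann A X s n) := by
  refine IsPoleSum.sum _ fun k hk => ?_
  clear hk
  induction k with
  | zero =>
    simp only [pow_zero, mul_one]
    refine IsPoleSum.sum _ fun c hc => ?_
    simpa using IsPoleSum.single (σ := σ) [c] (by simp) (by simpa using hs hc)
      (eigenProjection A c)
  | succ k ih =>
    have h1 : ∀ z, finResolvent A s z * (-(X * finResolvent A s z)) ^ (k + 1) =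
        ∑ c ∈ s, (((c : ℂ) - z)⁻¹ • (eigenProjection A c * -X)) *
          (finResolvent A s z * (-(X * finResolvent A s z)) ^ k) := fun z => by
      have h2 : finResolvent A s z * -X =
          ∑ c ∈ s, ((c : ℂ) - z)⁻¹ • (eigenProjection A c * -X) := by
        rw [finResolvent, Finset.sum_mul]
        exact Finset.sum_congr rfl fun c _ => smul_mul_assoc _ _ _
      rw [← Finset.sum_mul, ← h2, pow_succ', ← neg_mul]
      simp only [mul_assoc]
    simp only [h1]
    exact IsPoleSum.sum _ fun c hc => ih.pole_comp (hs hc) _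

theorem HasCompactResolvent.finResolvent_eq (hA : HasCompactResolvent A) {s : Finset ℝ}
    (hs : ↑s ⊆ eigenvaluesOf A) (hz : z ∈ resolventSetOf A) :
    finResolvent A s z = resolventOf A z * finProjection A s := by
  refine (hA.resolventOf_mul_finProjection hz fun c hc h => ?_).symm
  exact ofReal_mem_spectrumOf (hs hc) (h ▸ hz)

theorem HasCompactResolvent.norm_finResolvent_le (hA : HasCompactResolvent A) {s : Finset ℝ}
    (hs : ↑s ⊆ eigenvaluesOf A) (hd : 0 < d) (h : ∀ c ∈ eigenvaluesOf A, d ≤ ‖(c : ℂ) - z‖) :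
    ‖finResolvent A s z‖ ≤ d⁻¹ := by
  rw [hA.finResolvent_eq hs (hA.mem_resolventSetOf_of_le hd h)]
  refine (norm_mul_le _ _).trans ?_
  calc _ ≤ d⁻¹ * 1 := by
        gcongr
        · exact hA.norm_resolventOf_le hd h
        · exact (hA.isStarProjection_finProjection s).norm_le
    _ = _ := mul_one _

theorem HasCompactResolvent.norm_finNeumann_le (hA : HasCompactResolvent A) {s : Finset ℝ}
    (hs : ↑s ⊆ eigenvaluesOf A) (hd : ‖X‖ < d) (h : ∀ c ∈ eigenvaluesOf A, d ≤ ‖(c : ℂ) - z‖)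
    (n : ℕ) : ‖finNeumann A X s n z‖ ≤ (d - ‖X‖)⁻¹ := by
  have hd0 : 0 < d := (norm_nonneg _).trans_lt hd
  refine (norm_sum_le_of_le _ fun k _ =>
    norm_mul_pow_le (hA.norm_finResolvent_le hs hd0 h) k).trans ?_
  exact sum_le_hasSum _ (fun k _ => by positivity) (hasSum_bound hd)

/-- The finite sets `s n` exhaust the eigenvalues in every bounded region. -/
def IsExhaustion (σ : Set ℝ) (s : ℕ → Finset ℝ) : Prop :=
  (∀ n, ↑(s n) ⊆ σ) ∧ ∀ M : ℝ, ∀ᶠ n in atTop, ∀ c ∈ σ, c ∉ s n → M ≤ |c|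

theorem HasCompactResolvent.tendsto_finResolvent (hA : HasCompactResolvent A)
    {s : ℕ → Finset ℝ} (hs : IsExhaustion (eigenvaluesOf A) s) (hz : z ∈ resolventSetOf A) :
    Tendsto (fun n => finResolvent A (s n) z) atTop (𝓝 (resolventOf A z)) := by
  rw [tendsto_iff_norm_sub_tendsto_zero, Metric.tendsto_atTop']
  intro ε hε
  obtain ⟨N, hN⟩ := eventually_atTop.1 (hs.2 (‖z‖ + (ε / 2)⁻¹))
  refine ⟨N, fun n hn => ?_⟩
  have h1 := hA.norm_resolventOf_mul_le hz (s := s n)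
    (fun c hc h => ofReal_mem_spectrumOf (hs.1 n hc) (h ▸ hz))
    (d := (ε / 2)⁻¹) (by positivity) fun c hc hcs => by
      have h2 := hN n hn.le c hc hcs
      have h3 := norm_sub_norm_le (c : ℂ) z
      rw [Complex.norm_real, Real.norm_eq_abs] at h3
      linarith
  rw [inv_inv, mul_sub, mul_one, ← hA.finResolvent_eq (hs.1 n) hz] at h1
  rw [dist_zero_right, norm_norm, norm_sub_rev]
  linarith

theorem HasCompactResolvent.tendsto_finNeumann (hA : HasCompactResolvent A)
    {s : ℕ → Finset ℝ} (hs : IsExhaustion (eigenvaluesOf A) s) (hd : ‖X‖ < d)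
    (h : ∀ c ∈ eigenvaluesOf A, d ≤ ‖(c : ℂ) - z‖) :
    Tendsto (fun n => finNeumann A X (s n) n z) atTop (𝓝 (resolventOf (perturb A X) z)) := by
  have hd0 : 0 < d := (norm_nonneg _).trans_lt hd
  have hz := hA.mem_resolventSetOf_of_le hd0 h
  rw [(hA.isResolventAt_perturb hd h).resolventOf_eq]
  have h1 : ∀ n, finNeumann A X (s n) n z = ∑' k : ℕ, if k < n then
      finResolvent A (s n) z * (-(X * finResolvent A (s n) z)) ^ k else 0 := fun n => by
    rw [tsum_eq_sum (s := Finset.range n) fun k hk => if_neg (by simpa using hk), finNeumann]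
    exact Finset.sum_congr rfl fun k hk => (if_pos (by simpa using hk)).symm
  simp only [h1]
  refine tendsto_tsum_of_dominated_convergence (hasSum_bound hd).summable (fun k => ?_) ?_
  · have h2 := hA.tendsto_finResolvent hs hz
    have h3 : Tendsto (fun n => finResolvent A (s n) z * (-(X * finResolvent A (s n) z)) ^ k)
        atTop (𝓝 (resolventOf A z * (-(X * resolventOf A z)) ^ k)) :=
      h2.mul ((tendsto_const_nhds.mul h2).neg.pow k)
    refine h3.congr' ?_
    filter_upwards [eventually_gt_atTop k] with n hn
    rw [if_pos hn]
  · refine Eventually.of_forall fun n k => ?_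
    split_ifs
    · exact norm_mul_pow_le (hA.norm_finResolvent_le (hs.1 n) hd0 h) k
    · rw [norm_zero]; positivity

end Perturbed

/-! ### The basic equation -/

section Basic

set_option linter.unusedSectionVars false

variable {H₀ H₁ : Type*} [NormedAddCommGroup H₀] [InnerProductSpace ℂ H₀] [CompleteSpace H₀]
  [NormedAddCommGroup H₁] [InnerProductSpace ℂ H₁] [CompleteSpace H₁]
  {E : SpectralMeasure H₀} {B : H₁ →L[ℂ] H₀} {a b : EReal} {D : Set ℂ} {K : ℂ → H₁ →L[ℂ] H₁}
  {o : ℝ} {A : H₁ →ₗ.[ℂ] H₁} {X Y : H₁ →L[ℂ] H₁} {γ γ₁ γ₂ : ℝ → ℂ} {d : ℝ}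

theorem HasCompactResolvent.continuous_resolventOf_comp (hA : HasCompactResolvent A)
    (hγ : IsContour K D a b γ) (hd : ‖X‖ < d)
    (h : ∀ c ∈ eigenvaluesOf A, ∀ t, d ≤ ‖(c : ℂ) - γ t‖) :
    Continuous fun t => resolventOf (perturb A X) (γ t) :=
  (continuousOn_resolventOf _).comp_continuous hγ.locallyLipschitz.continuous fun t =>
    hA.mem_resolventSetOf_perturb hd fun c hc => h c hc t

theorem HasCompactResolvent.integrable_transfer (hA : HasCompactResolvent A)
    (hKc : ContinuousOn K D) (hγ : IsContour K D a b γ) (hv : variation K γ < ∞) (hd : ‖X‖ < d)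
    (h : ∀ c ∈ eigenvaluesOf A, ∀ t, d ≤ ‖(c : ℂ) - γ t‖) :
    Integrable fun t => deriv γ t • (K (γ t) ∘L resolventOf (perturb A X) (γ t)) :=
  hγ.integrable_integrand hKc hv (g := resolventOf (perturb A X))
    (hA.continuous_resolventOf_comp hγ hd h)
    fun t => hA.norm_resolventOf_perturb_le hd fun c hc => h c hc t

theorem HasCompactResolvent.norm_transferIntegral_le (hA : HasCompactResolvent A)
    (hKc : ContinuousOn K D) (hγ : IsContour K D a b γ) (hv : variation K γ < ∞) (hd : ‖X‖ < d)
    (h : ∀ c ∈ eigenvaluesOf A, ∀ t, d ≤ ‖(c : ℂ) - γ t‖) :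
    ‖transferIntegral K γ (perturb A X)‖ ≤ (variation K γ).toReal * (d - ‖X‖)⁻¹ :=
  hγ.norm_integral_le hKc hv (g := resolventOf (perturb A X))
    fun t => hA.norm_resolventOf_perturb_le hd fun c hc => h c hc t

theorem HasCompactResolvent.norm_transferIntegral_sub_le (hA : HasCompactResolvent A)
    (hKc : ContinuousOn K D) (hγ : IsContour K D a b γ) (hv : variation K γ < ∞) (hX : ‖X‖ < d)
    (hY : ‖Y‖ < d) (h : ∀ c ∈ eigenvaluesOf A, ∀ t, d ≤ ‖(c : ℂ) - γ t‖) :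
    ‖transferIntegral K γ (perturb A X) - transferIntegral K γ (perturb A Y)‖ ≤
      (variation K γ).toReal * ((d - ‖X‖)⁻¹ * ‖X - Y‖ * (d - ‖Y‖)⁻¹) := by
  rw [transferIntegral, transferIntegral, ← integral_sub
    (hA.integrable_transfer hKc hγ hv hX h) (hA.integrable_transfer hKc hγ hv hY h)]
  simp only [← smul_sub, ← ContinuousLinearMap.comp_sub]
  refine hγ.norm_integral_le hKc hv
    (g := fun z => resolventOf (perturb A X) z - resolventOf (perturb A Y) z) fun t => ?_
  have hRX := hA.norm_resolventOf_perturb_le hX fun c hc => h c hc t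
  have hRY := hA.norm_resolventOf_perturb_le hY fun c hc => h c hc t
  rw [(isResolventAt_resolventOf
    (hA.mem_resolventSetOf_perturb hX fun c hc => h c hc t)).sub_eq_of_perturb
    (isResolventAt_resolventOf (hA.mem_resolventSetOf_perturb hY fun c hc => h c hc t)),
    norm_sub_rev X Y]
  refine (norm_mul_le _ _).trans ?_
  have h0 : 0 ≤ (d - ‖X‖)⁻¹ := (norm_nonneg _).trans hRX
  exact mul_le_mul ((norm_mul_le _ _).trans (by gcongr)) hRY (norm_nonneg _) (by positivity)

theorem HasCompactResolvent.tendsto_integral_finNeumann (hA : HasCompactResolvent A)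
    (hKc : ContinuousOn K D) (hγ : IsContour K D a b γ) (hv : variation K γ < ∞) (hd : ‖X‖ < d)
    (h : ∀ c ∈ eigenvaluesOf A, ∀ t, d ≤ ‖(c : ℂ) - γ t‖) {s : ℕ → Finset ℝ}
    (hs : IsExhaustion (eigenvaluesOf A) s)
    (hint : ∀ n, Integrable fun t => deriv γ t • (K (γ t) ∘L finNeumann A X (s n) n (γ t))) :
    Tendsto (fun n => ∫ t, deriv γ t • (K (γ t) ∘L finNeumann A X (s n) n (γ t))) atTop
      (𝓝 (transferIntegral K γ (perturb A X))) := by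
  refine tendsto_integral_of_dominated_convergence
    (fun t => ‖K (γ t)‖ * ‖deriv γ t‖ * (d - ‖X‖)⁻¹) (fun n => (hint n).aestronglyMeasurable)
    ((hγ.integrable_norm hKc hv).mul_const _) (fun n => Eventually.of_forall fun t => ?_)
    (Eventually.of_forall fun t => ?_)
  · refine (norm_integrand_le K γ t _).trans ?_
    gcongr
    exact hA.norm_finNeumann_le (hs.1 n) hd (fun c hc => h c hc t) n
  · have h1 := hA.tendsto_finNeumann hs hd fun c hc => h c hc t
    exact (h1.const_mul (K (γ t))).const_smul (deriv γ t)

/-- The integral `V₁(A + X, Γ)` does not depend on the contour. -/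
theorem IsOneSidedContinuation.transferIntegral_eq (hK : IsOneSidedContinuation E B a b D K o)
    (hA : HasCompactResolvent A) (hσ : eigenvaluesOf A ⊆ realInterval a b) {s : ℕ → Finset ℝ}
    (hs : IsExhaustion (eigenvaluesOf A) s) (h₁ : IsContour K D a b γ₁)
    (h₂ : IsContour K D a b γ₂) (hv₁ : variation K γ₁ < ∞) (hv₂ : variation K γ₂ < ∞)
    (hd : ‖X‖ < d) (hd₁ : ∀ c ∈ eigenvaluesOf A, ∀ t, d ≤ ‖(c : ℂ) - γ₁ t‖)
    (hd₂ : ∀ c ∈ eigenvaluesOf A, ∀ t, d ≤ ‖(c : ℂ) - γ₂ t‖) :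
    transferIntegral K γ₁ (perturb A X) = transferIntegral K γ₂ (perturb A X) := by
  have hKc := hK.continuousOn.mono subset_union_left
  have hsame := fun n => hK.sameIntegral_of_isPoleSum hσ h₁ h₂ hv₁ hv₂
    ((norm_nonneg _).trans_lt hd) hd₁ hd₂ (isPoleSum_finNeumann A X (hs.1 n) n)
  have t₁ := hA.tendsto_integral_finNeumann hKc h₁ hv₁ hd hd₁ hs fun n => (hsame n).1
  have t₂ := hA.tendsto_integral_finNeumann hKc h₂ hv₂ hd hd₂ hs fun n => (hsame n).2.1
  refine tendsto_nhds_unique t₁ (t₂.congr fun n => ((hsame n).2.2).symm)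

theorem contourDist_nonneg (A : H₁ →ₗ.[ℂ] H₁) (γ : ℝ → ℂ) : 0 ≤ contourDist A γ :=
  Real.iInf_nonneg fun _ => Metric.infDist_nonneg

theorem contourDist_le {c : ℝ} (hc : c ∈ eigenvaluesOf A) (t : ℝ) :
    contourDist A γ ≤ ‖(c : ℂ) - γ t‖ := by
  rw [norm_sub_rev, ← dist_eq_norm]
  exact (ciInf_le ⟨0, by rintro _ ⟨u, rfl⟩; exact Metric.infDist_nonneg⟩ t).trans
    (Metric.infDist_le_dist_of_mem (ofReal_mem_spectrumOf hc))

theorem le_of_mul_sub_le {x d v : ℝ} (hd : 0 ≤ d) (hv : 0 ≤ v) (hvd : v < 1 / 4 * d ^ 2)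
    (hx : x < d - √v) (hxv : x ≤ v * (d - x)⁻¹) : x ≤ d / 2 - √(d ^ 2 / 4 - v) := by
  have hq := Real.sq_sqrt (show 0 ≤ d ^ 2 / 4 - v by linarith)
  have hq0 : 0 < √(d ^ 2 / 4 - v) := Real.sqrt_pos.2 (by linarith)
  have hs := Real.sq_sqrt hv
  have hs0 := Real.sqrt_nonneg v
  set q := √(d ^ 2 / 4 - v)
  set s := √v
  have hdx : 0 < d - x := by linarith
  have h1 : x * (d - x) ≤ v := by
    have := mul_le_mul_of_nonneg_right hxv hdx.le
    rwa [inv_mul_cancel_right₀ hdx.ne'] at this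
  have h2 : s < d / 2 := by nlinarith
  have h3 : d / 2 - s ≤ q := by
    by_contra! hcon
    nlinarith
  by_contra! hcon
  nlinarith

theorem IsAdmissibleContour.pos (h : IsAdmissibleContour A K D a b γ) : 0 < contourDist A γ := by
  have h1 := h.2.2
  have h2 : 0 ≤ (variation K γ).toReal := ENNReal.toReal_nonneg
  have h3 := contourDist_nonneg A γ
  by_contra! h4
  have : contourDist A γ = 0 := le_antisymm h4 h3
  rw [this] at h1
  linarith

theorem IsAdmissibleContour.rMin_lt (h : IsAdmissibleContour A K D a b γ) :
    rMin A K γ < contourDist A γ / 2 := by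
  have : 0 < √(contourDist A γ ^ 2 / 4 - (variation K γ).toReal) :=
    Real.sqrt_pos.2 (by linarith [h.2.2])
  rw [rMin]; linarith

theorem IsAdmissibleContour.rMin_nonneg (h : IsAdmissibleContour A K D a b γ) :
    0 ≤ rMin A K γ := by
  have h2 : 0 ≤ (variation K γ).toReal := ENNReal.toReal_nonneg
  rw [rMin, sub_nonneg, Real.sqrt_le_left (by linarith [h.pos])]
  nlinarith

theorem IsAdmissibleContour.rMin_mul (h : IsAdmissibleContour A K D a b γ) :
    rMin A K γ * (contourDist A γ - rMin A K γ) = (variation K γ).toReal := by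
  have hq := Real.sq_sqrt (show 0 ≤ contourDist A γ ^ 2 / 4 - (variation K γ).toReal by
    linarith [h.2.2])
  rw [rMin]
  linear_combination -hq

theorem IsAdmissibleContour.half_lt_rMax (h : IsAdmissibleContour A K D a b γ) :
    contourDist A γ / 2 < rMax A K γ := by
  have : √(variation K γ).toReal < contourDist A γ / 2 := by
    rw [Real.sqrt_lt' (by linarith [h.pos])]
    linarith [h.2.2]
  rw [rMax]; linarith

theorem IsBasicSolution.norm_le_rMin (hA : HasCompactResolvent A) (hKc : ContinuousOn K D)
    (h : IsAdmissibleContour A K D a b γ) (hX : IsBasicSolution A K γ X) :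
    ‖X‖ ≤ rMin A K γ := by
  have hX2 : ‖X‖ < contourDist A γ := hX.2.trans_le (by
    rw [rMax]; linarith [Real.sqrt_nonneg (variation K γ).toReal])
  refine le_of_mul_sub_le h.pos.le ENNReal.toReal_nonneg h.2.2 hX.2 ?_
  conv_lhs => rw [hX.1]
  exact hA.norm_transferIntegral_le hKc h.1 h.2.1 hX2 fun c hc t => contourDist_le hc t

/-- The basic equation has a solution. -/
theorem IsAdmissibleContour.exists_isBasicSolution (hA : HasCompactResolvent A)
    (hKc : ContinuousOn K D) (h : IsAdmissibleContour A K D a b γ) :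
    ∃ X, IsBasicSolution A K γ X := by
  have hd := h.pos
  have hρ0 := h.rMin_nonneg
  have hρd := h.rMin_lt
  have hρ := h.rMin_mul
  set d := contourDist A γ with hd_def
  set ρ := rMin A K γ with hρ_def
  set v := (variation K γ).toReal with hv_def
  have hdist : ∀ c ∈ eigenvaluesOf A, ∀ t, d ≤ ‖(c : ℂ) - γ t‖ := fun c hc t =>
    contourDist_le hc t
  let Φ : (H₁ →L[ℂ] H₁) → (H₁ →L[ℂ] H₁) := fun X => transferIntegral K γ (perturb A X)
  have hmaps : MapsTo Φ (Metric.closedBall 0 ρ) (Metric.closedBall 0 ρ) := fun X hX => by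
    rw [mem_closedBall_zero_iff] at hX ⊢
    have hX' : ‖X‖ < d := by linarith
    refine (hA.norm_transferIntegral_le hKc h.1 h.2.1 hX' hdist).trans ?_
    rw [← div_eq_mul_inv, div_le_iff₀ (by linarith), ← hv_def, ← hρ]
    gcongr
  have hk : v * ((d - ρ)⁻¹ * (d - ρ)⁻¹) < 1 := by
    have h1 : 0 < d - ρ := by linarith
    rw [← mul_inv, ← div_eq_mul_inv, div_lt_one (by positivity), ← hρ]
    exact mul_lt_mul_of_pos_right (by linarith) h1
  have hv0 : 0 ≤ v := ENNReal.toReal_nonneg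
  have hk0 : 0 ≤ v * ((d - ρ)⁻¹ * (d - ρ)⁻¹) := by
    have h1 : 0 < d - ρ := by linarith
    positivity
  have hcontr : ContractingWith ⟨v * ((d - ρ)⁻¹ * (d - ρ)⁻¹), hk0⟩
      (hmaps.restrict Φ (Metric.closedBall 0 ρ) (Metric.closedBall 0 ρ)) := by
    refine ⟨by exact_mod_cast hk, LipschitzWith.of_dist_le_mul fun X Y => ?_⟩
    have hX := mem_closedBall_zero_iff.1 X.2
    have hY := mem_closedBall_zero_iff.1 Y.2
    rw [Subtype.dist_eq, Subtype.dist_eq, dist_eq_norm, dist_eq_norm]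
    refine (hA.norm_transferIntegral_sub_le hKc h.1 h.2.1 (d := d) (by linarith) (by linarith)
      hdist).trans ?_
    have h1 : 0 < d - ρ := by linarith
    have e1 : (d - ‖(X : H₁ →L[ℂ] H₁)‖)⁻¹ ≤ (d - ρ)⁻¹ := by gcongr
    have e2 : (d - ‖(Y : H₁ →L[ℂ] H₁)‖)⁻¹ ≤ (d - ρ)⁻¹ := by gcongr
    have e3 : 0 ≤ (d - ‖(Y : H₁ →L[ℂ] H₁)‖)⁻¹ := inv_nonneg.2 (by linarith)
    calc _ ≤ v * ((d - ρ)⁻¹ * ‖(X : H₁ →L[ℂ] H₁) - Y‖ * (d - ρ)⁻¹) := by gcongr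
      _ = v * ((d - ρ)⁻¹ * (d - ρ)⁻¹) * ‖(X : H₁ →L[ℂ] H₁) - Y‖ := by ring
  obtain ⟨X, hX, hfix, -⟩ := hcontr.exists_fixedPoint' Metric.isClosed_closedBall.isComplete
    hmaps (Metric.mem_closedBall_self hρ0) (edist_ne_top _ _)
  refine ⟨X, hfix.symm, ?_⟩
  rw [mem_closedBall_zero_iff] at hX
  linarith [h.half_lt_rMax]

theorem eq_of_transferIntegral_eq (hA : HasCompactResolvent A)
    (hKc : ContinuousOn K D) (h : IsAdmissibleContour A K D a b γ)
    (hX : X = transferIntegral K γ (perturb A X)) (hY : Y = transferIntegral K γ (perturb A Y))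
    (hX2 : ‖X‖ < contourDist A γ / 2) (hY2 : ‖Y‖ < contourDist A γ / 2) : X = Y := by
  have hd := h.pos
  have hadm := h.2.2
  have h1 := hA.norm_transferIntegral_sub_le hKc h.1 h.2.1 (d := contourDist A γ)
    (X := X) (Y := Y) (by linarith) (by linarith) fun c hc t => contourDist_le hc t
  rw [← hX, ← hY] at h1
  set d := contourDist A γ
  set v := (variation K γ).toReal
  have hpos : d / 2 < d - ‖X‖ := by linarith
  have hpos' : d / 2 < d - ‖Y‖ := by linarith
  by_contra hne
  have hn : 0 < ‖X - Y‖ := norm_pos_iff.2 (sub_ne_zero.2 hne)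
  have h2 : v * ((d - ‖X‖)⁻¹ * ‖X - Y‖ * (d - ‖Y‖)⁻¹) =
      v / ((d - ‖X‖) * (d - ‖Y‖)) * ‖X - Y‖ := by
    rw [div_eq_mul_inv, mul_inv]; ring
  have h3 : v / ((d - ‖X‖) * (d - ‖Y‖)) < 1 := by
    rw [div_lt_one (by nlinarith)]
    nlinarith
  rw [h2] at h1
  nlinarith

/-- A basic solution is bounded by `r_min(Γ)` for every admissible contour `Γ`. -/
theorem IsOneSidedContinuation.norm_le_rMin (hK : IsOneSidedContinuation E B a b D K o)
    (hA : HasCompactResolvent A) (hσ : eigenvaluesOf A ⊆ realInterval a b) {s : ℕ → Finset ℝ}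
    (hs : IsExhaustion (eigenvaluesOf A) s) (h₁ : IsAdmissibleContour A K D a b γ₁)
    (h₂ : IsAdmissibleContour A K D a b γ₂) (hX : IsBasicSolution A K γ₁ X) :
    ‖X‖ ≤ rMin A K γ₂ := by
  have hKc := hK.continuousOn.mono subset_union_left
  have hX1 := (hX.norm_le_rMin hA hKc h₁).trans_lt h₁.rMin_lt
  have p₁ := h₁.pos
  have p₂ := h₂.pos
  have hmove : ∀ Z : H₁ →L[ℂ] H₁, ‖Z‖ < contourDist A γ₁ → ‖Z‖ < contourDist A γ₂ →
      transferIntegral K γ₁ (perturb A Z) = transferIntegral K γ₂ (perturb A Z) := fun Z z₁ z₂ =>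
    hK.transferIntegral_eq hA hσ hs h₁.1 h₂.1 h₁.2.1 h₂.2.1 (lt_min z₁ z₂)
      (fun c hc t => (min_le_left _ _).trans (contourDist_le hc t))
      fun c hc t => (min_le_right _ _).trans (contourDist_le hc t)
  rcases le_total (contourDist A γ₁) (contourDist A γ₂) with hle | hle
  · refine IsBasicSolution.norm_le_rMin hA hKc h₂ ⟨?_, ?_⟩
    · rw [← hmove X (by linarith) (by linarith)]
      exact hX.1
    · linarith [h₂.half_lt_rMax]
  · obtain ⟨Y, hY⟩ := h₂.exists_isBasicSolution hA hKc
    have hYle := hY.norm_le_rMin hA hKc h₂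
    have hY2 := hYle.trans_lt h₂.rMin_lt
    have : X = Y := by
      refine eq_of_transferIntegral_eq hA hKc h₁ hX.1 ?_ hX1 (by linarith)
      rw [hmove Y (by linarith) (by linarith)]
      exact hY.1
    rwa [this]

theorem IsOneSidedContinuation.norm_lt_of_rZero_lt (hK : IsOneSidedContinuation E B a b D K o)
    (hA : HasCompactResolvent A) (hσ : eigenvaluesOf A ⊆ realInterval a b) {s : ℕ → Finset ℝ}
    (hs : IsExhaustion (eigenvaluesOf A) s) (h : IsAdmissibleContour A K D a b γ)
    (hX : IsBasicSolution A K γ X) {r : ℝ} (hr : rZero A K D a b < r) : ‖X‖ < r := by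
  obtain ⟨_, ⟨γ', hγ', rfl⟩, hlt⟩ := exists_lt_of_csInf_lt
    (Set.Nonempty.image _ ⟨γ, show γ ∈ {γ | IsAdmissibleContour A K D a b γ} from h⟩) hr
  exact (hK.norm_le_rMin hA hσ hs h hγ' hX).trans_lt hlt

end Basic

/-! ### The continued derivative on either side of the real axis -/

section Reflection

variable {H₀ H₁ : Type*} [NormedAddCommGroup H₀] [InnerProductSpace ℂ H₀] [CompleteSpace H₀]
  [NormedAddCommGroup H₁] [InnerProductSpace ℂ H₁] [CompleteSpace H₁]
  {E : SpectralMeasure H₀} {B : H₁ →L[ℂ] H₀} {a b : EReal} {D : Set ℂ} {K : ℂ → H₁ →L[ℂ] H₁}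

theorem SpectralMeasure.isSelfAdjoint_proj_Iio (E : SpectralMeasure H₀) (x : ℝ) :
    IsSelfAdjoint (E.proj (Iio x)) :=
  (E.isStarProjection _ measurableSet_Iio).isSelfAdjoint

theorem star_couplingFunction (E : SpectralMeasure H₀) (B : H₁ →L[ℂ] H₀) (x : ℝ) :
    star (couplingFunction E B x) = couplingFunction E B x := by
  have h := E.isSelfAdjoint_proj_Iio x
  rw [ContinuousLinearMap.isSelfAdjoint_iff'] at h
  rw [ContinuousLinearMap.star_eq_adjoint, couplingFunction, ContinuousLinearMap.adjoint_comp,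
    ContinuousLinearMap.adjoint_comp, h, ContinuousLinearMap.adjoint_adjoint,
    ContinuousLinearMap.comp_assoc]

theorem star_deriv_couplingFunction {x : ℝ} {T : H₁ →L[ℂ] H₁}
    (h : HasDerivAt (couplingFunction E B) T x) : star T = T := by
  have h1 := h.star
  simp only [star_couplingFunction] at h1
  exact h1.unique h

theorem reflect_of_im_nonpos {z : ℂ} (hz : z.im ≤ 0) : reflect K z = K z := if_pos hz

theorem reflect_of_im_pos {z : ℂ} (hz : 0 < z.im) :
    reflect K z = star (K ((starRingEnd ℂ) z)) := by
  rw [reflect, if_neg hz.not_ge, ContinuousLinearMap.star_eq_adjoint]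

theorem IsContinuedDerivative.isOneSidedContinuation_neg_one
    (h : IsContinuedDerivative E B a b D K) :
    IsOneSidedContinuation E B a b D (reflect K) (-1) := by
  have hD : EqOn (reflect K) K D := fun z hz => reflect_of_im_nonpos (h.im_neg z hz).le
  refine ⟨h.isOpen, h.isSimplyConnected, by norm_num, fun z hz => ?_, fun x hx => ?_,
    fun x hx => ?_, ?_, ?_⟩
  · linarith [h.im_neg z hz]
  · filter_upwards [h.adjoins x hx] with z hz hz'
    exact hz (by linarith)
  · rw [reflect_of_im_nonpos (by simp)]
    exact h.hasDerivAt x hx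
  · refine h.continuousOn.congr ?_
    rintro z (hz | ⟨x, -, rfl⟩)
    · exact hD hz
    · exact reflect_of_im_nonpos (by simp)
  · exact h.differentiableOn.congr hD

theorem IsContinuedDerivative.isOneSidedContinuation_one
    (h : IsContinuedDerivative E B a b D K) :
    IsOneSidedContinuation E B a b {z | (starRingEnd ℂ) z ∈ D} (reflect K) 1 := by
  have him : ∀ z ∈ {z | (starRingEnd ℂ) z ∈ D}, 0 < z.im := fun z hz => by
    simpa using h.im_neg _ hz
  have hD : EqOn (reflect K) (fun z => star (K ((starRingEnd ℂ) z)))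
      {z | (starRingEnd ℂ) z ∈ D} := fun z hz => reflect_of_im_pos (him z hz)
  refine ⟨h.isOpen.preimage Complex.continuous_conj, ?_, by norm_num, fun z hz => ?_,
    fun x hx => ?_, fun x hx => ?_, ?_, ?_⟩
  · exact (Complex.conjLIE.toHomeomorph.isSimplyConnected_preimage (s := D)).2 h.isSimplyConnected
  · linarith [him z hz]
  · have h1 : Tendsto (starRingEnd ℂ) (𝓝 (x : ℂ)) (𝓝 (x : ℂ)) := by
      simpa using Complex.continuous_conj.tendsto (x : ℂ)
    filter_upwards [h1.eventually (h.adjoins x hx)] with z hz hz'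
    exact hz (by simpa using hz')
  · rw [reflect_of_im_nonpos (by simp)]
    exact h.hasDerivAt x hx
  · have h1 : ContinuousOn (fun z => star (K ((starRingEnd ℂ) z)))
        ({z | (starRingEnd ℂ) z ∈ D} ∪ (fun x : ℝ => (x : ℂ)) '' realInterval a b) := by
      refine (h.continuousOn.comp Complex.continuous_conj.continuousOn ?_).star
      rintro z (hz | ⟨x, hx, rfl⟩)
      · exact Or.inl hz
      · exact Or.inr ⟨x, hx, by simp⟩
    refine h1.congr ?_
    rintro z (hz | ⟨x, hx, rfl⟩)
    · exact hD hz
    · change reflect K x = star (K ((starRingEnd ℂ) x))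
      rw [reflect_of_im_nonpos (by simp), Complex.conj_ofReal,
        star_deriv_couplingFunction (h.hasDerivAt x hx)]
  · refine DifferentiableOn.congr (fun z hz => ?_) hD
    have h1 := (h.differentiableOn.differentiableAt (h.isOpen.mem_nhds hz)).star_conj
    rw [Complex.conj_conj] at h1
    exact h1.differentiableWithinAt

theorem IsContinuedDerivative.exists_isOneSidedContinuation
    (h : IsContinuedDerivative E B a b D K) (l : ℤˣ) :
    ∃ o, IsOneSidedContinuation E B a b (signedDomain D l) (reflect K) o := by
  rw [signedDomain]
  split_ifs
  · exact ⟨_, h.isOneSidedContinuation_neg_one⟩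
  · exact ⟨_, h.isOneSidedContinuation_one⟩

end Reflection

theorem exists_isExhaustion {σ : Set ℝ} {lam : ℕ → ℝ} (hlam : lam '' Ici 1 = σ)
    (hlim : Tendsto lam atTop atTop) : ∃ s, IsExhaustion σ s := by
  classical
  refine ⟨fun n => (Finset.Icc 1 n).image lam, fun n c hc => ?_, fun M => ?_⟩
  · obtain ⟨i, hi, rfl⟩ := Finset.mem_image.1 hc
    exact hlam ▸ mem_image_of_mem _ (Finset.mem_Icc.1 hi).1
  · obtain ⟨N, hN⟩ := eventually_atTop.1 (hlim.eventually_ge_atTop M)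
    filter_upwards [eventually_ge_atTop N] with n hn c hc hcn
    rw [← hlam] at hc
    obtain ⟨i, hi, rfl⟩ := hc
    have hni : n < i := by
      by_contra! hin
      exact hcn (Finset.mem_image_of_mem _ (Finset.mem_Icc.2 ⟨hi, hin⟩))
    exact (hN i (hn.trans hni.le)).trans (le_abs_self _)

/-! ### Riesz projections -/

section CauchyIntegral

variable {V : Type*} [NormedAddCommGroup V] [NormedSpace ℂ V] {c : ℂ} {R : ℝ} {f : ℂ → V}

theorem ne_of_notMem_sphere {w z : ℂ} (hw : w ∈ Metric.sphere c R) (hz : z ∉ Metric.sphere c R) :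
    w - z ≠ 0 := fun h => hz (by rwa [← sub_eq_zero.1 h])

theorem continuousOn_inv_sub_smul (hf : ContinuousOn f (Metric.sphere c R)) {z : ℂ}
    (hz : z ∉ Metric.sphere c R) :
    ContinuousOn (fun w => (w - z)⁻¹ • f w) (Metric.sphere c R) :=
  ((continuousOn_id.sub continuousOn_const).inv₀ fun _ hw => ne_of_notMem_sphere hw hz).smul hf

/-- Integrals of Cauchy type are holomorphic off the circle. -/
theorem differentiableAt_circleIntegral_inv_sub_smul (hR : 0 ≤ R)
    (hf : ContinuousOn f (Metric.sphere c R)) {z₀ : ℂ} (hz₀ : z₀ ∉ Metric.sphere c R) :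
    DifferentiableAt ℂ (fun z => ∮ w in C(c, R), (w - z)⁻¹ • f w) z₀ := by
  obtain ⟨δ, hδ, hball⟩ := Metric.nhds_basis_closedBall.mem_iff.1
    (Metric.isClosed_sphere.isOpen_compl.mem_nhds hz₀)
  have hmem : ∀ θ, circleMap c R θ ∈ Metric.sphere c R := circleMap_mem_sphere c hR
  have hcont : Continuous fun θ => f (circleMap c R θ) :=
    hf.comp_continuous (continuous_circleMap c R) hmem
  obtain ⟨M, hM⟩ := (isCompact_sphere c R).exists_bound_of_continuousOn hf
  have hsep : ∀ z ∈ Metric.ball z₀ (δ / 2), ∀ θ, δ / 2 ≤ ‖circleMap c R θ - z‖ := by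
    intro z hz θ
    have h1 : δ < dist (circleMap c R θ) z₀ := by
      by_contra! h
      exact hball (Metric.mem_closedBall.2 h) (hmem θ)
    have h2 := dist_triangle (circleMap c R θ) z z₀
    rw [← dist_eq_norm]
    linarith [Metric.mem_ball.1 hz]
  have hne : ∀ z ∈ Metric.ball z₀ (δ / 2), ∀ θ, circleMap c R θ - z ≠ 0 := fun z hz θ =>
    norm_pos_iff.1 ((half_pos hδ).trans_le (hsep z hz θ))
  have hz₀' : z₀ ∈ Metric.ball z₀ (δ / 2) := Metric.mem_ball_self (half_pos hδ)
  have hF : ∀ z ∈ Metric.ball z₀ (δ / 2), Continuous fun θ =>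
      deriv (circleMap c R) θ • (circleMap c R θ - z)⁻¹ • f (circleMap c R θ) := fun z hz => by
    simp only [deriv_circleMap]
    exact ((continuous_circleMap 0 R).mul continuous_const).smul
      ((((continuous_circleMap c R).sub continuous_const).inv₀ (hne z hz)).smul hcont)
  have hF' : Continuous fun θ => deriv (circleMap c R) θ •
      (((circleMap c R θ - z₀) ^ 2)⁻¹ • f (circleMap c R θ)) := by
    simp only [deriv_circleMap]
    exact ((continuous_circleMap 0 R).mul continuous_const).smul
      (((((continuous_circleMap c R).sub continuous_const).pow 2).inv₀
        fun θ => pow_ne_zero 2 (hne z₀ hz₀' θ)).smul hcont)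
  refine (intervalIntegral.hasDerivAt_integral_of_dominated_loc_of_deriv_le
    (F' := fun z θ => deriv (circleMap c R) θ •
      (((circleMap c R θ - z) ^ 2)⁻¹ • f (circleMap c R θ)))
    (bound := fun _ => R * (((δ / 2) ^ 2)⁻¹ * M))
    (Metric.ball_mem_nhds z₀ (half_pos hδ)) ?_ ((hF z₀ hz₀').intervalIntegrable _ _)
    hF'.aestronglyMeasurable ?_ intervalIntegrable_const ?_).2.differentiableAt
  · filter_upwards [Metric.ball_mem_nhds z₀ (half_pos hδ)] with z hz
    exact (hF z hz).aestronglyMeasurable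
  · refine Eventually.of_forall fun θ _ z hz => ?_
    rw [norm_smul, norm_smul, norm_inv, norm_pow, deriv_circleMap, norm_mul, Complex.norm_I, mul_one,
      norm_circleMap_zero, abs_of_nonneg hR]
    have := hsep z hz θ
    have := hM _ (hmem θ)
    gcongr
  · refine Eventually.of_forall fun θ _ z hz => ?_
    have h1 : HasDerivAt (fun z => (circleMap c R θ - z)⁻¹) (((circleMap c R θ - z) ^ 2)⁻¹) z := by
      have := ((hasDerivAt_id z).const_sub (circleMap c R θ)).fun_inv (hne z hz θ)
      simpa [div_eq_mul_inv] using this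
    exact (h1.smul_const _).const_smul _

end CauchyIntegral

section Riesz

variable {H : Type*} [NormedAddCommGroup H] [InnerProductSpace ℂ H] [CompleteSpace H]
  {T : H →ₗ.[ℂ] H} {c c' z : ℂ} {R R' : ℝ}

set_option linter.unusedSectionVars false

theorem map_circleIntegral {V W : Type*} [NormedAddCommGroup V] [NormedSpace ℂ V]
    [CompleteSpace V] [NormedAddCommGroup W] [NormedSpace ℂ W] [CompleteSpace W] (L : V →L[ℂ] W)
    {f : ℂ → V} (hf : CircleIntegrable f c R) :
    L (∮ z in C(c, R), f z) = ∮ z in C(c, R), L (f z) := by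
  rw [circleIntegral, ← L.intervalIntegral_comp_comm hf.out]
  simp only [map_smul]
  rfl

theorem rieszProjection_eq_smul (T : H →ₗ.[ℂ] H) (c : ℂ) (R : ℝ) :
    rieszProjection T c R =
      -((2 * (Real.pi : ℂ) * Complex.I)⁻¹ • ∮ z in C(c, R), resolventOf T z) := by
  rw [rieszProjection, neg_smul, one_div]

theorem circleIntegral_resolventOf (T : H →ₗ.[ℂ] H) (c : ℂ) (R : ℝ) :
    ∮ z in C(c, R), resolventOf T z =
      -((2 * (Real.pi : ℂ) * Complex.I) • rieszProjection T c R) := by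
  rw [rieszProjection_eq_smul, smul_neg, smul_inv_smul₀ Complex.two_pi_I_ne_zero, neg_neg]

theorem circleIntegrable_resolventOf (hR : 0 ≤ R) (hs : Metric.sphere c R ⊆ resolventSetOf T) :
    CircleIntegrable (resolventOf T) c R :=
  ((continuousOn_resolventOf T).mono hs).circleIntegrable hR

/-- The resolvent identity, integrated over a circle. -/
theorem circleIntegral_inv_sub_smul_resolventOf (hR : 0 ≤ R)
    (hs : Metric.sphere c R ⊆ resolventSetOf T) (hz : z ∈ resolventSetOf T)
    (hzs : z ∉ Metric.sphere c R) :
    ∮ w in C(c, R), (w - z)⁻¹ • resolventOf T w =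
      (∮ w in C(c, R), (w - z)⁻¹) • resolventOf T z -
        (2 * (Real.pi : ℂ) * Complex.I) • (rieszProjection T c R * resolventOf T z) := by
  have hcont := (continuousOn_resolventOf T).mono hs
  have h1 : ∮ w in C(c, R), (w - z)⁻¹ • resolventOf T w =
      ∮ w in C(c, R), ((w - z)⁻¹ • resolventOf T z + resolventOf T w * resolventOf T z) := by
    refine circleIntegral.integral_congr hR fun w hw => ?_
    have := (isResolventAt_resolventOf (hs hw)).sub_eq (isResolventAt_resolventOf hz)
    change _ = (w - z)⁻¹ • _ + _
    rw [← inv_smul_smul₀ (ne_of_notMem_sphere hw hzs) (resolventOf T w * resolventOf T z), ← this,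
      ← smul_add, add_sub_cancel]
  have h2 := map_circleIntegral ((ContinuousLinearMap.mul ℂ (H →L[ℂ] H)).flip (resolventOf T z))
    (circleIntegrable_resolventOf hR hs)
  simp only [ContinuousLinearMap.flip_apply, ContinuousLinearMap.mul_apply'] at h2
  rw [h1, circleIntegral.integral_add, circleIntegral.integral_smul_const, ← h2,
    circleIntegral_resolventOf, neg_mul, smul_mul_assoc, sub_eq_add_neg]
  · refine ContinuousOn.circleIntegrable hR ?_
    exact (continuousOn_inv_sub_smul (f := fun _ => resolventOf T z) continuousOn_const hzs)
  · exact (hcont.mul continuousOn_const).circleIntegrable hR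

theorem circleIntegral_inv_sub_smul_of_mem_ball
    (hs : Metric.sphere c R ⊆ resolventSetOf T) (hz : z ∈ resolventSetOf T)
    (hzb : z ∈ Metric.ball c R) :
    ∮ w in C(c, R), (w - z)⁻¹ • resolventOf T w =
      (2 * (Real.pi : ℂ) * Complex.I) • (resolventOf T z - rieszProjection T c R * resolventOf T z)
        := by
  have hR : 0 ≤ R := dist_nonneg.trans (Metric.mem_ball.1 hzb).le
  rw [circleIntegral_inv_sub_smul_resolventOf hR hs hz
    (fun h => (Metric.mem_ball.1 hzb).ne (Metric.mem_sphere.1 h)),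
    circleIntegral.integral_sub_inv_of_mem_ball hzb, smul_sub]

theorem circleIntegral_inv_sub_smul_of_notMem_closedBall (hR : 0 ≤ R)
    (hs : Metric.sphere c R ⊆ resolventSetOf T) (hz : z ∈ resolventSetOf T)
    (hzb : z ∉ Metric.closedBall c R) :
    ∮ w in C(c, R), (w - z)⁻¹ • resolventOf T w =
      -((2 * (Real.pi : ℂ) * Complex.I) • (rieszProjection T c R * resolventOf T z)) := by
  have hne : ∀ w ∈ Metric.closedBall c R, w - z ≠ 0 := fun w hw h =>
    hzb (by rwa [← sub_eq_zero.1 h])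
  have h0 : ∮ w in C(c, R), (w - z)⁻¹ = 0 := by
    refine Complex.circleIntegral_eq_zero_of_differentiable_on_off_countable hR countable_empty
      ((continuousOn_id.sub continuousOn_const).inv₀ hne) fun w hw => ?_
    exact (differentiableAt_id.sub_const z).fun_inv (hne w (Metric.ball_subset_closedBall hw.1))
  rw [circleIntegral_inv_sub_smul_resolventOf hR hs hz
    (fun h => hzb (Metric.sphere_subset_closedBall h)), h0, zero_smul, zero_sub]

theorem rieszProjection_mul (S : H →L[ℂ] H) (hR : 0 ≤ R)
    (hs : Metric.sphere c R ⊆ resolventSetOf T) :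
    S * rieszProjection T c R =
      -((2 * (Real.pi : ℂ) * Complex.I)⁻¹ • ∮ z in C(c, R), S * resolventOf T z) := by
  have h := map_circleIntegral (ContinuousLinearMap.mul ℂ (H →L[ℂ] H) S)
    (circleIntegrable_resolventOf hR hs)
  simp only [ContinuousLinearMap.mul_apply'] at h
  rw [rieszProjection_eq_smul, mul_neg, mul_smul_comm, h]

/-- Riesz projections for disjoint discs annihilate each other. -/
theorem rieszProjection_mul_of_disjoint (hR : 0 ≤ R) (hR' : 0 ≤ R')
    (hs : Metric.sphere c R ⊆ resolventSetOf T) (hs' : Metric.sphere c' R' ⊆ resolventSetOf T)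
    (hd : Disjoint (Metric.closedBall c R) (Metric.closedBall c' R')) :
    rieszProjection T c R * rieszProjection T c' R' = 0 := by
  have hout : ∀ z ∈ Metric.closedBall c' R', z ∉ Metric.closedBall c R := fun z hz hz' =>
    disjoint_left.1 hd hz' hz
  have hG : ∀ z ∈ Metric.closedBall c' R', DifferentiableAt ℂ
      (fun z => ∮ w in C(c, R), (w - z)⁻¹ • resolventOf T w) z := fun z hz =>
    differentiableAt_circleIntegral_inv_sub_smul hR ((continuousOn_resolventOf T).mono hs)
      fun h => hout z hz (Metric.sphere_subset_closedBall h)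
  have h1 : ∮ z in C(c', R'), rieszProjection T c R * resolventOf T z =
      ∮ z in C(c', R'), -((2 * (Real.pi : ℂ) * Complex.I)⁻¹) •
        ∮ w in C(c, R), (w - z)⁻¹ • resolventOf T w := by
    refine circleIntegral.integral_congr hR' fun z hz => ?_
    rw [circleIntegral_inv_sub_smul_of_notMem_closedBall hR hs (hs' hz)
      (hout z (Metric.sphere_subset_closedBall hz)), neg_smul_neg,
      inv_smul_smul₀ Complex.two_pi_I_ne_zero]
  rw [rieszProjection_mul _ hR' hs', h1, circleIntegral.integral_smul,
    Complex.circleIntegral_eq_zero_of_differentiable_on_off_countable hR' countable_empty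
      (fun z hz => (hG z hz).continuousAt.continuousWithinAt)
      fun z hz => hG z (Metric.ball_subset_closedBall hz.1)]
  simp

theorem rieszProjection_mul_of_lt (hR' : 0 ≤ R') (hlt : R' < R)
    (hs : Metric.sphere c R ⊆ resolventSetOf T) (hs' : Metric.sphere c R' ⊆ resolventSetOf T) :
    rieszProjection T c R * rieszProjection T c R' = rieszProjection T c R' := by
  have hR : 0 ≤ R := hR'.trans hlt.le
  have hin : ∀ z ∈ Metric.closedBall c R', z ∈ Metric.ball c R := fun z hz =>
    Metric.closedBall_subset_ball hlt hz
  have hG : ∀ z ∈ Metric.closedBall c R', DifferentiableAt ℂ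
      (fun z => ∮ w in C(c, R), (w - z)⁻¹ • resolventOf T w) z := fun z hz =>
    differentiableAt_circleIntegral_inv_sub_smul hR ((continuousOn_resolventOf T).mono hs)
      fun h => (Metric.mem_ball.1 (hin z hz)).ne (Metric.mem_sphere.1 h)
  have h1 : ∮ z in C(c, R'), rieszProjection T c R * resolventOf T z =
      ∮ z in C(c, R'), (resolventOf T z - (2 * (Real.pi : ℂ) * Complex.I)⁻¹ •
        ∮ w in C(c, R), (w - z)⁻¹ • resolventOf T w) := by
    refine circleIntegral.integral_congr hR' fun z hz => ?_
    rw [circleIntegral_inv_sub_smul_of_mem_ball hs (hs' hz)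
      (hin z (Metric.sphere_subset_closedBall hz)),
      inv_smul_smul₀ Complex.two_pi_I_ne_zero, sub_sub_cancel]
  have hGc : ContinuousOn (fun z => ∮ w in C(c, R), (w - z)⁻¹ • resolventOf T w)
      (Metric.closedBall c R') := fun z hz => (hG z hz).continuousAt.continuousWithinAt
  have hGi : CircleIntegrable (fun z => (2 * (Real.pi : ℂ) * Complex.I)⁻¹ •
      ∮ w in C(c, R), (w - z)⁻¹ • resolventOf T w) c R' :=
    ((hGc.mono Metric.sphere_subset_closedBall).fun_const_smul _).circleIntegrable hR'
  rw [rieszProjection_mul _ hR' hs', h1, circleIntegral.integral_sub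
    (circleIntegrable_resolventOf hR' hs') hGi,
    circleIntegral.integral_smul,
    Complex.circleIntegral_eq_zero_of_differentiable_on_off_countable hR' countable_empty hGc
      fun z hz => hG z (Metric.ball_subset_closedBall hz.1), smul_zero, sub_zero,
    rieszProjection_eq_smul]

theorem rieszProjection_mul_self (hR' : 0 < R') (hlt : R' < R)
    (h : Metric.closedBall c R \ Metric.ball c R' ⊆ resolventSetOf T) :
    rieszProjection T c R * rieszProjection T c R = rieszProjection T c R := by
  have hs : Metric.sphere c R ⊆ resolventSetOf T := fun z hz => h
    ⟨Metric.sphere_subset_closedBall hz, fun hz' => by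
      rw [Metric.mem_sphere] at hz; rw [Metric.mem_ball] at hz'; linarith⟩
  have hs' : Metric.sphere c R' ⊆ resolventSetOf T := fun z hz => h
    ⟨Metric.closedBall_subset_closedBall hlt.le (Metric.sphere_subset_closedBall hz), fun hz' => by
      rw [Metric.mem_sphere] at hz; rw [Metric.mem_ball] at hz'; linarith⟩
  have heq : rieszProjection T c R = rieszProjection T c R' := by
    rw [rieszProjection, rieszProjection,
      Complex.circleIntegral_eq_of_differentiable_on_annulus_off_countable hR' hlt.le
        countable_empty ((continuousOn_resolventOf T).mono h)]
    intro z hz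
    exact differentiableAt_resolventOf (h ⟨Metric.ball_subset_closedBall hz.1.1,
      fun hz' => hz.1.2 (Metric.ball_subset_closedBall hz')⟩)
  have h2 := rieszProjection_mul_of_lt hR'.le hlt hs hs'
  rwa [← heq] at h2

end Riesz

/-! ### Completeness and independence of the Riesz subspaces -/

section RieszSequence

variable {H : Type*} [NormedAddCommGroup H] [InnerProductSpace ℂ H]

theorem omegaLinearIndependent_range {Q : ℕ → H →L[ℂ] H} (hQ : ∀ k, Q k * Q k = Q k)
    (hd : ∀ j k, j ≠ k → Q j * Q k = 0) :
    OmegaLinearIndependent fun k => LinearMap.range (Q k : H →ₗ[ℂ] H) := by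
  intro x hx hsum j
  have h1 : ∀ k, Q j (x k) = if k = j then x j else 0 := by
    intro k
    obtain ⟨u, hu⟩ := hx k
    change Q k u = x k at hu
    rw [← hu]
    change (Q j * Q k) u = _
    split_ifs with hkj
    · subst hkj
      rw [hQ, hu]
    · rw [hd j k (Ne.symm hkj), zero_apply]
  have h2 : Tendsto (fun n => Q j (∑ k ∈ Finset.range n, x k)) atTop (𝓝 (x j)) := by
    refine tendsto_const_nhds.congr' ?_
    filter_upwards [eventually_gt_atTop j] with n hn
    rw [map_sum, Finset.sum_congr rfl fun k _ => h1 k, Finset.sum_ite_eq' _ j, if_pos]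
    exact Finset.mem_range.2 hn
  have h3 := ((Q j).continuous.tendsto 0).comp hsum
  rw [map_zero] at h3
  exact tendsto_nhds_unique h2 h3

variable [CompleteSpace H] {T : H →ₗ.[ℂ] H} {c : ℕ → ℂ} {R : ℕ → ℝ} {M : ℝ} {x y : H}

/-- If `y` is orthogonal to the range of the Riesz projection, the function `⟪y, (T - z)⁻¹ x⟫` is
given in the disc by an integral of Cauchy type. -/
theorem inner_resolventOf_eq_of_mem_ball {c : ℂ} {R : ℝ} {z : ℂ}
    (hs : Metric.sphere c R ⊆ resolventSetOf T)
    (hy : ∀ v, ⟪y, rieszProjection T c R v⟫_ℂ = 0) (hz : z ∈ resolventSetOf T)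
    (hzb : z ∈ Metric.ball c R) :
    ⟪y, resolventOf T z x⟫_ℂ = (2 * (Real.pi : ℂ) * Complex.I)⁻¹ •
      ⟪y, (∮ w in C(c, R), (w - z)⁻¹ • resolventOf T w) x⟫_ℂ := by
  rw [circleIntegral_inv_sub_smul_of_mem_ball hs hz hzb, smul_apply, inner_smul_right, smul_eq_mul,
    inv_mul_cancel_left₀ Complex.two_pi_I_ne_zero, sub_apply, mul_apply_eq_comp, inner_sub_right,
    hy, sub_zero]

theorem inner_resolventOf_eq_zero (hR : ∀ k, 0 < R k)
    (hs : ∀ k, Metric.sphere (c k) (R k) ⊆ resolventSetOf T)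
    (hd : Pairwise fun j k =>
      Disjoint (Metric.closedBall (c j) (R j)) (Metric.closedBall (c k) (R k)))
    (hout : ∀ z, (∀ k, z ∉ Metric.ball (c k) (R k)) → z ∈ resolventSetOf T ∧ ‖resolventOf T z‖ ≤ M)
    (hsmall : ∀ ε > 0, ∃ z ∈ resolventSetOf T, ‖resolventOf T z‖ ≤ ε)
    (hy : ∀ k v, ⟪y, rieszProjection T (c k) (R k) v⟫_ℂ = 0) {z : ℂ} (hz : z ∈ resolventSetOf T) :
    ⟪y, resolventOf T z x⟫_ℂ = 0 := by
  classical
  set φ : (H →L[ℂ] H) →L[ℂ] ℂ := (innerSL ℂ y).comp (ContinuousLinearMap.apply ℂ H x) with hφ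
  have hφa : ∀ S : H →L[ℂ] H, φ S = ⟪y, S x⟫_ℂ := fun S => rfl
  let f : ℂ → ℂ := fun z => ⟪y, resolventOf T z x⟫_ℂ
  let h : ℕ → ℂ → ℂ := fun k z => (2 * (Real.pi : ℂ) * Complex.I)⁻¹ •
    ⟪y, (∮ w in C(c k, R k), (w - z)⁻¹ • resolventOf T w) x⟫_ℂ
  let g : ℂ → ℂ := fun z => if z ∈ resolventSetOf T then f z else
    if hk : ∃ k, z ∈ Metric.ball (c k) (R k) then h hk.choose z else 0
  have hgf : ∀ z ∈ resolventSetOf T, g z = f z := fun z hz => if_pos hz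
  have huniq : ∀ j k z, z ∈ Metric.closedBall (c j) (R j) → z ∈ Metric.closedBall (c k) (R k) →
      j = k := fun j k z hj hk => by
    by_contra hjk
    exact disjoint_left.1 (hd hjk) hj hk
  have hgh : ∀ k, EqOn g (h k) (Metric.ball (c k) (R k)) := by
    intro k z hz
    by_cases hzr : z ∈ resolventSetOf T
    · rw [hgf z hzr]
      exact inner_resolventOf_eq_of_mem_ball (hs k) (hy k) hzr hz
    · have hk : ∃ k, z ∈ Metric.ball (c k) (R k) := ⟨k, hz⟩
      have : hk.choose = k := huniq _ _ z (Metric.ball_subset_closedBall hk.choose_spec)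
        (Metric.ball_subset_closedBall hz)
      simp only [g, if_neg hzr, dif_pos hk, this]
  have hgd : Differentiable ℂ g := by
    intro z
    by_cases hzk : ∃ k, z ∈ Metric.ball (c k) (R k)
    · obtain ⟨k, hk⟩ := hzk
      have h1 := differentiableAt_circleIntegral_inv_sub_smul (hR k).le
        ((continuousOn_resolventOf T).mono (hs k)) (z₀ := z)
        fun h => (Metric.mem_ball.1 hk).ne (Metric.mem_sphere.1 h)
      have h2 : DifferentiableAt ℂ (h k) z :=
        ((φ.differentiableAt).comp z h1).const_smul (2 * (Real.pi : ℂ) * Complex.I)⁻¹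
      exact h2.congr_of_eventuallyEq ((hgh k).eventuallyEq_of_mem (Metric.isOpen_ball.mem_nhds hk))
    · push Not at hzk
      have hz := (hout z hzk).1
      have h2 : DifferentiableAt ℂ f z := (φ.differentiableAt).comp z (differentiableAt_resolventOf hz)
      exact h2.congr_of_eventuallyEq
        (EqOn.eventuallyEq_of_mem hgf ((isOpen_resolventSetOf T).mem_nhds hz))
  have hfle : ∀ z, ‖f z‖ ≤ ‖y‖ * (‖resolventOf T z‖ * ‖x‖) := fun z =>
    (norm_inner_le_norm _ _).trans (by gcongr; exact ContinuousLinearMap.le_opNorm _ _)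
  have hgout : ∀ z, (∀ k, z ∉ Metric.ball (c k) (R k)) → ‖g z‖ ≤ ‖y‖ * (M * ‖x‖) := by
    intro z hz
    rw [hgf z (hout z hz).1]
    refine (hfle z).trans ?_
    gcongr
    exact (hout z hz).2
  have hbdd : ∀ z, ‖g z‖ ≤ ‖y‖ * (M * ‖x‖) := by
    intro z
    by_cases hzk : ∃ k, z ∈ Metric.ball (c k) (R k)
    · obtain ⟨k, hk⟩ := hzk
      refine Complex.norm_le_of_forall_mem_frontier_norm_le Metric.isBounded_ball hgd.diffContOnCl
        (fun w hw => hgout w fun j hj => ?_) (subset_closure hk)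
      rw [frontier_ball _ (hR k).ne'] at hw
      obtain rfl := huniq j k w (Metric.ball_subset_closedBall hj)
        (Metric.sphere_subset_closedBall hw)
      exact (Metric.mem_ball.1 hj).ne (Metric.mem_sphere.1 hw)
    · push Not at hzk
      exact hgout z hzk
  have hconst : ∀ w, g z = g w := fun w => hgd.apply_eq_apply_of_bounded
    (isBounded_iff_forall_norm_le.2 ⟨_, by rintro _ ⟨w, rfl⟩; exact hbdd w⟩) z w
  have hle : ∀ ε > 0, ‖f z‖ ≤ ε * (‖y‖ * ‖x‖) := by
    intro ε hε
    obtain ⟨w, hw, hwε⟩ := hsmall ε hε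
    rw [← hgf z hz, hconst w, hgf w hw]
    calc ‖f w‖ ≤ ‖y‖ * (‖resolventOf T w‖ * ‖x‖) := hfle w
      _ ≤ ‖y‖ * (ε * ‖x‖) := by gcongr
      _ = ε * (‖y‖ * ‖x‖) := by ring
  have h0 : Tendsto (fun ε : ℝ => ε * (‖y‖ * ‖x‖)) (𝓝[>] 0) (𝓝 0) := by
    have : Tendsto (fun ε : ℝ => ε * (‖y‖ * ‖x‖)) (𝓝 0) (𝓝 (0 * (‖y‖ * ‖x‖))) :=
      (continuous_id.mul continuous_const).tendsto 0
    rw [zero_mul] at this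
    exact this.mono_left nhdsWithin_le_nhds
  exact norm_le_zero_iff.1 (ge_of_tendsto h0 (eventually_nhdsWithin_of_forall hle))

theorem completeSequence_range_rieszProjection (hT : Dense (T.domain : Set H)) (hR : ∀ k, 0 < R k)
    (hs : ∀ k, Metric.sphere (c k) (R k) ⊆ resolventSetOf T)
    (hd : Pairwise fun j k =>
      Disjoint (Metric.closedBall (c j) (R j)) (Metric.closedBall (c k) (R k)))
    (hout : ∀ z, (∀ k, z ∉ Metric.ball (c k) (R k)) → z ∈ resolventSetOf T ∧ ‖resolventOf T z‖ ≤ M)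
    (hsmall : ∀ ε > 0, ∃ z ∈ resolventSetOf T, ‖resolventOf T z‖ ≤ ε) :
    CompleteSequence fun k =>
      LinearMap.range (rieszProjection T (c k) (R k) : H →ₗ[ℂ] H) := by
  rw [CompleteSequence, Submodule.topologicalClosure_eq_top_iff, Submodule.eq_bot_iff]
  intro y hy
  rw [Submodule.mem_orthogonal'] at hy
  obtain ⟨z, hz, -⟩ := hsmall 1 one_pos
  refine hT.eq_zero_of_inner_left ℂ fun u hu => ?_
  have hu' := (isResolventAt_resolventOf hz).2 ⟨u, hu⟩
  change _ = u at hu'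
  rw [← hu']
  exact inner_resolventOf_eq_zero hR hs hd hout hsmall
    (fun k v => hy _ (Submodule.mem_iSup_of_mem k ⟨v, rfl⟩)) hz

end RieszSequence

section Perturbation

variable {H : Type*} [NormedAddCommGroup H] [InnerProductSpace ℂ H] [CompleteSpace H]
  {A : H →ₗ.[ℂ] H} {X : H →L[ℂ] H} {c R : ℕ → ℝ} {r : ℝ}

/-- The discs with centres `c k` and radii `R k` are separated, and every point of `σ` lies in one
of them, at a distance of at least `r` from the boundary. -/
structure IsSeparatingFamily (σ : Set ℝ) (c R : ℕ → ℝ) (r : ℝ) : Prop where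
  le_radius : ∀ k, r ≤ R k
  separated : ∀ j k, j < k → c j + R j < c k - R k
  cover : ∀ e ∈ σ, ∃ k, |e - c k| + r ≤ R k

theorem IsSeparatingFamily.disjoint {σ : Set ℝ} (h : IsSeparatingFamily σ c R r) :
    Pairwise fun j k => Disjoint (Metric.closedBall (c j : ℂ) (R j))
      (Metric.closedBall (c k : ℂ) (R k)) := by
  have key : ∀ j k, j < k → Disjoint (Metric.closedBall (c j : ℂ) (R j))
      (Metric.closedBall (c k : ℂ) (R k)) := fun j k hjk => by
    apply Metric.closedBall_disjoint_closedBall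
    rw [dist_comm, Complex.dist_of_im_eq (by simp), Complex.ofReal_re, Complex.ofReal_re]
    have := h.separated j k hjk
    exact lt_of_lt_of_le (by linarith) (le_abs_self _)
  intro j k hjk
  rcases hjk.lt_or_gt with h1 | h1
  · exact key j k h1
  · exact (key k j h1).symm

theorem norm_ofReal_sub_ge {e d : ℝ} {z : ℂ} : ‖z - (d : ℂ)‖ - |e - d| ≤ ‖(e : ℂ) - z‖ := by
  have h1 : ‖z - (d : ℂ)‖ ≤ ‖z - e‖ + ‖(e : ℂ) - d‖ := norm_sub_le_norm_sub_add_norm_sub _ _ _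
  rw [← Complex.ofReal_sub, Complex.norm_real, Real.norm_eq_abs, norm_sub_rev z (e : ℂ)] at h1
  linarith

theorem HasCompactResolvent.omegaLinearIndependent_and_completeSequence
    (hA : HasCompactResolvent A) (h : IsSeparatingFamily (eigenvaluesOf A) c R r) (hX : ‖X‖ < r) :
    OmegaLinearIndependent (fun k =>
        LinearMap.range (rieszProjection (perturb A X) (c k : ℂ) (R k) : H →ₗ[ℂ] H)) ∧
      CompleteSequence (fun k =>
        LinearMap.range (rieszProjection (perturb A X) (c k : ℂ) (R k) : H →ₗ[ℂ] H)) := by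
  have hX0 : 0 ≤ ‖X‖ := norm_nonneg X
  obtain ⟨ρ, hρ1, hρ2⟩ := exists_between hX
  have hR : ∀ k, 0 < R k := fun k => by linarith [h.le_radius k]
  have hlow : ∀ z : ℂ, (∀ k, z ∉ Metric.ball (c k : ℂ) (R k)) →
      ∀ e ∈ eigenvaluesOf A, r ≤ ‖(e : ℂ) - z‖ := by
    intro z hz e he
    obtain ⟨k, hk⟩ := h.cover e he
    have h1 := norm_ofReal_sub_ge (e := e) (d := c k) (z := z)
    have h2 : R k ≤ ‖z - (c k : ℂ)‖ := by
      have := hz k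
      rwa [Metric.mem_ball, not_lt, dist_eq_norm] at this
    linarith
  have hann : ∀ k, Metric.closedBall (c k : ℂ) (R k) \ Metric.ball (c k : ℂ) (R k - (r - ρ)) ⊆
      resolventSetOf (perturb A X) := by
    intro k z hz
    refine hA.mem_resolventSetOf_perturb hρ1 fun e he => ?_
    obtain ⟨j, hj⟩ := h.cover e he
    have h1 := norm_ofReal_sub_ge (e := e) (d := c j) (z := z)
    rcases eq_or_ne k j with rfl | hkj
    · have := hz.2
      rw [Metric.mem_ball, not_lt, dist_eq_norm] at this
      linarith
    · have h3 := disjoint_left.1 (h.disjoint hkj) hz.1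
      rw [Metric.mem_closedBall, not_le, dist_eq_norm] at h3
      linarith
  have hs : ∀ k, Metric.sphere (c k : ℂ) (R k) ⊆ resolventSetOf (perturb A X) := fun k z hz =>
    hann k ⟨Metric.sphere_subset_closedBall hz, fun hz' => by
      rw [Metric.mem_sphere] at hz; rw [Metric.mem_ball] at hz'; linarith⟩
  constructor
  · refine omegaLinearIndependent_range (fun k => ?_) fun j k hjk => ?_
    · exact rieszProjection_mul_self (by linarith [h.le_radius k]) (by linarith) (hann k)
    · exact rieszProjection_mul_of_disjoint (hR j).le (hR k).le (hs j) (hs k) (h.disjoint hjk)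
  · refine completeSequence_range_rieszProjection (M := (r - ‖X‖)⁻¹) hA.isSelfAdjoint.dense_domain
      hR hs h.disjoint (fun z hz => ⟨hA.mem_resolventSetOf_perturb hX (hlow z hz),
        hA.norm_resolventOf_perturb_le hX (hlow z hz)⟩) fun ε hε => ?_
    have hε' : 0 < ε⁻¹ := inv_pos.2 hε
    have hfar : ∀ e ∈ eigenvaluesOf A,
        ‖X‖ + ε⁻¹ ≤ ‖(e : ℂ) - ((‖X‖ + ε⁻¹ : ℝ) : ℂ) * Complex.I‖ := fun e _ => by
      refine le_trans ?_ (Complex.abs_im_le_norm _)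
      rw [Complex.sub_im, Complex.ofReal_im, Complex.im_ofReal_mul, Complex.I_im, mul_one, zero_sub,
        abs_neg]
      exact le_abs_self _
    refine ⟨_, hA.mem_resolventSetOf_perturb (by linarith) hfar,
      (hA.norm_resolventOf_perturb_le (by linarith) hfar).trans ?_⟩
    rw [add_sub_cancel_left, inv_inv]

end Perturbation

section Circles

variable {lam : ℕ → ℝ} {i₀ : ℕ} {r : ℝ}

theorem isSeparatingFamily_circles (hmono : MonotoneOn lam (Ici 1)) (hi₀ : 2 ≤ i₀)
    (hgap : ∀ i ≥ i₀, lam i - lam (i - 1) > 2 * r) :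
    IsSeparatingFamily (lam '' Ici 1) (fun k => circleCenter lam i₀ (indexSeq i₀ k))
      (fun k => circleRadius lam i₀ r (indexSeq i₀ k)) r := by
  have h01 : lam 1 ≤ lam (i₀ - 1) := hmono (by simp) (by simp; omega) (by omega)
  have hc0 : circleCenter lam i₀ (indexSeq i₀ 0) = (lam 1 + lam (i₀ - 1)) / 2 := if_pos rfl
  have hR0 : circleRadius lam i₀ r (indexSeq i₀ 0) = (lam (i₀ - 1) - lam 1) / 2 + r := if_pos rfl
  have hcs : ∀ k, circleCenter lam i₀ (indexSeq i₀ (k + 1)) = lam (i₀ + k) := fun k =>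
    if_neg (by simp only [indexSeq]; omega)
  have hRs : ∀ k, circleRadius lam i₀ r (indexSeq i₀ (k + 1)) = r := fun k =>
    if_neg (by simp only [indexSeq]; omega)
  refine ⟨fun k => ?_, fun j k hjk => ?_, ?_⟩
  · cases k with
    | zero => simp only [hR0]; linarith
    | succ k => simp only [hRs]; exact le_rfl
  · obtain ⟨k, rfl⟩ := Nat.exists_eq_succ_of_ne_zero (by omega : k ≠ 0)
    have h1 := hgap (i₀ + k) (by omega)
    simp only [Nat.succ_eq_add_one, hcs, hRs]
    cases j with
    | zero =>
      have h2 : lam (i₀ - 1) ≤ lam (i₀ + k - 1) :=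
        hmono (by simp; omega) (by simp; omega) (by omega)
      simp only [hc0, hR0]; linarith
    | succ j =>
      have h2 : lam (i₀ + j) ≤ lam (i₀ + k - 1) :=
        hmono (by simp; omega) (by simp; omega) (by omega)
      simp only [hcs, hRs]; linarith
  · rintro _ ⟨i, hi, rfl⟩
    rw [mem_Ici] at hi
    rcases lt_or_ge i i₀ with hlt | hge
    · refine ⟨0, ?_⟩
      have h1 : lam 1 ≤ lam i := hmono (by simp) hi hi
      have h2 : lam i ≤ lam (i₀ - 1) := hmono hi (by simp; omega) (by omega)
      simp only [hc0, hR0]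
      have : |lam i - (lam 1 + lam (i₀ - 1)) / 2| ≤ (lam (i₀ - 1) - lam 1) / 2 :=
        abs_le.2 ⟨by linarith, by linarith⟩
      linarith
    · obtain ⟨k, rfl⟩ := Nat.exists_eq_add_of_le hge
      refine ⟨k + 1, ?_⟩
      simp only [hcs, hRs]
      simp

end Circles

end TransferFunction

theorem mainTheorem7
    {H₀ H₁ : Type*} [NormedAddCommGroup H₀] [InnerProductSpace ℂ H₀] [CompleteSpace H₀]
    [NormedAddCommGroup H₁] [InnerProductSpace ℂ H₁] [CompleteSpace H₁]
    -- the entries of the operator matrix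
    (A₀ : H₀ →ₗ.[ℂ] H₀) (hA₀ : IsSelfAdjoint A₀)
    (A₁ : H₁ →ₗ.[ℂ] H₁) (hA₁ : IsSelfAdjoint A₁)
    (B₀₁ : H₁ →L[ℂ] H₀)
    -- the spectra
    (E : TransferFunction.SpectralMeasure H₀) (hE : E.IsSpectralMeasureOf A₀)
    (hac : E.IsAbsolutelyContinuous)
    (a b : EReal) (hab : a < b)
    (hσ₀ : TransferFunction.spectrumOf A₀ =
      (fun x : ℝ => (x : ℂ)) '' closure (TransferFunction.realInterval a b))
    (hσ₁ : TransferFunction.spectrumOf A₁ ⊆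
      (fun x : ℝ => (x : ℂ)) '' TransferFunction.realInterval a b)
    -- the derivative of `K_B` and its analytic continuation
    (D : Set ℂ) (K' : ℂ → H₁ →L[ℂ] H₁)
    (hK' : TransferFunction.IsContinuedDerivative E B₀₁ a b D K')
    -- the solution `X` of index `l`, constructed with the help of the contour `γ`
    (l : ℤˣ) (γ : ℝ → ℂ)
    (hγ : TransferFunction.IsAdmissibleContour A₁ (TransferFunction.reflect K')
      (TransferFunction.signedDomain D l) a b γ)
    (X : H₁ →L[ℂ] H₁)
    (hX : TransferFunction.IsBasicSolution A₁ (TransferFunction.reflect K') γ X)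
    -- `A₁` has compact resolvent, is semibounded, and has the eigenvalues `lam 1 ≤ lam 2 ≤ …`
    (hcpt : ∀ z ∈ TransferFunction.resolventSetOf A₁,
      IsCompactOperator (TransferFunction.resolventOf A₁ z))
    (hsemi : ∃ c : ℝ, ∀ x : A₁.domain, c * ‖(x : H₁)‖ ^ 2 ≤ (inner ℂ (x : H₁) (A₁ x)).re)
    (lam : ℕ → ℝ) (hmono : MonotoneOn lam (Set.Ici 1))
    (hlam : lam '' Set.Ici 1 = TransferFunction.eigenvaluesOf A₁)
    (hlim : Filter.Tendsto lam Filter.atTop Filter.atTop)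
    -- the gap condition
    (r : ℝ) (hr : TransferFunction.rZero A₁ (TransferFunction.reflect K')
      (TransferFunction.signedDomain D l) a b < r)
    (i₀ : ℕ) (hi₀ : 2 ≤ i₀) (hgap : ∀ i ≥ i₀, lam i - lam (i - 1) > 2 * r) :
    TransferFunction.OmegaLinearIndependent (fun k => TransferFunction.invariantSubspace
        (TransferFunction.perturb A₁ X) lam i₀ r (TransferFunction.indexSeq i₀ k)) ∧
      TransferFunction.CompleteSequence (fun k => TransferFunction.invariantSubspace
        (TransferFunction.perturb A₁ X) lam i₀ r (TransferFunction.indexSeq i₀ k)) := by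
  have hA : TransferFunction.HasCompactResolvent A₁ := by
    refine ⟨hA₁, fun z hz => ?_, hcpt⟩
    obtain ⟨x, -, rfl⟩ := hσ₁ hz
    simp
  have hσ : TransferFunction.eigenvaluesOf A₁ ⊆ TransferFunction.realInterval a b := by
    intro c hc
    obtain ⟨x, hx, hxc⟩ := hσ₁ (TransferFunction.ofReal_mem_spectrumOf hc)
    rwa [← Complex.ofReal_injective hxc]
  obtain ⟨s, hs⟩ := TransferFunction.exists_isExhaustion hlam hlim
  obtain ⟨o, hK⟩ := hK'.exists_isOneSidedContinuation l
  have hXr : ‖X‖ < r := hK.norm_lt_of_rZero_lt hA hσ hs hγ hX hr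
  exact hA.omegaLinearIndependent_and_completeSequence
    (hlam ▸ TransferFunction.isSeparatingFamily_circles hmono hi₀ hgap) hXr
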